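/- \textbf{Model.} Let $V$ be a finite set of $N$ nodes, each blue or red, and let every pair of distinct nodes be neighbours (complete graph). Each node has a choice in $\{0,1\}$. Fix $\alpha,\beta,\delta\in[0,1]$. At each time $k=0,1,2,\dots$ a node $v_k$ is chosen uniformly at random, independently of the past. Let $I$ be $\alpha$ times (number of in-group neighbours of $v_k$ with choice $1$ minus number with choice $0$) minus $\beta$ times (number of out-group neighbours with choice $1$ minus number with choice $0$), divided by the degree of $v_k$. The new choice of $v_k$ is $0$ if $I<-\delta$, it is $1$ if $I>\delta$, and it is unchanged otherwise; all other nodes keep their choices. Let $\theta_k=(\theta^B_k,\theta^R_k)$ be the fractions of nodes with choice $1$ in the blue and in the red group, and let $\theta^{N}(t)=\theta_k$ for $t\in[k/N,(k+1)/N)$. \textbf{Limit equation.} For $r\in(0,1)$ and $\theta=(\theta^B,\theta^R)\in\mathbb R^2$ put $$u(\theta)=\alpha(1-r)(2\theta^B-1)-\beta r(2\theta^R-1),\qquad v(\theta)=\alpha r(2\theta^R-1)-\beta(1-r)(2\theta^B-1),$$ $$g(\theta)=\bigl((1-\theta^B)\mathbf 1_{u>\delta}-\theta^B\mathbf 1_{u<-\delta},\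 (1-\theta^R)\mathbf 1_{v>\delta}-\theta^R\mathbf 1_{v<-\delta}\bigr),\qquad h(x)=\bigcap_{\epsilon>0}\overline{\mathrm{co}}\{g(y):\|y-x\|<\epsilon\}.$$ A Filippov solution on $[0,T]$ is a function $x(t)=x(0)+\int_0^t y(s)\,ds$ with $y$ integrable and $y(s)\in h(x(s))$ for almost every $s$. For a set $S$ of functions on $[0,T]$ let $l_T(z,S)=\inf_{y\in S}\sup_{t\in[0,T]}\|z(t)-y(t)\|$. \textbf{Convergence.} Consider a sequence of such populations, with arbitrary initial choices, in which $N\to\infty$ and the fraction of red nodes tends to $r\in(0,1)$. Let $\mathcal S_T$ be the set of Filippov solutions on $[0,T]$ with initial value in $[0,1]^2$. Then for all $T,\varepsilon>0$, $$\sup_{t'\ge 0}\ \mathbb P\bigl(l_T(\theta^N(t'+\cdot),\mathcal S_T)>\varepsilon\bigr)\to 0 .$$ If moreover $\theta^N(0)\to\theta_0$, then $\mathbb P\bigl(l_T(\theta^N,\mathcal S_T(\theta_0))>\varepsilon\bigr)\to0$, where $\mathcal S_T(\theta_0)$ is the set of Filippov solutions on $[0,T]$ that start at $\theta_0$. \textbf{Uniqueness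 ($\delta=0$).} Call the parameters Case 4 if $\alpha r<\beta(1-r)$ and $\alpha(1-r)<\beta r$ (for $\alpha,\beta>0$ this is $\frac\beta\alpha>\frac r{1-r}>\frac\alpha\beta$). Let $\theta_0\in[0,1]^2$, and suppose that $\theta_0$ does not lie on a part of a discontinuity line that solutions do not cross, that is: if $u(\theta_0)=0$ then $\alpha(1-r)<\beta r$, and if $v(\theta_0)=0$ then $\alpha r<\beta(1-r)$. (This holds in particular whenever $u(\theta_0)\ne0$ and $v(\theta_0)\neq0$, and for every $\theta_0$ in Case 4.) Then there is exactly one Filippov solution on $[0,\infty)$ that starts at $\theta_0$, and every Filippov solution on some $[0,T]$ that starts at $\theta_0$ is its restriction, except when the parameters are in Case 4 and $\theta_0^B=\theta_0^R$. In the exceptional case (Case 4, $\theta_0\in[0,1]^2$, $\theta_0^B=\theta_0^R$) there is $\tau\ge0$ such that all Filippov solutions on $[0,\infty)$ that start at $\theta_0$ coincide on $[0,\tau]$ and are equal to $(\tfrac12,\tfrac12)$ at time $\tau$, and there are two such solutions that differ at some time $t>\tau$. -/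

import Mathlib

open Set Filter Topology MeasureTheory
open scoped ENNReal

noncomputable section

namespace AffectivePolarization

/-! ### The stochastic model on a finite social network

Group membership is a map `party : V → Bool` (`false` is blue, `true` is red) and the current choices
are a map `c : V → Bool` (`false` is choice 0, `true` is choice 1). -/

section Model

variable {V : Type*} [Fintype V]

/-- The number of nodes of group `a`. -/
def groupSize (party : V → Bool) (a : Bool) : ℕ :=
  (Finset.univ.filter fun v => party v = a).card

/-- The fraction of red nodes in the population. -/
def redFraction (party : V → Bool) : ℝ :=
  (groupSize party true : ℝ) / (Fintype.card V : ℝ)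

open Classical in
/-- The number of neighbours of `v`. -/
def numNeighbors (G : SimpleGraph V) (v : V) : ℕ :=
  (Finset.univ.filter fun u => G.Adj v u).card

open Classical in
/-- The number of in-group neighbours of `v` with choice `a`, normalised by the degree of `v`. -/
def inShare (G : SimpleGraph V) (party c : V → Bool) (v : V) (a : Bool) : ℝ :=
  ((Finset.univ.filter fun u => G.Adj v u ∧ party u = party v ∧ c u = a).card : ℝ) /
    (numNeighbors G v : ℝ)

open Classical in
/-- The number of out-group neighbours of `v` with choice `a`, normalised by the degree of `v`. -/
def outShare (G : SimpleGraph V) (party c : V → Bool) (v : V) (a : Bool) : ℝ :=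
  ((Finset.univ.filter fun u => G.Adj v u ∧ party u ≠ party v ∧ c u = a).card : ℝ) /
    (numNeighbors G v : ℝ)

/-- The net influence on `v` in favour of choice 1: in-group love `α`, out-group hate `β`. -/
def influence (α β : ℝ) (G : SimpleGraph V) (party c : V → Bool) (v : V) : ℝ :=
  α * (inShare G party c v true - inShare G party c v false) -
    β * (outShare G party c v true - outShare G party c v false)

open Classical in
/-- The choice of `v` after it has been selected for an update; `δ` is the inertia. -/
def newChoice (α β δ : ℝ) (G : SimpleGraph V) (party c : V → Bool) (v : V) : Bool :=
  if influence α β G party c v < -δ then false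
  else if influence α β G party c v > δ then true
  else c v

open Classical in
/-- The choices when node `ω k` is selected at time `k`, starting from the choices `c₀`. -/
def choices (α β δ : ℝ) (G : SimpleGraph V) (party c₀ : V → Bool) (ω : ℕ → V) : ℕ → V → Bool
  | 0 => c₀
  | k + 1 =>
    Function.update (choices α β δ G party c₀ ω k) (ω k)
      (newChoice α β δ G party (choices α β δ G party c₀ ω k) (ω k))

/-- The fraction of nodes of group `a` that have choice 1. -/
def groupState (party c : V → Bool) (a : Bool) : ℝ :=
  ((Finset.univ.filter fun v => party v = a ∧ c v = true).card : ℝ) / (groupSize party a : ℝ)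

/-- The state: fractions of choice 1 in the blue and in the red group. -/
def state (party c : V → Bool) : ℝ × ℝ :=
  (groupState party c false, groupState party c true)

/-- The piecewise constant interpolation of the state process: with `N` nodes, its value on
`[k / N, (k + 1) / N)` is the state at time `k`. -/
def interpolation (α β δ : ℝ) (G : SimpleGraph V) (party c₀ : V → Bool) (ω : ℕ → V) (t : ℝ) :
    ℝ × ℝ :=
  state party (choices α β δ G party c₀ ω ⌊(Fintype.card V : ℝ) * t⌋₊)

/-- The law of the sequence of selected nodes: independent and uniform on `V`. -/
def selectionLaw (V : Type*) [Fintype V] [Nonempty V] [MeasurableSpace V] : Measure (ℕ → V) :=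
  Measure.infinitePi fun _ : ℕ => (PMF.uniformOfFintype V).toMeasure

end Model

/-! ### The limit mean differential equation and its Filippov solutions

The plane is `ℝ × ℝ`: the first coordinate is the blue state, the second one the red state. -/

/-- The net influence on the blue group at the state `θ`, when `r` is the fraction of red nodes. -/
def blueField (α β r : ℝ) (θ : ℝ × ℝ) : ℝ :=
  α * (1 - r) * (2 * θ.1 - 1) - β * r * (2 * θ.2 - 1)

/-- The net influence on the red group at the state `θ`. -/
def redField (α β r : ℝ) (θ : ℝ × ℝ) : ℝ :=
  α * r * (2 * θ.2 - 1) - β * (1 - r) * (2 * θ.1 - 1)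

open Classical in
/-- The discontinuous right-hand side of the limit mean differential equation. -/
def meanField (α β δ r : ℝ) (θ : ℝ × ℝ) : ℝ × ℝ :=
  ((1 - θ.1) * (if blueField α β r θ > δ then 1 else 0) -
      θ.1 * (if blueField α β r θ < -δ then 1 else 0),
    (1 - θ.2) * (if redField α β r θ > δ then 1 else 0) -
      θ.2 * (if redField α β r θ < -δ then 1 else 0))

/-- The Filippov set-valued map of `g`: the intersection over `ε > 0` of the closed convex hulls of
the images under `g` of the `ε`-balls around `x`. -/
def filippovMap (g : ℝ × ℝ → ℝ × ℝ) (x : ℝ × ℝ) : Set (ℝ × ℝ) :=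
  ⋂ ε > (0 : ℝ), closedConvexHull ℝ (g '' Metric.ball x ε)

/-- `x` is a solution on `[0, T]` of the differential inclusion `x' ∈ filippovMap g x`. -/
def IsFilippovSolutionOn (g : ℝ × ℝ → ℝ × ℝ) (T : ℝ) (x : ℝ → ℝ × ℝ) : Prop :=
  ∃ y : ℝ → ℝ × ℝ, IntegrableOn y (Icc 0 T) ∧
    (∀ᵐ s ∂(volume.restrict (Icc 0 T)), y s ∈ filippovMap g (x s)) ∧
    ∀ t ∈ Icc 0 T, x t = x 0 + ∫ s in (0 : ℝ)..t, y s

/-- `x` is a solution on `[0, ∞)` of the differential inclusion `x' ∈ filippovMap g x`. -/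
def IsFilippovSolution (g : ℝ × ℝ → ℝ × ℝ) (x : ℝ → ℝ × ℝ) : Prop :=
  ∀ T : ℝ, 0 ≤ T → IsFilippovSolutionOn g T x

/-- The solution set on `[0, T]`, with initial values in `K`. -/
def solutionSet (g : ℝ × ℝ → ℝ × ℝ) (T : ℝ) (K : Set (ℝ × ℝ)) : Set (ℝ → ℝ × ℝ) :=
  {x | x 0 ∈ K ∧ IsFilippovSolutionOn g T x}

/-- The distance of a trajectory `z` from a set `S` of trajectories, uniform on `[0, T]`. -/
def distToSet (T : ℝ) (z : ℝ → ℝ × ℝ) (S : Set (ℝ → ℝ × ℝ)) : ℝ≥0∞ :=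
  ⨅ y ∈ S, ⨆ t ∈ Icc (0 : ℝ) T, edist (z t) (y t)

/-- The parameters are in Case 4: `β / α > r / (1 - r) > α / β`, in a division-free form. -/
def IsCase4 (α β r : ℝ) : Prop :=
  α * r < β * (1 - r) ∧ α * (1 - r) < β * r

end AffectivePolarization

end

/-!
The proof has two independent halves, joined by the notion of an approximate solution.

*Convergence.* On a complete graph the influence on a node depends only on its group, its own
choice and the two group states, so the mean increment of the state is explicit (`drift_eq`). It
differs from the limit mean field in two ways: the group proportions are not yet the limit ones,
and no node counts as its own neighbour, so that near a discontinuity members of the same group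
with different choices may react differently. Nevertheless the mean increment is close to the
closed convex hull of the values of the mean field at nearby states (`exists_near_drift`). For
`α ≠ β` this holds because the two fields are independent linear coordinates, so the reactions
of the two groups can be averaged separately. For `α = β` the fields are opposite to each other, and
there is one exceptional situation, in which all nodes of both groups would switch. It forces the
difference of the two group balances to vanish; the next step makes this difference nonzero, and
from then on it keeps its sign, so that the exception occurs at one time at most
(`exists_index_isCritical`) and costs only `O(1 / N)`.

The increments minus their means are orthogonal and of size `O(1 / N)`. Chebyshev's inequality on
a grid of bounded size, with the Lipschitz bound between grid points, makes their sums small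
uniformly on a window (`measure_exists_sum_gt_le`). So with high probability, uniformly in the
position of the window, the process is an `IsApproxSolution`: over any time interval during which
it stays in a small ball, its increment is close to the length of the interval times a point of
the closed convex hull of the mean field near that ball. Bounded families of such functions
converge along ultrafilters; the difference quotients of the limit lie in the closed convex hulls,
so the limit is a Filippov solution (`IsApproxSolution.limit`, `exists_approx_precision`). The
same compactness, applied to Euler polygons, gives the existence of Filippov solutions
(`exists_isFilippovSolutionOn`).

*Uniqueness without inertia.* With `P = eᵗ (2 θᴮ - 1)` and `Q = eᵗ (2 θᴿ - 1)` the inclusion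
becomes `P' = eᵗ σ`, `Q' = eᵗ τ`, where `σ` and `τ` are the signs of two linear forms in `P` and
`Q` (`IsSignSolution`). Solutions are unique as soon as these signs are determined at almost every
time by the initial value (`uniqueFrom_of_signs`). If love dominates in a group, the sign of its
form persists, since the form cannot decrease in absolute value. If hate dominates, the form is
driven through zero at a known speed and changes sign at a time that can be computed from the
initial value (`IsSignSolution.crossing_of_pos`, `IsSignSolution.crossing_of_case4`). If hate
dominates in both groups, this needs `P ≠ Q`, and then `|P - Q|` never decreases.

On the diagonal, if hate dominates in both groups, both shares move towards `1 / 2` until they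
reach the centre (`diagonal_solution_eq`). There the explicit solution `branch` and its mirror
image turn off to different sides.
-/

/-! ### Absolutely continuous functions and Filippov solutions -/

theorem AbsolutelyContinuousOnInterval.congr_uIcc {f g : ℝ → ℝ} {a b : ℝ}
    (hf : AbsolutelyContinuousOnInterval f a b) (h : EqOn f g (uIcc a b)) :
    AbsolutelyContinuousOnInterval g a b := by
  rw [absolutelyContinuousOnInterval_iff] at hf ⊢
  intro ε hε
  obtain ⟨δ, hδ, H⟩ := hf ε hε
  refine ⟨δ, hδ, fun E hE hlt => ?_⟩
  have h' := H E hE hlt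
  refine lt_of_eq_of_lt (Finset.sum_congr rfl fun i hi => ?_) h'
  have := hE.1 i hi
  rw [h this.1, h this.2]

namespace AffectivePolarization

/-- An absolutely continuous curve is a Filippov solution if, at almost every time, any derivative
that it has lies in the Filippov set. -/
theorem isFilippovSolutionOn_of_ae {g : ℝ × ℝ → ℝ × ℝ} {T : ℝ} (hT : 0 ≤ T) {x : ℝ → ℝ × ℝ}
    (h1 : AbsolutelyContinuousOnInterval (fun t => (x t).1) 0 T)
    (h2 : AbsolutelyContinuousOnInterval (fun t => (x t).2) 0 T)
    (h : ∀ᵐ t, t ∈ Ioo 0 T → ∀ w, HasDerivAt x w t → w ∈ filippovMap g (x t)) :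
    IsFilippovSolutionOn g T x := by
  have i1 := h1.intervalIntegrable_deriv
  have i2 := h2.intervalIntegrable_deriv
  refine ⟨fun t => (deriv (fun t => (x t).1) t, deriv (fun t => (x t).2) t), ?_, ?_, ?_⟩
  · rw [integrableOn_Icc_iff_integrableOn_Ioc]
    exact ((intervalIntegrable_iff_integrableOn_Ioc_of_le hT).1 i1).prodMk
      ((intervalIntegrable_iff_integrableOn_Ioc_of_le hT).1 i2)
  · rw [ae_restrict_iff' measurableSet_Icc]
    have e0 : ∀ᵐ t : ℝ, t ≠ 0 := by simp [ae_iff, measure_singleton]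
    have e1 : ∀ᵐ t : ℝ, t ≠ T := by simp [ae_iff, measure_singleton]
    filter_upwards [h, h1.ae_differentiableAt, h2.ae_differentiableAt, e0, e1]
      with t ht d1 d2 n0 n1 hmem
    rw [uIcc_of_le hT] at d1 d2
    exact ht ⟨lt_of_le_of_ne hmem.1 n0.symm, lt_of_le_of_ne hmem.2 n1⟩ _
      ((d1 hmem).hasDerivAt.prodMk (d2 hmem).hasDerivAt)
  · intro t ht
    have hsub : uIcc 0 t ⊆ uIcc 0 T := by
      rw [uIcc_of_le hT, uIcc_of_le ht.1]; exact Icc_subset_Icc le_rfl ht.2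
    have j1 := (h1.mono hsub).intervalIntegrable_deriv
    have j2 := (h2.mono hsub).intervalIntegrable_deriv
    have I1 := (h1.mono hsub).integral_deriv_eq_sub
    have I2 := (h2.mono hsub).integral_deriv_eq_sub
    have : ∫ s in (0:ℝ)..t, (deriv (fun t => (x t).1) s, deriv (fun t => (x t).2) s) =
        ((x t).1 - (x 0).1, (x t).2 - (x 0).2) := by
      rw [← I1, ← I2]
      rw [intervalIntegral.integral_of_le ht.1, intervalIntegral.integral_of_le ht.1,
        intervalIntegral.integral_of_le ht.1]
      exact integral_pair ((intervalIntegrable_iff_integrableOn_Ioc_of_le ht.1).1 j1)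
        ((intervalIntegrable_iff_integrableOn_Ioc_of_le ht.1).1 j2)
    rw [this]
    ext <;> simp

/-- A Filippov solution is absolutely continuous, and almost everywhere it has a derivative, which
lies in the Filippov set. -/
theorem IsFilippovSolutionOn.absolutelyContinuous_and_ae {g : ℝ × ℝ → ℝ × ℝ} {T : ℝ} (hT : 0 ≤ T)
    {x : ℝ → ℝ × ℝ} (hx : IsFilippovSolutionOn g T x) :
    AbsolutelyContinuousOnInterval (fun t => (x t).1) 0 T ∧
    AbsolutelyContinuousOnInterval (fun t => (x t).2) 0 T ∧
    ∀ᵐ t, t ∈ Ioo 0 T → ∃ w ∈ filippovMap g (x t),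
      HasDerivAt (fun t => (x t).1) w.1 t ∧ HasDerivAt (fun t => (x t).2) w.2 t := by
  obtain ⟨y, hy, hmem, hint⟩ := hx
  have i1 : IntervalIntegrable (fun s => (y s).1) volume 0 T := by
    rw [intervalIntegrable_iff_integrableOn_Ioc_of_le hT, ← integrableOn_Icc_iff_integrableOn_Ioc]
    exact hy.fst
  have i2 : IntervalIntegrable (fun s => (y s).2) volume 0 T := by
    rw [intervalIntegrable_iff_integrableOn_Ioc_of_le hT, ← integrableOn_Icc_iff_integrableOn_Ioc]
    exact hy.snd
  have hyi : ∀ t ∈ Icc 0 T, IntegrableOn y (Ioc 0 t) := fun t ht =>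
    hy.mono_set (Ioc_subset_Icc_self.trans (Icc_subset_Icc le_rfl ht.2))
  have e1 : ∀ t ∈ Icc 0 T, (x t).1 = (x 0).1 + ∫ s in (0:ℝ)..t, (y s).1 := by
    intro t ht
    rw [hint t ht, intervalIntegral.integral_of_le ht.1, intervalIntegral.integral_of_le ht.1,
      Prod.fst_add, fst_integral (hyi t ht)]
  have e2 : ∀ t ∈ Icc 0 T, (x t).2 = (x 0).2 + ∫ s in (0:ℝ)..t, (y s).2 := by
    intro t ht
    rw [hint t ht, intervalIntegral.integral_of_le ht.1, intervalIntegral.integral_of_le ht.1,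
      Prod.snd_add, snd_integral (hyi t ht)]
  have hconst : ∀ c : ℝ, AbsolutelyContinuousOnInterval (fun _ => c) 0 T := fun c =>
    ((LipschitzWith.const c).lipschitzOnWith (s := uIcc 0 T)).absolutelyContinuousOnInterval
  have key : ∀ (f z : ℝ → ℝ), IntervalIntegrable z volume 0 T →
      (∀ t ∈ Icc 0 T, f t = f 0 + ∫ s in (0:ℝ)..t, z s) →
      AbsolutelyContinuousOnInterval f 0 T ∧
        ∀ᵐ t, t ∈ Ioo 0 T → HasDerivAt f (z t) t := by
    intro f z hz hf
    constructor
    · refine ((hconst (f 0)).add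
        (hz.absolutelyContinuousOnInterval_intervalIntegral (c := 0) (by simp))).congr_uIcc ?_
      rw [uIcc_of_le hT]
      intro t ht
      exact (hf t ht).symm
    · filter_upwards [hz.ae_hasDerivAt_integral] with t ht hmem
      rw [uIcc_of_le hT] at ht
      have := (ht (Ioo_subset_Icc_self hmem) 0 ⟨le_rfl, hT⟩).const_add (f 0)
      refine this.congr_of_eventuallyEq ?_
      filter_upwards [Ioo_mem_nhds hmem.1 hmem.2] with s hs
      exact hf s (Ioo_subset_Icc_self hs)
  obtain ⟨a1, d1⟩ := key _ _ i1 e1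
  obtain ⟨a2, d2⟩ := key _ _ i2 e2
  refine ⟨a1, a2, ?_⟩
  rw [ae_restrict_iff' measurableSet_Icc] at hmem
  filter_upwards [d1, d2, hmem] with t h1 h2 h3 ht
  exact ⟨y t, h3 (Ioo_subset_Icc_self ht), h1 ht, h2 ht⟩

theorem IsFilippovSolutionOn.congr {g : ℝ × ℝ → ℝ × ℝ} {T : ℝ} {x z : ℝ → ℝ × ℝ}
    (hx : IsFilippovSolutionOn g T x) (h : EqOn x z (Icc 0 T)) : IsFilippovSolutionOn g T z := by
  obtain ⟨y, hy, hmem, hint⟩ := hx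
  refine ⟨y, hy, ?_, fun t ht => ?_⟩
  · rw [ae_restrict_iff' measurableSet_Icc] at hmem ⊢
    filter_upwards [hmem] with s hs hsT
    rw [← h hsT]; exact hs hsT
  · rw [← h ht, ← h ⟨le_rfl, ht.1.trans ht.2⟩, hint t ht]

/-! ### Approximate solutions and their limits -/

/-- `z` is an approximate solution on `[0, T]` with precision `η`: it is Lipschitz up to the error
`η`, and as long as it stays in a ball of radius `ρ ≥ η` around a point `x`, its increments are, up
to the error `η`, those of a motion whose velocity is an average of values of `g` near `x`.  Neither
continuity nor differentiability of `z` is required. -/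
structure IsApproxSolution (g : ℝ × ℝ → ℝ × ℝ) (T C η : ℝ) (z : ℝ → ℝ × ℝ) : Prop where
  dist_le : ∀ s ∈ Icc 0 T, ∀ t ∈ Icc 0 T, ‖z t - z s‖ ≤ C * |t - s| + η
  increment : ∀ (x : ℝ × ℝ) (ρ : ℝ), η ≤ ρ → ∀ s t, 0 ≤ s → s ≤ t → t ≤ T →
    (∀ τ ∈ Icc s t, z τ ∈ Metric.ball x ρ) →
    ∃ w ∈ closedConvexHull ℝ (g '' Metric.ball x (2 * ρ)), ‖z t - z s - (t - s) • w‖ ≤ η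

/-- Approximate solutions that converge pointwise along an ultrafilter, with precision tending to
`0`, converge uniformly to a Filippov solution. -/
theorem IsApproxSolution.limit {ι : Type*} (𝒰 : Ultrafilter ι) {g : ℝ × ℝ → ℝ × ℝ} {T C : ℝ}
    (hT : 0 ≤ T) (hC : 0 ≤ C) {η : ι → ℝ} (hη : Tendsto η 𝒰 (𝓝 0)) {z : ι → ℝ → ℝ × ℝ}
    (hz : ∀ i, IsApproxSolution g T C (η i) (z i)) {x : ℝ → ℝ × ℝ}
    (hx : ∀ t ∈ Icc 0 T, Tendsto (fun i => z i t) 𝒰 (𝓝 (x t))) :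
    IsFilippovSolutionOn g T x ∧ ∀ ε > 0, ∀ᶠ i in 𝒰, ∀ t ∈ Icc 0 T, dist (z i t) (x t) ≤ ε := by
  have hlip : ∀ s ∈ Icc 0 T, ∀ t ∈ Icc 0 T, ‖x t - x s‖ ≤ C * |t - s| := by
    intro s hs t ht
    have h1 : Tendsto (fun i => ‖z i t - z i s‖) 𝒰 (𝓝 ‖x t - x s‖) :=
      ((hx t ht).sub (hx s hs)).norm
    have h2 : Tendsto (fun i => C * |t - s| + η i) 𝒰 (𝓝 (C * |t - s| + 0)) :=
      tendsto_const_nhds.add hη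
    rw [add_zero] at h2
    exact le_of_tendsto_of_tendsto' h1 h2 fun i => (hz i).dist_le s hs t ht
  have hunif : ∀ ε > 0, ∀ᶠ i in 𝒰, ∀ t ∈ Icc 0 T, dist (z i t) (x t) ≤ ε := by
    intro ε hε
    -- control at the points of a finite net of mesh `h`, and the Lipschitz bound between them
    set h : ℝ := ε / (8 * (C + 1)) with hh
    have hhpos : 0 < h := by positivity
    have hCh : C * h ≤ ε / 8 := by
      rw [hh, mul_div_assoc', div_le_div_iff₀ (by positivity) (by positivity)]
      nlinarith
    obtain ⟨S, hSfin, hcov⟩ := Metric.totallyBounded_iff.1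
      (isCompact_Icc (a := (0 : ℝ)) (b := T)).totallyBounded h hhpos
    have hev : ∀ᶠ i in 𝒰, ∀ s ∈ hSfin.toFinset, ∀ p ∈ Icc 0 T, |p - s| < h →
        dist (z i p) (x p) < ε := by
      rw [Filter.eventually_all_finset]
      intro s _
      by_cases hs : ∃ p ∈ Icc 0 T, |p - s| < h
      · obtain ⟨p, hp, hps⟩ := hs
        have h1 := (Metric.tendsto_nhds.1 (hx p hp)) (ε / 8) (by positivity)
        have h2 := (Metric.tendsto_nhds.1 hη) (ε / 8) (by positivity)
        filter_upwards [h1, h2] with i hi hi2 q hq hqs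
        have hd : |q - p| ≤ 2 * h := by
          rw [abs_le]; rw [abs_lt] at hps hqs; constructor <;> linarith
        have a1 := (hz i).dist_le p hp q hq
        have a2 := hlip p hp q hq
        have a3 : C * |q - p| ≤ ε / 4 := by nlinarith [abs_nonneg (q - p)]
        have a4 : η i < ε / 8 := by
          rw [Real.dist_eq, sub_zero] at hi2; exact (abs_lt.1 hi2).2
        rw [← dist_eq_norm] at a1 a2
        have t1 := dist_triangle4 (z i q) (z i p) (x p) (x q)
        rw [dist_comm (x p)] at t1
        linarith
      · push Not at hs
        exact Eventually.of_forall fun i q hq hqs => absurd hqs (not_lt.2 (hs q hq))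
    filter_upwards [hev] with i hi t ht
    have := hcov ht
    simp only [mem_iUnion, Metric.mem_ball, Real.dist_eq] at this
    obtain ⟨s, hs, hts⟩ := this
    exact (hi s (hSfin.mem_toFinset.2 hs) t ht hts).le
  refine ⟨?_, hunif⟩
  have hL : LipschitzOnWith ⟨C, hC⟩ x (uIcc 0 T) := by
    rw [uIcc_of_le hT]
    refine LipschitzOnWith.of_dist_le_mul fun s hs t ht => ?_
    rw [dist_eq_norm, Real.dist_eq]; exact hlip t ht s hs
  refine isFilippovSolutionOn_of_ae hT ?_ ?_ (Eventually.of_forall fun s hs w hw => ?_)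
  · have := LipschitzWith.prod_fst.comp_lipschitzOnWith hL
    exact this.absolutelyContinuousOnInterval
  · have := LipschitzWith.prod_snd.comp_lipschitzOnWith hL
    exact this.absolutelyContinuousOnInterval
  -- for each `ε` the difference quotients to the right of `s` lie in the closed convex hull, as
  -- limits of points at distance at most `(t - s)⁻¹ η i` from it
  rw [filippovMap, mem_iInter₂]
  intro ε hε
  set K := closedConvexHull ℝ (g '' Metric.ball (x s) ε) with hK
  have hKc : IsClosed K := isClosed_closedConvexHull
  have hKne : K.Nonempty :=
    ⟨g (x s), subset_closedConvexHull ⟨x s, Metric.mem_ball_self hε, rfl⟩⟩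
  have hquot : ∀ᶠ t in 𝓝[>] s, slope x s t ∈ K := by
    have hcont := hw.continuousAt
    obtain ⟨d, hd, hball⟩ := Metric.continuousAt_iff.1 hcont (ε / 8) (by positivity)
    have hm : Ioo s (min (s + d) T) ∈ 𝓝[>] s :=
      Ioo_mem_nhdsGT (lt_min (by linarith) hs.2)
    filter_upwards [hm] with t ht
    have hst : s < t := ht.1
    have htT : t < T := ht.2.trans_le (min_le_right _ _)
    have htd : t < s + d := ht.2.trans_le (min_le_left _ _)
    have h1 : Tendsto (fun i => (t - s)⁻¹ • (z i t - z i s)) 𝒰 (𝓝 (slope x s t)) := by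
      rw [slope_def_module]
      exact ((hx t ⟨hs.1.le.trans hst.le, htT.le⟩).sub
        (hx s (Ioo_subset_Icc_self hs))).const_smul _
    have h2 : ∀ᶠ i in 𝒰, Metric.infDist ((t - s)⁻¹ • (z i t - z i s)) K ≤ (t - s)⁻¹ * η i := by
      have hη2 := (Metric.tendsto_nhds.1 hη) (ε / 2) (by positivity)
      filter_upwards [hunif (ε / 8) (by positivity), hη2] with i hi hηi
      rw [Real.dist_eq, sub_zero] at hηi
      obtain ⟨v, hv, hve⟩ := (hz i).increment (x s) (ε / 2) (abs_lt.1 hηi).2.le s t hs.1.le hst.le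
        htT.le (by
          intro τ hτ
          have a1 := hi τ ⟨hs.1.le.trans hτ.1, hτ.2.trans htT.le⟩
          have a2 := hball (x := τ) (by
            rw [Real.dist_eq, abs_of_nonneg (by linarith [hτ.1])]; linarith [hτ.2])
          rw [Metric.mem_ball]
          linarith [dist_triangle (z i τ) (x τ) (x s)])
      rw [mul_div_cancel₀ _ (two_ne_zero' ℝ)] at hv
      refine (Metric.infDist_le_dist_of_mem hv).trans ?_
      have hne : t - s ≠ 0 := by linarith
      have : (t - s)⁻¹ • (z i t - z i s) - v = (t - s)⁻¹ • (z i t - z i s - (t - s) • v) := by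
        rw [smul_sub (t - s)⁻¹ (z i t - z i s), smul_smul, inv_mul_cancel₀ hne, one_smul]
      rw [dist_eq_norm, this, norm_smul, Real.norm_eq_abs, abs_of_pos (inv_pos.2 (by linarith))]
      exact mul_le_mul_of_nonneg_left hve (inv_nonneg.2 (by linarith))
    have h3 : Tendsto (fun i => Metric.infDist ((t - s)⁻¹ • (z i t - z i s)) K) 𝒰
        (𝓝 (Metric.infDist (slope x s t) K)) :=
      ((Metric.continuous_infDist_pt K).tendsto _).comp h1
    have h4 : Tendsto (fun i => (t - s)⁻¹ * η i) 𝒰 (𝓝 ((t - s)⁻¹ * 0)) := hη.const_mul _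
    rw [mul_zero] at h4
    have h5 := le_of_tendsto_of_tendsto h3 h4 h2
    rw [hKc.mem_iff_infDist_zero hKne]
    exact le_antisymm h5 Metric.infDist_nonneg
  have hsl : Tendsto (slope x s) (𝓝[>] s) (𝓝 w) :=
    (hasDerivAt_iff_tendsto_slope.1 hw).mono_left (nhdsWithin_mono _ fun t ht => ne_of_gt ht)
  exact hKc.mem_of_tendsto hsl hquot

/-- Approximate solutions that start near a compact set are uniformly close to Filippov solutions
that start in it. -/
theorem exists_approx_precision {g : ℝ × ℝ → ℝ × ℝ} {T C ε : ℝ} (hT : 0 ≤ T) (hC : 0 ≤ C)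
    (hε : 0 < ε) {K : Set (ℝ × ℝ)} (hK : IsCompact K) :
    ∃ η > 0, ∀ z, IsApproxSolution g T C η z → (∃ p ∈ K, dist (z 0) p ≤ η) →
      ∃ x ∈ solutionSet g T K, ∀ t ∈ Icc 0 T, dist (z t) (x t) ≤ ε := by
  -- otherwise a sequence of counterexamples has a limit along an ultrafilter, by boundedness
  by_contra hcon
  push Not at hcon
  choose z hz hp hfar using fun n : ℕ => hcon (1 / ((n : ℝ) + 1)) (by positivity)
  choose p hpK hdist using hp
  set 𝒰 : Ultrafilter ℕ := hyperfilter ℕ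
  have hη : Tendsto (fun n : ℕ => 1 / ((n : ℝ) + 1)) 𝒰 (𝓝 0) :=
    tendsto_one_div_add_atTop_nhds_zero_nat.mono_left Nat.hyperfilter_le_atTop
  obtain ⟨p₀, hp₀, hlim⟩ := hK.ultrafilter_le_nhds (𝒰.map p)
    (by rw [Ultrafilter.coe_map, le_principal_iff, mem_map]; exact univ_mem' hpK)
  have hlim' : Tendsto p 𝒰 (𝓝 p₀) := hlim
  obtain ⟨R, hR⟩ := hK.isBounded.subset_closedBall (0 : ℝ × ℝ)
  have hbound : ∀ t ∈ Icc 0 T, ∃ q, Tendsto (fun n => z n t) 𝒰 (𝓝 q) := by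
    intro t ht
    have hmem : ∀ n, z n t ∈ Metric.closedBall (0 : ℝ × ℝ) (R + 1 + (C * |t| + 1)) := by
      intro n
      have hn : 1 / ((n : ℝ) + 1) ≤ 1 := by
        rw [div_le_one (by positivity)]; linarith [n.cast_nonneg (α := ℝ)]
      have a1 := (hz n).dist_le 0 ⟨le_rfl, hT⟩ t ht
      rw [← dist_eq_norm, sub_zero] at a1
      have a2 := hR (hpK n)
      rw [Metric.mem_closedBall] at a2 ⊢
      have a3 := dist_triangle4 (z n t) (z n 0) (p n) 0
      linarith [hdist n]
    obtain ⟨q, -, hq⟩ := (isCompact_closedBall (0 : ℝ × ℝ)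
      (R + 1 + (C * |t| + 1))).ultrafilter_le_nhds (𝒰.map fun n => z n t)
      (by rw [Ultrafilter.coe_map, le_principal_iff, mem_map]; exact univ_mem' hmem)
    exact ⟨q, hq⟩
  choose! x hx using hbound
  obtain ⟨hsol, hunif⟩ := IsApproxSolution.limit 𝒰 hT hC hη hz hx
  have hx0 : x 0 = p₀ := by
    have h0 := hx 0 ⟨le_rfl, hT⟩
    have h1 : Tendsto (fun n => dist (z n 0) (p n)) 𝒰 (𝓝 (dist (x 0) p₀)) := h0.dist hlim'
    have h2 := le_of_tendsto_of_tendsto' h1 hη hdist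
    exact dist_le_zero.1 h2
  obtain ⟨n, hn⟩ := (hunif ε hε).exists
  obtain ⟨t, ht, htε⟩ := hfar n x ⟨hx0 ▸ hp₀, hsol⟩
  exact absurd (hn t ht) (not_le.2 htε)

end AffectivePolarization

namespace AffectivePolarization

/-! ### Sampled paths as approximate solutions -/

/-- A sequence of states, sampled with time step `1 / N`, is an approximate solution if its
increments are, up to a small accumulated error, `1 / N` times averages `w` of values of `g` near
the current state.  The velocities `d` may differ much from `w` at a single index `j₀`, which costs
`3 / N`; the remaining `6 / N` of the term `9 / N` account for the rounding of times to multiples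
of `1 / N`. -/
theorem isApproxSolution_of_steps {g : ℝ × ℝ → ℝ × ℝ} {T C η e ν t' : ℝ} {N : ℕ} (hN : 0 < N)
    (ht' : 0 ≤ t') (hC : 0 ≤ C) (he : 0 ≤ e)
    {Θ d w : ℕ → ℝ × ℝ} (hstep : ∀ k, ‖Θ (k + 1) - Θ k‖ ≤ C / N)
    (hw : ∀ j, w j ∈ closedConvexHull ℝ (g '' Metric.ball (Θ j) η)) (hw2 : ∀ j, ‖w j‖ ≤ 2)
    (hd3 : ∀ j, ‖d j - w j‖ ≤ 3) {j₀ : ℕ} (hd : ∀ j, j ≠ j₀ → ‖d j - w j‖ ≤ e)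
    (hnoise : ∀ j k : ℕ, ⌊N * t'⌋₊ ≤ j → j ≤ k → (k : ℝ) ≤ N * (t' + T) →
      ‖Θ k - Θ j - (N : ℝ)⁻¹ • ∑ i ∈ Finset.Ico j k, d i‖ ≤ ν)
    (hCη : C / N ≤ η) (hη : ν + (T + 1) * e + 9 / N ≤ η) :
    IsApproxSolution g T C η (fun t => Θ ⌊(N : ℝ) * (t' + t)⌋₊) := by
  have hNr : (0 : ℝ) < N := Nat.cast_pos.2 hN
  have hN1 : (1 : ℝ) ≤ N := by exact_mod_cast hN
  have hlip : ∀ j k : ℕ, j ≤ k → ‖Θ k - Θ j‖ ≤ C / N * ((k : ℝ) - j) := by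
    intro j k hjk
    induction k, hjk using Nat.le_induction with
    | base => simp
    | succ k hk ih =>
      have : Θ (k + 1) - Θ j = (Θ (k + 1) - Θ k) + (Θ k - Θ j) := by abel
      rw [this]
      refine (norm_add_le _ _).trans ?_
      push_cast
      nlinarith [hstep k]
  have hfl : ∀ s t : ℝ, 0 ≤ s → s ≤ t →
      ⌊(N : ℝ) * (t' + s)⌋₊ ≤ ⌊(N : ℝ) * (t' + t)⌋₊ ∧
      |((⌊(N : ℝ) * (t' + t)⌋₊ : ℝ) - ⌊(N : ℝ) * (t' + s)⌋₊) - N * (t - s)| ≤ 1 := by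
    intro s t hs hst
    have h1 : (N : ℝ) * (t' + s) ≤ N * (t' + t) := by gcongr
    refine ⟨Nat.floor_mono h1, ?_⟩
    have a1 := Nat.floor_le (a := (N : ℝ) * (t' + s)) (by positivity)
    have a2 := Nat.lt_floor_add_one ((N : ℝ) * (t' + s))
    have a3 := Nat.floor_le (a := (N : ℝ) * (t' + t)) (le_trans (by positivity) h1)
    have a4 := Nat.lt_floor_add_one ((N : ℝ) * (t' + t))
    rw [abs_le]
    constructor <;> nlinarith
  constructor
  · have main : ∀ s t : ℝ, 0 ≤ s → s ≤ t →
        ‖Θ ⌊(N : ℝ) * (t' + t)⌋₊ - Θ ⌊(N : ℝ) * (t' + s)⌋₊‖ ≤ C * |t - s| + η := by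
      intro s t hs hst
      obtain ⟨hle, habs⟩ := hfl s t hs hst
      refine (hlip _ _ hle).trans ?_
      rw [abs_of_nonneg (sub_nonneg.2 hst)]
      have h1 := (abs_le.1 habs).2
      calc C / N * ((⌊(N : ℝ) * (t' + t)⌋₊ : ℝ) - ⌊(N : ℝ) * (t' + s)⌋₊)
          ≤ C / N * (N * (t - s) + 1) := by gcongr; linarith
        _ = C * (t - s) + C / N := by field_simp
        _ ≤ _ := by linarith
    intro s hs t ht
    rcases le_total s t with h | h
    · exact main s t hs.1 h
    · rw [norm_sub_rev, abs_sub_comm]; exact main t s ht.1 h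
  · intro x ρ hρ s t hs hst htT hball
    obtain ⟨hle, habs⟩ := hfl s t hs hst
    have hK1T : (⌊(N : ℝ) * (t' + t)⌋₊ : ℝ) ≤ N * (t' + T) :=
      (Nat.floor_le (by have := hs.trans hst; positivity)).trans (by gcongr)
    have hK0 : ⌊(N : ℝ) * t'⌋₊ ≤ ⌊(N : ℝ) * (t' + s)⌋₊ := Nat.floor_mono (by gcongr; linarith)
    have hK1 : (⌊(N : ℝ) * (t' + t)⌋₊ : ℝ) ≤ N * (t' + t) :=
      Nat.floor_le (by have := hs.trans hst; positivity)
    have hK0s := Nat.lt_floor_add_one ((N : ℝ) * (t' + s))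
    -- every index of the window is visited by the sampled path
    have hvisit : ∀ j, ⌊(N : ℝ) * (t' + s)⌋₊ ≤ j → j ≤ ⌊(N : ℝ) * (t' + t)⌋₊ →
        Θ j ∈ Metric.ball x ρ := by
      intro j h0 h1
      rcases h0.eq_or_lt with h0 | h0
      · rw [← h0]; exact hball s ⟨le_rfl, hst⟩
      · have hj0 : (⌊(N : ℝ) * (t' + s)⌋₊ : ℝ) + 1 ≤ j := by exact_mod_cast h0
        have hj1 : (j : ℝ) ≤ ⌊(N : ℝ) * (t' + t)⌋₊ := by exact_mod_cast h1
        have e1 : (N : ℝ) * (t' + (j / N - t')) = j := by field_simp; ring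
        have := hball (j / N - t') ⟨by rw [le_sub_iff_add_le, le_div_iff₀ hNr]; nlinarith,
          by rw [sub_le_iff_le_add, div_le_iff₀ hNr]; nlinarith⟩
        simp only [e1, Nat.floor_natCast] at this
        exact this
    generalize hk0 : ⌊(N : ℝ) * (t' + s)⌋₊ = k₀ at *
    generalize hk1 : ⌊(N : ℝ) * (t' + t)⌋₊ = k₁ at *
    have hcard : ((Finset.Ico k₀ (k₁ + 1)).card : ℝ) = k₁ - k₀ + 1 := by
      rw [Nat.card_Ico, Nat.cast_sub (by omega)]; push_cast; ring
    have hkr : (k₀ : ℝ) ≤ k₁ := by exact_mod_cast hle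
    set n : ℝ := k₁ - k₀ + 1 with hn
    have hnpos : 0 < n := by linarith
    set v : ℝ × ℝ := ∑ i ∈ Finset.Ico k₀ (k₁ + 1), n⁻¹ • w i with hv
    have hsum1 : ∑ i ∈ Finset.Ico k₀ (k₁ + 1), n⁻¹ = 1 := by
      rw [Finset.sum_const, nsmul_eq_mul, hcard, mul_inv_cancel₀ hnpos.ne']
    refine ⟨v, ?_, ?_⟩
    · refine convex_closedConvexHull.sum_mem (fun _ _ => (inv_pos.2 hnpos).le) hsum1
        fun i hi => ?_
      rw [Finset.mem_Ico] at hi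
      refine (closedConvexHull ℝ).monotone (image_mono ?_) (hw i)
      have := hvisit i hi.1 (by omega)
      rw [Metric.mem_ball] at this
      exact Metric.ball_subset_ball' (by linarith)
    · have hnv : n • v = ∑ i ∈ Finset.Ico k₀ k₁, w i + w k₁ := by
        rw [hv, ← Finset.smul_sum, smul_smul, mul_inv_cancel₀ hnpos.ne', one_smul,
          Finset.sum_Ico_succ_top hle]
      have hv2 : ‖v‖ ≤ 2 := by
        calc ‖v‖ ≤ ∑ i ∈ Finset.Ico k₀ (k₁ + 1), n⁻¹ * 2 :=
              norm_sum_le_of_le _ fun i _ => by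
                rw [norm_smul, Real.norm_eq_abs, abs_of_pos (inv_pos.2 hnpos)]
                exact mul_le_mul_of_nonneg_left (hw2 i) (inv_pos.2 hnpos).le
          _ = 2 := by rw [← Finset.sum_mul, hsum1, one_mul]
      have hdw : ‖∑ i ∈ Finset.Ico k₀ k₁, (d i - w i)‖ ≤ (k₁ - k₀) * e + 3 := by
        calc ‖∑ i ∈ Finset.Ico k₀ k₁, (d i - w i)‖
            ≤ ∑ i ∈ Finset.Ico k₀ k₁, (e + if i = j₀ then 3 else 0) :=
              norm_sum_le_of_le _ fun i _ => by
                split_ifs with h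
                · linarith [hd3 i]
                · linarith [hd i h]
          _ ≤ _ := by
              rw [Finset.sum_add_distrib, Finset.sum_const, Nat.card_Ico, nsmul_eq_mul,
                Nat.cast_sub hle, Finset.sum_ite_eq']
              split_ifs <;> linarith
      have hdec : Θ k₁ - Θ k₀ - (t - s) • v =
          (Θ k₁ - Θ k₀ - (N : ℝ)⁻¹ • ∑ i ∈ Finset.Ico k₀ k₁, d i) +
          (N : ℝ)⁻¹ • ∑ i ∈ Finset.Ico k₀ k₁, (d i - w i) +
          ((n / N - (t - s)) • v - (N : ℝ)⁻¹ • w k₁) := by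
        have : (n / N) • v = (N : ℝ)⁻¹ • (∑ i ∈ Finset.Ico k₀ k₁, w i + w k₁) := by
          rw [← hnv, smul_smul, div_eq_inv_mul]
        rw [sub_smul (n / N), this, Finset.sum_sub_distrib, smul_sub, smul_add]
        abel
      have hnN : |n / N - (t - s)| ≤ 2 / N := by
        have : n / N - (t - s) = ((k₁ - k₀ : ℝ) - N * (t - s) + 1) / N := by
          rw [hn]; field_simp; ring
        rw [this, abs_div, abs_of_pos hNr]
        gcongr
        rw [abs_le] at habs ⊢
        constructor <;> linarith
      have hNinv : ‖(N : ℝ)⁻¹‖ = (N : ℝ)⁻¹ := by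
        rw [Real.norm_eq_abs, abs_of_pos (inv_pos.2 hNr)]
      have b2 : ‖(N : ℝ)⁻¹ • ∑ i ∈ Finset.Ico k₀ k₁, (d i - w i)‖ ≤ (T + 1) * e + 3 / N := by
        rw [norm_smul, hNinv]
        have h1 : (k₁ - k₀ : ℝ) ≤ N * (T + 1) := by
          have := (abs_le.1 habs).2
          nlinarith
        calc (N : ℝ)⁻¹ * ‖∑ i ∈ Finset.Ico k₀ k₁, (d i - w i)‖
            ≤ (N : ℝ)⁻¹ * (N * (T + 1) * e + 3) := by gcongr; nlinarith
          _ = _ := by field_simp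
      have b3 : ‖(n / N - (t - s)) • v - (N : ℝ)⁻¹ • w k₁‖ ≤ 6 / N := by
        refine (norm_sub_le _ _).trans ?_
        rw [norm_smul, norm_smul, hNinv, Real.norm_eq_abs]
        calc |n / N - (t - s)| * ‖v‖ + (N : ℝ)⁻¹ * ‖w k₁‖ ≤ 2 / N * 2 + (N : ℝ)⁻¹ * 2 := by
              gcongr; exact hw2 _
          _ = 6 / N := by field_simp; norm_num
      have b1 := hnoise k₀ k₁ hK0 hle hK1T
      show ‖Θ k₁ - Θ k₀ - (t - s) • v‖ ≤ η
      rw [hdec]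
      have c1 := norm_add₃_le (a := Θ k₁ - Θ k₀ - (N : ℝ)⁻¹ • ∑ i ∈ Finset.Ico k₀ k₁, d i)
        (b := (N : ℝ)⁻¹ • ∑ i ∈ Finset.Ico k₀ k₁, (d i - w i))
        (c := (n / N - (t - s)) • v - (N : ℝ)⁻¹ • w k₁)
      have : (9 : ℝ) / N = 3 / N + 6 / N := by ring
      linarith

end AffectivePolarization

namespace AffectivePolarization

/-! ### Existence of Filippov solutions -/

theorem mem_unitSquare {x : ℝ × ℝ} :
    x ∈ Icc (0 : ℝ × ℝ) 1 ↔ (0 ≤ x.1 ∧ x.1 ≤ 1) ∧ (0 ≤ x.2 ∧ x.2 ≤ 1) := by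
  simp only [mem_Icc, Prod.le_def, Prod.fst_zero, Prod.snd_zero, Prod.fst_one, Prod.snd_one]
  tauto

/-- Solutions exist from every point of the unit square, as limits of Euler polygons, if the
full Euler step does not leave the square. -/
theorem exists_isFilippovSolutionOn {g : ℝ × ℝ → ℝ × ℝ}
    (hg : ∀ x ∈ Icc (0 : ℝ × ℝ) 1, x + g x ∈ Icc (0 : ℝ × ℝ) 1) {T : ℝ} (hT : 0 ≤ T) {θ₀ : ℝ × ℝ}
    (hθ₀ : θ₀ ∈ Icc (0 : ℝ × ℝ) 1) : ∃ x, x 0 = θ₀ ∧ IsFilippovSolutionOn g T x := by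
  obtain ⟨η, hη, H⟩ := exists_approx_precision (g := g) (T := T) (C := 1) (ε := 1) hT zero_le_one
    one_pos (isCompact_singleton (x := θ₀))
  obtain ⟨N, hN⟩ := exists_nat_gt (max 1 (9 / η))
  have hN1 : (1 : ℝ) < N := (le_max_left _ _).trans_lt hN
  have hNη : 9 / (N : ℝ) ≤ η := by
    rw [div_le_iff₀ (by linarith)]
    have := (le_max_right _ _).trans_lt hN
    rw [div_lt_iff₀ hη] at this
    linarith
  have hN0 : (0 : ℝ) < N := by linarith
  set Θ : ℕ → ℝ × ℝ := fun k => Nat.rec θ₀ (fun _ x => x + (N : ℝ)⁻¹ • g x) k with hΘ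
  have hsucc : ∀ k, Θ (k + 1) = Θ k + (N : ℝ)⁻¹ • g (Θ k) := fun k => rfl
  have hmem : ∀ k, Θ k ∈ Icc (0 : ℝ × ℝ) 1 := by
    intro k
    induction k with
    | zero => exact hθ₀
    | succ k ih =>
      rw [hsucc]
      have h1 : (N : ℝ)⁻¹ ≤ 1 := inv_le_one_of_one_le₀ hN1.le
      have := (convex_Icc (0 : ℝ × ℝ) 1) ih (hg _ ih) (sub_nonneg.2 h1) (inv_pos.2 hN0).le
        (by ring)
      convert this using 1
      rw [sub_smul, one_smul, smul_add]; abel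
  have hnorm : ∀ k, ‖g (Θ k)‖ ≤ 1 := by
    intro k
    have h1 := mem_unitSquare.1 (hmem k)
    have h2 := mem_unitSquare.1 (hg _ (hmem k))
    simp only [Prod.fst_add, Prod.snd_add] at h2
    rw [Prod.norm_def, max_le_iff, Real.norm_eq_abs, Real.norm_eq_abs, abs_le, abs_le]
    refine ⟨⟨?_, ?_⟩, ?_, ?_⟩ <;> linarith
  have hsum : ∀ j k : ℕ, j ≤ k → Θ k - Θ j = (N : ℝ)⁻¹ • ∑ i ∈ Finset.Ico j k, g (Θ i) := by
    intro j k hjk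
    induction k, hjk using Nat.le_induction with
    | base => simp
    | succ k hk ih =>
      rw [Finset.sum_Ico_succ_top hk, smul_add, ← ih, hsucc]; abel
  have happ := isApproxSolution_of_steps (g := g) (T := T) (C := 1) (η := η) (e := 0) (ν := 0)
    (t' := 0) (N := N) (by exact_mod_cast hN0) le_rfl zero_le_one le_rfl (Θ := Θ)
    (d := fun k => g (Θ k)) (w := fun k => g (Θ k))
    (fun k => by
      rw [hsucc, add_sub_cancel_left, norm_smul, Real.norm_eq_abs, abs_of_pos (inv_pos.2 hN0),
        one_div]
      exact mul_le_of_le_one_right (inv_pos.2 hN0).le (hnorm k))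
    (fun j => subset_closedConvexHull ⟨Θ j, Metric.mem_ball_self hη, rfl⟩)
    (fun j => (hnorm j).trans one_le_two) (fun j => by simp) (j₀ := 0) (fun j _ => by simp)
    (fun j k _ hjk _ => by rw [hsum j k hjk]; simp)
    (le_trans (by gcongr; norm_num) hNη) (by simpa using hNη)
  obtain ⟨x, hx, -⟩ := H _ happ ⟨θ₀, rfl, by simpa [hΘ] using hη.le⟩
  exact ⟨x, hx.1, hx.2⟩

/-- A full Euler step moves each coordinate to `0` or `1`, or not at all. -/
theorem add_meanField_mem {α β δ r : ℝ} (hδ : 0 ≤ δ) {x : ℝ × ℝ} (hx : x ∈ Icc (0 : ℝ × ℝ) 1) :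
    x + meanField α β δ r x ∈ Icc (0 : ℝ × ℝ) 1 := by
  rw [mem_unitSquare] at hx ⊢
  simp only [meanField, Prod.fst_add, Prod.snd_add]
  split_ifs <;> first | (exfalso; linarith) | (refine ⟨⟨?_, ?_⟩, ?_, ?_⟩ <;> linarith)

theorem norm_meanField_le {α β δ r : ℝ} (hδ : 0 ≤ δ) {x : ℝ × ℝ} (hx : x ∈ Icc (0 : ℝ × ℝ) 1) :
    ‖meanField α β δ r x‖ ≤ 1 := by
  have h2 := mem_unitSquare.1 (add_meanField_mem (α := α) (β := β) (r := r) hδ hx)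
  rw [mem_unitSquare] at hx
  simp only [Prod.fst_add, Prod.snd_add] at h2
  rw [Prod.norm_def, max_le_iff, Real.norm_eq_abs, Real.norm_eq_abs, abs_le, abs_le]
  refine ⟨⟨?_, ?_⟩, ?_, ?_⟩ <;> linarith

/-! ### The mean increment of the process and the Filippov set -/

/-- The mean velocity of the share `θ` of choice 1 in a group, when the members with choice 0 feel
the influence `I₀` and those with choice 1 the influence `I₁`.  The two differ slightly, because no
node counts as its own neighbour. -/
noncomputable def groupDrift (δ θ I₀ I₁ : ℝ) : ℝ :=
  (1 - θ) * (if I₀ > δ then 1 else 0) - θ * (if I₁ < -δ then 1 else 0)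

theorem meanField_eq_groupDrift (α β δ r : ℝ) (θ : ℝ × ℝ) :
    meanField α β δ r θ =
      (groupDrift δ θ.1 (blueField α β r θ) (blueField α β r θ),
        groupDrift δ θ.2 (redField α β r θ) (redField α β r θ)) := rfl

theorem abs_groupDrift_le {δ θ : ℝ} (hθ : 0 ≤ θ ∧ θ ≤ 1) (I₀ I₁ : ℝ) :
    |groupDrift δ θ I₀ I₁| ≤ 1 := by
  unfold groupDrift
  rw [abs_le]
  split_ifs <;> constructor <;> linarith [hθ.1, hθ.2]

theorem abs_groupDrift_sub_le {δ u : ℝ} (hδ : 0 ≤ δ) (θ y : ℝ) :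
    |groupDrift δ θ u u - groupDrift δ y u u| ≤ |θ - y| := by
  have h := neg_abs_le (θ - y)
  have h' := le_abs_self (θ - y)
  unfold groupDrift
  rw [abs_le]
  split_ifs
  · linarith
  all_goals constructor <;> linarith

/-- The drift of a group is an average of its values at two nearby levels `u₁`, `u₂` of a common
influence.  If members of both choices switch, the weight is `1 - θ`. -/
theorem exists_groupDrift_eq {δ θ u κ I₀ I₁ : ℝ} (hδ : 0 ≤ δ) (hθ : 0 ≤ θ ∧ θ ≤ 1)
    (h0 : |I₀ - u| ≤ κ) (h1 : |I₁ - u| ≤ κ) :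
    ∃ l u₁ u₂ : ℝ, (0 ≤ l ∧ l ≤ 1) ∧ |u₁ - u| ≤ κ ∧ |u₂ - u| ≤ κ ∧
      groupDrift δ θ I₀ I₁ = l * groupDrift δ θ u₁ u₁ + (1 - l) * groupDrift δ θ u₂ u₂ := by
  rcases lt_or_ge δ I₀ with hA | hA <;> rcases lt_or_ge I₁ (-δ) with hB | hB
  · -- members of both choices switch: the drift `1 - 2 θ` averages `1 - θ` and `-θ`
    refine ⟨1 - θ, I₀, I₁, ⟨by linarith, by linarith⟩, h0, h1, ?_⟩
    simp only [groupDrift, gt_iff_lt, hA, hB, if_true, if_neg (show ¬ I₀ < -δ by linarith),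
      if_neg (show ¬ δ < I₁ by linarith)]
    ring
  · refine ⟨1, I₀, I₀, ⟨zero_le_one, le_rfl⟩, h0, h0, ?_⟩
    simp only [groupDrift, gt_iff_lt, hA, if_neg (not_lt.2 hB), if_true,
      if_neg (show ¬ I₀ < -δ by linarith)]
    ring
  · refine ⟨1, I₁, I₁, ⟨zero_le_one, le_rfl⟩, h1, h1, ?_⟩
    simp only [groupDrift, gt_iff_lt, hB, if_neg (not_lt.2 hA), if_true,
      if_neg (show ¬ δ < I₁ by linarith)]
    ring
  · -- nobody switches: the point of `[-δ, δ]` closest to `u` is within `κ` of `u`, since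
    -- `I₀ ≤ δ` and `-δ ≤ I₁` are
    have hκ := (abs_nonneg _).trans h0
    rw [abs_le] at h0 h1
    have hc : |max (-δ) (min δ u) - u| ≤ κ := by
      rcases le_total δ u with h | h
      · rw [min_eq_left h, max_eq_right (by linarith), abs_le]; constructor <;> linarith
      · rw [min_eq_right h]
        rcases le_total (-δ) u with h' | h'
        · rw [max_eq_right h', sub_self, abs_zero]; exact hκ
        · rw [max_eq_left h', abs_le]; constructor <;> linarith
    refine ⟨1, max (-δ) (min δ u), max (-δ) (min δ u), ⟨zero_le_one, le_rfl⟩, hc, hc, ?_⟩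
    have e1 : ¬ δ < max (-δ) (min δ u) := not_lt.2 (max_le (by linarith) (min_le_left _ _))
    have e2 : ¬ max (-δ) (min δ u) < -δ := not_lt.2 (le_max_left _ _)
    simp only [groupDrift, gt_iff_lt, if_neg (not_lt.2 hA), if_neg (not_lt.2 hB), if_neg e1,
      if_neg e2]
    ring

/-- For `α ≠ β` the two fields are independent linear coordinates of the plane, so that they can be
prescribed at a nearby point. -/
theorem exists_field_eq {α β r : ℝ} (hα : α ∈ Icc (0 : ℝ) 1) (hβ : β ∈ Icc (0 : ℝ) 1)
    (hr : r ∈ Ioo (0 : ℝ) 1) (hne : α ≠ β) {η : ℝ} (hη : 0 < η) :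
    ∃ κ > 0, ∀ (θ : ℝ × ℝ) (u v : ℝ), |u - blueField α β r θ| ≤ κ → |v - redField α β r θ| ≤ κ →
      ∃ y ∈ Metric.ball θ η, blueField α β r y = u ∧ redField α β r y = v := by
  obtain ⟨hr0, hr1⟩ := hr
  have hq : 0 < 1 - r := by linarith
  have hdet : (α ^ 2 - β ^ 2) * (r * (1 - r)) ≠ 0 := by
    have h1 : α + β ≠ 0 := fun h => hne (by linarith [hα.1, hβ.1])
    have h2 : α - β ≠ 0 := sub_ne_zero.2 hne
    have : α ^ 2 - β ^ 2 = (α + β) * (α - β) := by ring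
    rw [this]; positivity
  set Δ := (α ^ 2 - β ^ 2) * (r * (1 - r)) with hΔ
  have hΔ' : 0 < |Δ| := abs_pos.2 hdet
  refine ⟨|Δ| * (η / 2), by positivity, fun θ u v hu hv => ?_⟩
  set a := u - blueField α β r θ with ha
  set b := v - redField α β r θ with hb
  have bound : ∀ s t : ℝ, 0 ≤ s → s ≤ 1 → 0 ≤ t → t ≤ 1 → |(s * a + t * b) / (2 * Δ)| < η := by
    intro s t hs hs1 ht ht1
    rw [abs_div, abs_mul, abs_two, div_lt_iff₀ (by positivity)]
    calc |s * a + t * b| ≤ |s * a| + |t * b| := abs_add_le _ _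
      _ ≤ |Δ| * (η / 2) + |Δ| * (η / 2) := by
          rw [abs_mul, abs_mul, abs_of_nonneg hs, abs_of_nonneg ht]
          exact add_le_add ((mul_le_of_le_one_left (abs_nonneg _) hs1).trans hu)
            ((mul_le_of_le_one_left (abs_nonneg _) ht1).trans hv)
      _ < η * (2 * |Δ|) := by nlinarith
  have hp : ∀ c ρ : ℝ, c ∈ Icc (0 : ℝ) 1 → 0 < ρ → ρ < 1 → 0 ≤ c * ρ ∧ c * ρ ≤ 1 := by
    intro c ρ hc h0 h1
    exact ⟨mul_nonneg hc.1 h0.le, mul_le_one₀ hc.2 h0.le h1.le⟩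
  -- the shift of `θ` is the solution of the linear system, by Cramer's rule
  refine ⟨(θ.1 + (α * r * a + β * r * b) / (2 * Δ),
    θ.2 + (β * (1 - r) * a + α * (1 - r) * b) / (2 * Δ)), ?_, ?_, ?_⟩
  · rw [Metric.mem_ball, Prod.dist_eq, max_lt_iff, Real.dist_eq, Real.dist_eq]
    simp only [add_sub_cancel_left]
    exact ⟨bound _ _ (hp α r hα hr0 hr1).1 (hp α r hα hr0 hr1).2 (hp β r hβ hr0 hr1).1
      (hp β r hβ hr0 hr1).2, bound _ _ (hp β _ hβ hq (by linarith)).1 (hp β _ hβ hq (by linarith)).2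
      (hp α _ hα hq (by linarith)).1 (hp α _ hα hq (by linarith)).2⟩
  · have : u = blueField α β r θ + a := by rw [ha]; ring
    rw [this]
    simp only [blueField]
    have : α * (1 - r) * (2 * ((α * r * a + β * r * b) / (2 * Δ))) -
        β * r * (2 * ((β * (1 - r) * a + α * (1 - r) * b) / (2 * Δ))) = a := by
      field_simp
      rw [hΔ]; ring
    linarith
  · have : v = redField α β r θ + b := by rw [hb]; ring
    rw [this]
    simp only [redField]
    have : α * r * (2 * ((β * (1 - r) * a + α * (1 - r) * b) / (2 * Δ))) -
        β * (1 - r) * (2 * ((α * r * a + β * r * b) / (2 * Δ))) = b := by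
      field_simp
      rw [hΔ]; ring
    linarith

theorem dist_pair_le {a b c d η : ℝ} (h1 : |a - c| ≤ η) (h2 : |b - d| ≤ η) :
    ‖(a, b) - (c, d)‖ ≤ η := by
  rw [Prod.norm_def, max_le_iff]
  exact ⟨h1, h2⟩

theorem abs_average_sub_le {l a b c d η : ℝ} (hl : 0 ≤ l ∧ l ≤ 1) (h1 : |a - c| ≤ η)
    (h2 : |b - d| ≤ η) : |l * a + (1 - l) * b - (l * c + (1 - l) * d)| ≤ η := by
  rw [abs_le] at *
  constructor <;> nlinarith [hl.1, hl.2]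

/-- The drift at a state is close to the convex hull of the nearby values of the mean field, if
`α ≠ β`: the thresholds of the two groups are crossed independently of each other. -/
theorem exists_near_drift_of_ne {α β δ r : ℝ} (hα : α ∈ Icc (0 : ℝ) 1) (hβ : β ∈ Icc (0 : ℝ) 1)
    (hr : r ∈ Ioo (0 : ℝ) 1) (hδ : 0 ≤ δ) (hne : α ≠ β) {η : ℝ} (hη : 0 < η) :
    ∃ κ > 0, ∀ θ ∈ Icc (0 : ℝ × ℝ) 1, ∀ I₀ I₁ J₀ J₁ : ℝ,
      |I₀ - blueField α β r θ| ≤ κ → |I₁ - blueField α β r θ| ≤ κ →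
      |J₀ - redField α β r θ| ≤ κ → |J₁ - redField α β r θ| ≤ κ →
      ∃ w ∈ closedConvexHull ℝ (meanField α β δ r '' Metric.ball θ η),
        ‖(groupDrift δ θ.1 I₀ I₁, groupDrift δ θ.2 J₀ J₁) - w‖ ≤ η := by
  obtain ⟨κ, hκ, H⟩ := exists_field_eq hα hβ hr hne hη
  refine ⟨κ, hκ, fun θ hθ I₀ I₁ J₀ J₁ hI0 hI1 hJ0 hJ1 => ?_⟩
  obtain ⟨hθ1, hθ2⟩ := mem_unitSquare.1 hθ
  obtain ⟨l, u₁, u₂, hl, hu1, hu2, eu⟩ := exists_groupDrift_eq hδ hθ1 hI0 hI1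
  obtain ⟨m, v₁, v₂, hm, hv1, hv2, ev⟩ := exists_groupDrift_eq hδ hθ2 hJ0 hJ1
  have near : ∀ u v, |u - blueField α β r θ| ≤ κ → |v - redField α β r θ| ≤ κ →
      ∃ p ∈ closedConvexHull ℝ (meanField α β δ r '' Metric.ball θ η),
        |groupDrift δ θ.1 u u - p.1| ≤ η ∧ |groupDrift δ θ.2 v v - p.2| ≤ η := by
    intro u v hu hv
    obtain ⟨y, hy, hyu, hyv⟩ := H θ u v hu hv
    refine ⟨_, subset_closedConvexHull ⟨y, hy, rfl⟩, ?_⟩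
    rw [meanField_eq_groupDrift, hyu, hyv]
    rw [Metric.mem_ball, dist_comm, Prod.dist_eq, max_lt_iff, Real.dist_eq, Real.dist_eq] at hy
    exact ⟨(abs_groupDrift_sub_le hδ _ _).trans hy.1.le,
      (abs_groupDrift_sub_le hδ _ _).trans hy.2.le⟩
  obtain ⟨p11, h11, a11, b11⟩ := near u₁ v₁ hu1 hv1
  obtain ⟨p12, h12, a12, b12⟩ := near u₁ v₂ hu1 hv2
  obtain ⟨p21, h21, a21, b21⟩ := near u₂ v₁ hu2 hv1
  obtain ⟨p22, h22, a22, b22⟩ := near u₂ v₂ hu2 hv2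
  have hm' := sub_nonneg.2 hm.2
  have hl' := sub_nonneg.2 hl.2
  have conv := convex_closedConvexHull (𝕜 := ℝ) (s := meanField α β δ r '' Metric.ball θ η)
  refine ⟨_, conv (conv h11 h12 hm.1 hm' (by ring)) (conv h21 h22 hm.1 hm' (by ring)) hl.1 hl'
    (by ring), ?_⟩
  rw [eu, ev]
  refine dist_pair_le ?_ ?_
  · simp only [Prod.fst_add, Prod.smul_fst, smul_eq_mul]
    refine abs_average_sub_le hl ?_ ?_
    · have := abs_average_sub_le hm a11 a12
      rwa [← add_mul, add_sub_cancel, one_mul] at this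
    · have := abs_average_sub_le hm a21 a22
      rwa [← add_mul, add_sub_cancel, one_mul] at this
  · simp only [Prod.snd_add, Prod.smul_snd, smul_eq_mul]
    have h1 := abs_average_sub_le hm b11 b12
    have h2 := abs_average_sub_le hm b21 b22
    have := abs_average_sub_le hl h1 h2
    rwa [← add_mul l, add_sub_cancel, one_mul] at this

/-- For `α = β` the two fields are opposite to each other.  The drift is still close to the
convex hull of the nearby values of the mean field, unless all members of both groups switch. -/
theorem exists_near_drift_of_eq {α δ r : ℝ} (hα : α ∈ Icc (0 : ℝ) 1)
    (hr : r ∈ Ioo (0 : ℝ) 1) (hδ : 0 ≤ δ) {η : ℝ} (hη : 0 < η) :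
    ∃ κ > 0, ∀ θ ∈ Icc (0 : ℝ × ℝ) 1, ∀ I₀ I₁ : ℝ, (α = 0 → I₀ = 0 ∧ I₁ = 0) →
      |I₀ - blueField α α r θ| ≤ κ → |I₁ - blueField α α r θ| ≤ κ → ¬ (δ < I₀ ∧ I₁ < -δ) →
      ∃ w ∈ closedConvexHull ℝ (meanField α α δ r '' Metric.ball θ η),
        ‖(groupDrift δ θ.1 I₀ I₁, groupDrift δ θ.2 (-I₁) (-I₀)) - w‖ ≤ η := by
  have hvu : ∀ y, redField α α r y = -blueField α α r y := by
    intro y; simp only [redField, blueField]; ring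
  have hq : 0 < 1 - r := by linarith [hr.2]
  -- a nearby point at which the blue field has a prescribed value; for `α = 0` the field vanishes
  have shift : ∃ κ > 0, ∀ (θ : ℝ × ℝ) (u : ℝ), (α = 0 → u = 0) → |u - blueField α α r θ| ≤ κ →
      ∃ y ∈ Metric.ball θ η, blueField α α r y = u := by
    rcases hα.1.eq_or_lt with h0 | hpos
    · refine ⟨1, one_pos, fun θ u hu _ => ⟨θ, Metric.mem_ball_self hη, ?_⟩⟩
      rw [hu h0.symm, ← h0]; simp [blueField]
    · refine ⟨α * (1 - r) * η, by positivity, fun θ u _ hu => ?_⟩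
      set a := u - blueField α α r θ with ha
      refine ⟨(θ.1 + a / (2 * (α * (1 - r))), θ.2), ?_, ?_⟩
      · rw [Metric.mem_ball, Prod.dist_eq, max_lt_iff, Real.dist_eq, dist_self]
        simp only [add_sub_cancel_left]
        refine ⟨?_, hη⟩
        have hb : 0 < α * (1 - r) := by positivity
        rw [abs_div, abs_of_pos (by positivity : 0 < 2 * (α * (1 - r))),
          div_lt_iff₀ (by positivity)]
        nlinarith
      · have : u = blueField α α r θ + a := by rw [ha]; ring
        rw [this]
        simp only [blueField]
        have : α * (1 - r) * (2 * (a / (2 * (α * (1 - r))))) = a := by field_simp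
        linarith
  obtain ⟨κ, hκ, H⟩ := shift
  refine ⟨κ, hκ, fun θ hθ I₀ I₁ hz h0 h1 hnot => ?_⟩
  suffices hu : ∃ u, (α = 0 → u = 0) ∧ |u - blueField α α r θ| ≤ κ ∧
      groupDrift δ θ.1 I₀ I₁ = groupDrift δ θ.1 u u ∧
      groupDrift δ θ.2 (-I₁) (-I₀) = groupDrift δ θ.2 (-u) (-u) by
    obtain ⟨u, hu0, huκ, e1, e2⟩ := hu
    obtain ⟨y, hy, hyu⟩ := H θ u hu0 huκ
    refine ⟨_, subset_closedConvexHull ⟨y, hy, rfl⟩, ?_⟩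
    rw [meanField_eq_groupDrift, hvu, hyu, e1, e2]
    rw [Metric.mem_ball, dist_comm, Prod.dist_eq, max_lt_iff, Real.dist_eq, Real.dist_eq] at hy
    exact dist_pair_le ((abs_groupDrift_sub_le hδ _ _).trans hy.1.le)
      ((abs_groupDrift_sub_le hδ _ _).trans hy.2.le)
  rcases lt_or_ge δ I₀ with hA | hA
  · have hB : ¬ I₁ < -δ := fun h => hnot ⟨hA, h⟩
    refine ⟨I₀, fun h => (hz h).1, h0, ?_, ?_⟩
    · simp only [groupDrift, gt_iff_lt, hA, if_true, if_neg hB,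
        if_neg (show ¬ I₀ < -δ by linarith)]
    · simp only [groupDrift, gt_iff_lt, if_neg (show ¬ δ < -I₁ by linarith),
        if_neg (show ¬ δ < -I₀ by linarith)]
  · rcases lt_or_ge I₁ (-δ) with hB | hB
    · refine ⟨I₁, fun h => (hz h).2, h1, ?_, ?_⟩
      · simp only [groupDrift, gt_iff_lt, hB, if_true, if_neg (not_lt.2 hA),
          if_neg (show ¬ δ < I₁ by linarith)]
      · simp only [groupDrift, if_neg (show ¬ -I₀ < -δ by linarith),
          if_neg (show ¬ -I₁ < -δ by linarith)]
    · -- nobody switches: clamp the field to `[-δ, δ]`, where both drifts vanish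
      have hκ' := (abs_nonneg _).trans h0
      set u := blueField α α r θ with hu
      have hc : |max (-δ) (min δ u) - u| ≤ κ := by
        rw [abs_le] at h0 h1
        rcases le_total δ u with h | h
        · rw [min_eq_left h, max_eq_right (by linarith), abs_le]; constructor <;> linarith
        · rw [min_eq_right h]
          rcases le_total (-δ) u with h' | h'
          · rw [max_eq_right h', sub_self, abs_zero]; exact hκ'
          · rw [max_eq_left h', abs_le]; constructor <;> linarith
      have e1 : max (-δ) (min δ u) ≤ δ := max_le (by linarith) (min_le_left _ _)
      have e2 : -δ ≤ max (-δ) (min δ u) := le_max_left _ _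
      refine ⟨max (-δ) (min δ u), fun h => ?_, hc, ?_, ?_⟩
      · have : u = 0 := by rw [hu, h]; simp [blueField]
        rw [this, min_eq_right hδ, max_eq_right (by linarith)]
      · simp only [groupDrift, gt_iff_lt, if_neg (not_lt.2 hA), if_neg (not_lt.2 hB),
          if_neg (not_lt.2 e1), if_neg (not_lt.2 e2)]
      · simp only [groupDrift, gt_iff_lt, if_neg (show ¬ δ < -I₁ by linarith),
          if_neg (show ¬ -I₀ < -δ by linarith),
          if_neg (show ¬ δ < -max (-δ) (min δ u) by linarith),
          if_neg (show ¬ -max (-δ) (min δ u) < -δ by linarith)]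

end AffectivePolarization

namespace AffectivePolarization

/-! ### One step of the process on a complete graph -/

section OneStep

variable {V : Type*} [Fintype V]

/-- A choice as a sign: `1` for choice 1 and `-1` for choice 0. -/
def sign (b : Bool) : ℤ := if b then 1 else -1

/-- The number of members of group `a` with choice 1 minus the number of those with choice 0. -/
def balance (party c : V → Bool) (a : Bool) : ℤ :=
  ∑ v, if party v = a then sign (c v) else 0

/-- The influence that a member of group `a` with choice `e` feels on a complete graph: its own
choice does not count. -/
noncomputable def memberInfluence (α β : ℝ) (party c : V → Bool) (a e : Bool) : ℝ :=
  (α * (balance party c a - sign e) - β * balance party c (!a)) / ((Fintype.card V : ℝ) - 1)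

theorem groupSize_eq_sum (party : V → Bool) (a : Bool) :
    (groupSize party a : ℝ) = ∑ v, if party v = a then (1 : ℝ) else 0 := by
  rw [groupSize, Finset.sum_boole]

theorem groupSize_add (party : V → Bool) :
    groupSize party false + groupSize party true = Fintype.card V := by
  have h := Finset.card_filter_add_card_filter_not (s := (Finset.univ : Finset V))
    (fun v => party v = false)
  simp only [Bool.not_eq_false] at h
  exact h

theorem groupState_eq (party c : V → Bool) (a : Bool) :
    groupState party c a = (balance party c a + groupSize party a) / (2 * groupSize party a) := by
  have h : (2 : ℝ) * ((Finset.univ.filter fun v => party v = a ∧ c v = true).card : ℝ) =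
      balance party c a + groupSize party a := by
    rw [← Finset.sum_boole, groupSize_eq_sum, balance, Int.cast_sum, ← Finset.sum_add_distrib,
      Finset.mul_sum]
    refine Finset.sum_congr rfl fun v _ => ?_
    by_cases h1 : party v = a <;> cases h2 : c v <;> simp [h1, sign]; norm_num
  rw [groupState, ← h, mul_div_mul_left _ _ two_ne_zero]

theorem groupState_mem (party c : V → Bool) (a : Bool) :
    0 ≤ groupState party c a ∧ groupState party c a ≤ 1 := by
  refine ⟨by unfold groupState; positivity, div_le_one_of_le₀ ?_ (Nat.cast_nonneg _)⟩
  refine Nat.cast_le.2 (Finset.card_le_card fun v hv => ?_)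
  simp only [Finset.mem_filter, Finset.mem_univ, true_and] at hv ⊢
  exact hv.1

theorem state_mem (party c : V → Bool) : state party c ∈ Icc (0 : ℝ × ℝ) 1 :=
  mem_unitSquare.2 ⟨groupState_mem party c false, groupState_mem party c true⟩

theorem balance_eq {party c : V → Bool} {a : Bool} (h : 0 < groupSize party a) :
    (balance party c a : ℝ) = groupSize party a * (2 * groupState party c a - 1) := by
  have : (0 : ℝ) < groupSize party a := Nat.cast_pos.2 h
  rw [groupState_eq]
  field_simp
  ring

/-- The influence in a large population is close to the limit field: the node itself and the
deviation of the group proportions from their limits `ρ₁`, `ρ₂` contribute at most `κ` each. -/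
theorem abs_memberInfluence_sub_le {α β κ ρ₁ ρ₂ : ℝ} (hα : α ∈ Icc (0 : ℝ) 1)
    (hβ : β ∈ Icc (0 : ℝ) 1) {party c : V → Bool} (h : ∀ a, 0 < groupSize party a)
    (hN : 1 < Fintype.card V) {a e : Bool}
    (h1 : |groupSize party a / ((Fintype.card V : ℝ) - 1) - ρ₁| ≤ κ)
    (h2 : |groupSize party (!a) / ((Fintype.card V : ℝ) - 1) - ρ₂| ≤ κ)
    (h3 : 1 / ((Fintype.card V : ℝ) - 1) ≤ κ) :
    |memberInfluence α β party c a e - (α * ρ₁ * (2 * groupState party c a - 1) -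
      β * ρ₂ * (2 * groupState party c (!a) - 1))| ≤ 3 * κ := by
  have hN' : (0 : ℝ) < (Fintype.card V : ℝ) - 1 := by
    rw [sub_pos]; exact_mod_cast hN
  set M : ℝ := (Fintype.card V : ℝ) - 1 with hM
  have hs : |((sign e : ℤ) : ℝ) / M| ≤ κ := by
    rw [abs_div, abs_of_pos hN']
    have : |((sign e : ℤ) : ℝ)| = 1 := by cases e <;> simp [sign]
    rw [this]; exact h3
  have key : memberInfluence α β party c a e - (α * ρ₁ * (2 * groupState party c a - 1) -
      β * ρ₂ * (2 * groupState party c (!a) - 1)) =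
      α * ((groupSize party a / M - ρ₁) * (2 * groupState party c a - 1)) -
      α * (sign e / M) -
      β * ((groupSize party (!a) / M - ρ₂) * (2 * groupState party c (!a) - 1)) := by
    rw [memberInfluence, balance_eq (h a), balance_eq (h !a), ← hM]
    field_simp
    ring
  have hθ : ∀ a', |2 * groupState party c a' - 1| ≤ 1 := fun a' => by
    have := groupState_mem party c a'
    rw [abs_le]; constructor <;> linarith
  have hm : ∀ γ x y : ℝ, γ ∈ Icc (0 : ℝ) 1 → |x| ≤ κ → |y| ≤ 1 → |γ * (x * y)| ≤ κ := by
    intro γ x y hγ hx hy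
    rw [abs_mul, abs_mul, abs_of_nonneg hγ.1]
    have h1 : |x| * |y| ≤ κ := (mul_le_of_le_one_right (abs_nonneg _) hy).trans hx
    exact (mul_le_of_le_one_left (by positivity) hγ.2).trans h1
  rw [key]
  have b1 := hm α _ _ hα h1 (hθ a)
  have b2 := hm α _ 1 hα hs (by simp)
  have b3 := hm β _ _ hβ h2 (hθ !a)
  rw [mul_one] at b2
  rw [abs_le] at *
  constructor <;> linarith

section Update

variable [DecidableEq V]

theorem balance_update (party c : V → Bool) (v : V) (e a : Bool) :
    balance party (Function.update c v e) a =
      balance party c a + if party v = a then sign e - sign (c v) else 0 := by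
  rw [← sub_eq_iff_eq_add', balance, balance, ← Finset.sum_sub_distrib]
  rw [Finset.sum_eq_single v]
  · simp only [Function.update_self]
    split_ifs <;> simp
  · intro u _ hu
    rw [Function.update_of_ne hu, sub_self]
  · simp

theorem groupState_update_sub (party c : V → Bool) (v : V) (e a : Bool) :
    groupState party (Function.update c v e) a - groupState party c a =
      if party v = a then ((sign e - sign (c v) : ℤ) : ℝ) / (2 * groupSize party a) else 0 := by
  rw [groupState_eq, groupState_eq, balance_update]
  split_ifs
  · push_cast; ring
  · simp

theorem numNeighbors_top (v : V) :
    (numNeighbors (⊤ : SimpleGraph V) v : ℝ) = Fintype.card V - 1 := by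
  have : numNeighbors (⊤ : SimpleGraph V) v = Fintype.card V - 1 := by
    rw [numNeighbors, ← Finset.card_univ, ← Finset.card_erase_of_mem (Finset.mem_univ v)]
    congr 1
    ext u
    simp [eq_comm]
  rw [this, Nat.cast_sub (Fintype.card_pos_iff.2 ⟨v⟩), Nat.cast_one]

theorem influence_top (α β : ℝ) (party c : V → Bool) (v : V) :
    influence α β ⊤ party c v = memberInfluence α β party c (party v) (c v) := by
  have h1 : ((Finset.univ.filter fun u => (⊤ : SimpleGraph V).Adj v u ∧ party u = party v ∧
        c u = true).card : ℝ) -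
      ((Finset.univ.filter fun u => (⊤ : SimpleGraph V).Adj v u ∧ party u = party v ∧
        c u = false).card : ℝ) = balance party c (party v) - sign (c v) := by
    have h : ((sign (c v) : ℤ) : ℝ) = ∑ u, if u = v then ((sign (c u) : ℤ) : ℝ) else 0 := by
      rw [Finset.sum_ite_eq' Finset.univ v]; simp
    rw [← Finset.sum_boole, ← Finset.sum_boole, ← Finset.sum_sub_distrib, balance, Int.cast_sum, h,
      ← Finset.sum_sub_distrib]
    refine Finset.sum_congr rfl fun u _ => ?_
    rcases eq_or_ne u v with rfl | hu
    · simp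
    · by_cases h1 : party u = party v <;> cases h2 : c u <;> simp [h1, hu, hu.symm, sign]
  have h2 : ((Finset.univ.filter fun u => (⊤ : SimpleGraph V).Adj v u ∧ party u ≠ party v ∧
        c u = true).card : ℝ) -
      ((Finset.univ.filter fun u => (⊤ : SimpleGraph V).Adj v u ∧ party u ≠ party v ∧
        c u = false).card : ℝ) = balance party c (!party v) := by
    rw [← Finset.sum_boole, ← Finset.sum_boole, ← Finset.sum_sub_distrib, balance, Int.cast_sum]
    refine Finset.sum_congr rfl fun u _ => ?_
    rcases eq_or_ne u v with rfl | hu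
    · simp
    · cases h1 : party u <;> cases h3 : party v <;> cases h2 : c u <;> simp [hu.symm, sign]
  have h1' : inShare ⊤ party c v true - inShare ⊤ party c v false =
      (balance party c (party v) - sign (c v)) / ((Fintype.card V : ℝ) - 1) := by
    rw [inShare, inShare, ← sub_div, numNeighbors_top, ← h1]
    congr!
  have h2' : outShare ⊤ party c v true - outShare ⊤ party c v false =
      balance party c (!party v) / ((Fintype.card V : ℝ) - 1) := by
    rw [outShare, outShare, ← sub_div, numNeighbors_top, ← h2]
    congr!
  rw [influence, h1', h2', memberInfluence]
  ring

/-- A selected node either keeps its choice or switches, and whether it switches depends only on its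
group and its present choice. -/
theorem newChoice_top {α β δ : ℝ} (hδ : 0 ≤ δ) (party c : V → Bool) (v : V) :
    newChoice α β δ ⊤ party c v =
      if c v = true then decide (¬ memberInfluence α β party c (party v) true < -δ)
      else decide (memberInfluence α β party c (party v) false > δ) := by
  rw [newChoice, influence_top]
  cases h : c v
  · by_cases h1 : memberInfluence α β party c (party v) false < -δ
    · have : ¬ memberInfluence α β party c (party v) false > δ := by
        rw [gt_iff_lt, not_lt]; linarith
      simp [h1, this]
    · simp [h1]
  · by_cases h1 : memberInfluence α β party c (party v) true < -δ <;> simp [h1]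

/-- The configuration after node `v` has been selected for an update on the complete graph. -/
noncomputable def next (α β δ : ℝ) (party c : V → Bool) (v : V) : V → Bool :=
  Function.update c v (newChoice α β δ ⊤ party c v)

theorem sign_newChoice_sub {α β δ : ℝ} (hδ : 0 ≤ δ) (party c : V → Bool) (v : V) :
    ((sign (newChoice α β δ ⊤ party c v) - sign (c v) : ℤ) : ℝ) =
      (1 - sign (c v)) * (if memberInfluence α β party c (party v) false > δ then 1 else 0) -
      (1 + sign (c v)) * (if memberInfluence α β party c (party v) true < -δ then 1 else 0) := by
  rw [newChoice_top hδ]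
  cases h : c v
  · by_cases h1 : memberInfluence α β party c (party v) false > δ <;> simp [h1, sign]; norm_num
  · by_cases h1 : memberInfluence α β party c (party v) true < -δ
    · simp [h1, sign]; norm_num
    · simp only [if_true, decide_not, h1, decide_false, Bool.not_false, sub_self, Int.cast_zero,
        if_false, mul_zero, sub_zero]
      simp [sign]

/-- The sum of the increments of a group state over all nodes that may be selected; the mean
increment is this sum divided by the number of nodes. -/
theorem sum_groupState_next_sub {α β δ : ℝ} (hδ : 0 ≤ δ) (party c : V → Bool) {a : Bool}
    (ha : 0 < groupSize party a) :
    ∑ v, (groupState party (next α β δ party c v) a - groupState party c a) =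
      groupDrift δ (groupState party c a) (memberInfluence α β party c a false)
        (memberInfluence α β party c a true) := by
  have hn : (0 : ℝ) < groupSize party a := Nat.cast_pos.2 ha
  set A : ℝ := if memberInfluence α β party c a false > δ then 1 else 0 with hA
  set B : ℝ := if memberInfluence α β party c a true < -δ then 1 else 0 with hB
  have key : ∀ v, groupState party (next α β δ party c v) a - groupState party c a =
      (A - B) / (2 * groupSize party a) * (if party v = a then (1 : ℝ) else 0) -
      (A + B) / (2 * groupSize party a) * ((if party v = a then sign (c v) else 0 : ℤ) : ℝ) := by
    intro v
    rw [next, groupState_update_sub, sign_newChoice_sub hδ]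
    by_cases h : party v = a
    · simp only [h, if_true]
      rw [← hA, ← hB]; field_simp; ring
    · simp [h]
  rw [Finset.sum_congr rfl fun v _ => key v, Finset.sum_sub_distrib, ← Finset.mul_sum,
    ← Finset.mul_sum, ← groupSize_eq_sum, ← Int.cast_sum, ← balance, balance_eq ha]
  unfold groupDrift
  rw [← hA, ← hB]
  field_simp
  ring

theorem abs_groupState_next_sub_le (α β δ : ℝ) (party c : V → Bool) (v : V) (a : Bool) :
    |groupState party (next α β δ party c v) a - groupState party c a| ≤ 1 / groupSize party a := by
  rw [next, groupState_update_sub]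
  split_ifs
  · rw [abs_div, abs_of_nonneg (by positivity : (0 : ℝ) ≤ 2 * groupSize party a),
      ← mul_div_mul_left 1 (groupSize party a : ℝ) two_ne_zero]
    gcongr
    generalize newChoice α β δ ⊤ party c v = e
    cases e <;> cases c v <;> norm_num [sign]
  · rw [abs_zero]; positivity

/-- The sum over all nodes `v` of the increment of the state when `v` is selected, i.e. the number
of nodes times the mean increment. -/
noncomputable def drift (α β δ : ℝ) (party c : V → Bool) : ℝ × ℝ :=
  ∑ v, (state party (next α β δ party c v) - state party c)

theorem drift_eq {α β δ : ℝ} (hδ : 0 ≤ δ) (party c : V → Bool) (h : ∀ a, 0 < groupSize party a) :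
    drift α β δ party c =
      (groupDrift δ (state party c).1 (memberInfluence α β party c false false)
        (memberInfluence α β party c false true),
      groupDrift δ (state party c).2 (memberInfluence α β party c true false)
        (memberInfluence α β party c true true)) := by
  ext
  · rw [drift, Prod.fst_sum]; exact sum_groupState_next_sub hδ party c (h false)
  · rw [drift, Prod.snd_sum]; exact sum_groupState_next_sub hδ party c (h true)

theorem norm_drift_le {α β δ : ℝ} (hδ : 0 ≤ δ) (party c : V → Bool)
    (h : ∀ a, 0 < groupSize party a) : ‖drift α β δ party c‖ ≤ 1 := by
  rw [drift_eq hδ party c h, Prod.norm_def, max_le_iff]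
  exact ⟨abs_groupDrift_le (groupState_mem _ _ _) _ _, abs_groupDrift_le (groupState_mem _ _ _) _ _⟩

end Update

/-! ### Equal love and hate: the critical configuration occurs at most once -/

/-- For `α = β` the balance of the blue group minus that of the red group determines all
influences. -/
def gap (party c : V → Bool) : ℤ := balance party c false - balance party c true

theorem memberInfluence_false_of_eq (α : ℝ) (party c : V → Bool) (e : Bool) :
    memberInfluence α α party c false e =
      α * (gap party c - sign e) / ((Fintype.card V : ℝ) - 1) := by
  rw [memberInfluence, gap]; push_cast; simp only [Bool.not_false]; ring

theorem memberInfluence_true_of_eq (α : ℝ) (party c : V → Bool) (e : Bool) :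
    memberInfluence α α party c true e =
      -memberInfluence α α party c false (!e) := by
  rw [memberInfluence, memberInfluence]
  have : sign (!e) = -sign e := by cases e <;> simp [sign]
  rw [this]
  push_cast; simp only [Bool.not_false, Bool.not_true]; ring

/-- All nodes switch when they are selected, for `α = β`.  The condition is stated for the blue
nodes; for the red nodes it follows, since they feel the opposite influences. -/
def IsCritical (α δ : ℝ) (party c : V → Bool) : Prop :=
  δ < memberInfluence α α party c false false ∧ memberInfluence α α party c false true < -δ

/-- Removing the own choice from the balance shifts the gap by one, so that the influences on the
blue nodes of the two choices can have opposite signs only if the gap is strictly between `-1`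
and `1`. -/
theorem IsCritical.gap_eq_zero {α δ : ℝ} (hα : 0 ≤ α) (hδ : 0 ≤ δ) (hN : 1 < Fintype.card V)
    {party c : V → Bool} (h : IsCritical α δ party c) : gap party c = 0 := by
  have hN' : (0 : ℝ) < (Fintype.card V : ℝ) - 1 := by
    rw [sub_pos]; exact_mod_cast hN
  obtain ⟨h1, h2⟩ := h
  rw [memberInfluence_false_of_eq] at h1 h2
  have a1 : (0 : ℝ) < gap party c - sign false := by
    have := hδ.trans_lt h1
    rw [div_pos_iff_of_pos_right hN'] at this
    exact pos_of_mul_pos_right this hα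
  have a2 : (gap party c : ℝ) - sign true < 0 := by
    have := h2.trans_le (neg_nonpos.2 hδ)
    rw [div_lt_iff₀ hN', zero_mul] at this
    exact neg_of_mul_neg_right this hα
  simp only [sign] at a1 a2
  norm_num at a1 a2
  have b1 : (-1 : ℤ) < gap party c := by
    have : (-1 : ℝ) < gap party c := by linarith
    exact_mod_cast this
  have b2 : gap party c < 1 := by exact_mod_cast a2
  omega

variable [DecidableEq V]

theorem gap_next (α β δ : ℝ) (party c : V → Bool) (v : V) :
    gap party (next α β δ party c v) = gap party c +
      (if party v = false then 1 else -1) * (sign (newChoice α β δ ⊤ party c v) - sign (c v)) := by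
  rw [gap, gap, next, balance_update, balance_update]
  cases party v <;> simp <;> ring

/-- A positive gap stays positive: no blue node with choice 1 and no red node with choice 0
switches. -/
theorem gap_next_of_pos {α δ : ℝ} (hα : 0 ≤ α) (hδ : 0 ≤ δ) (hN : 1 < Fintype.card V)
    {party c : V → Bool} (h : 0 < gap party c) (v : V) : 0 < gap party (next α α δ party c v) := by
  have hN' : (0 : ℝ) < (Fintype.card V : ℝ) - 1 := by
    rw [sub_pos]; exact_mod_cast hN
  have hg : (1 : ℝ) ≤ gap party c := by exact_mod_cast h
  have h1 : ¬ memberInfluence α α party c false true < -δ := by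
    rw [memberInfluence_false_of_eq, not_lt]
    have : 0 ≤ α * (gap party c - sign true) / ((Fintype.card V : ℝ) - 1) := by
      have : (0 : ℝ) ≤ gap party c - sign true := by simp [sign]; linarith
      positivity
    linarith
  have h2 : ¬ memberInfluence α α party c true false > δ := by
    rw [memberInfluence_true_of_eq]
    simp only [Bool.not_false, not_lt, gt_iff_lt]
    linarith [not_lt.1 h1]
  rw [gap_next, newChoice_top hδ]
  cases hv : party v <;> cases hc : c v <;> simp [h1, h2, sign]
  · split_ifs <;> omega
  · exact h
  · exact h
  · split_ifs <;> omega

/-- A negative gap stays negative: no blue node with choice 0 and no red node with choice 1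
switches. -/
theorem gap_next_of_neg {α δ : ℝ} (hα : 0 ≤ α) (hδ : 0 ≤ δ) (hN : 1 < Fintype.card V)
    {party c : V → Bool} (h : gap party c < 0) (v : V) : gap party (next α α δ party c v) < 0 := by
  have hN' : (0 : ℝ) < (Fintype.card V : ℝ) - 1 := by
    rw [sub_pos]; exact_mod_cast hN
  have hg : (gap party c : ℝ) ≤ -1 := by exact_mod_cast Int.le_sub_one_of_lt h
  have h1 : ¬ memberInfluence α α party c false false > δ := by
    rw [memberInfluence_false_of_eq, gt_iff_lt, not_lt]
    have : α * (gap party c - sign false) / ((Fintype.card V : ℝ) - 1) ≤ 0 := by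
      have : (gap party c : ℝ) - sign false ≤ 0 := by simp [sign]; linarith
      exact div_nonpos_of_nonpos_of_nonneg (mul_nonpos_of_nonneg_of_nonpos hα this) hN'.le
    linarith
  have h2 : ¬ memberInfluence α α party c true true < -δ := by
    rw [memberInfluence_true_of_eq]
    simp only [Bool.not_true, not_lt]
    linarith [not_lt.1 h1]
  rw [gap_next, newChoice_top hδ]
  cases hv : party v <;> cases hc : c v <;> simp [h1, h2, sign]
  · exact h
  · split_ifs <;> omega
  · split_ifs <;> omega
  · exact h

/-- The switch of any node changes a vanishing gap to `2` or `-2`. -/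
theorem IsCritical.gap_next_ne_zero {α δ : ℝ} (hα : 0 ≤ α) (hδ : 0 ≤ δ) (hN : 1 < Fintype.card V)
    {party c : V → Bool} (h : IsCritical α δ party c) (v : V) :
    gap party (next α α δ party c v) ≠ 0 := by
  have h0 := h.gap_eq_zero hα hδ hN
  have h3 : δ < memberInfluence α α party c true false := by
    rw [memberInfluence_true_of_eq]; simp only [Bool.not_false]; linarith [h.2]
  have h4 : memberInfluence α α party c true true < -δ := by
    rw [memberInfluence_true_of_eq]; simp only [Bool.not_true]; linarith [h.1]
  rw [gap_next, newChoice_top hδ, h0]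
  cases hv : party v <;> cases hc : c v <;> simp [h.1, h.2, h3, h4, sign]

theorem choices_succ (α β δ : ℝ) (party c₀ : V → Bool) (ω : ℕ → V) (k : ℕ) :
    choices α β δ ⊤ party c₀ ω (k + 1) =
      next α β δ party (choices α β δ ⊤ party c₀ ω k) (ω k) := by
  rw [choices, next]
  congr!

/-- After a critical configuration the gap never vanishes again, so that a trajectory visits
critical configurations at one time at most. -/
theorem exists_index_isCritical {α δ : ℝ} (hα : 0 ≤ α) (hδ : 0 ≤ δ) (hN : 1 < Fintype.card V)
    (party c₀ : V → Bool) (ω : ℕ → V) :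
    ∃ j₀, ∀ j, j ≠ j₀ → ¬ IsCritical α δ party (choices α α δ ⊤ party c₀ ω j) := by
  by_cases hex : ∃ j₀, IsCritical α δ party (choices α α δ ⊤ party c₀ ω j₀)
  swap
  · push Not at hex
    exact ⟨0, fun j _ => hex j⟩
  classical
  set j₀ := Nat.find hex with hj₀
  have hcrit := Nat.find_spec hex
  refine ⟨j₀, fun j hj hc => ?_⟩
  have hlt : j₀ < j := lt_of_le_of_ne (Nat.find_min' hex hc) hj.symm
  have h1 : ∀ k, j₀ + 1 ≤ k → gap party (choices α α δ ⊤ party c₀ ω k) ≠ 0 := by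
    intro k hk
    induction k, hk using Nat.le_induction with
    | base => rw [choices_succ]; exact hcrit.gap_next_ne_zero hα hδ hN _
    | succ k hk ih =>
      rw [choices_succ]
      rcases lt_or_gt_of_ne ih with h | h
      · exact (gap_next_of_neg hα hδ hN h _).ne
      · exact (gap_next_of_pos hα hδ hN h _).ne'
  exact h1 j hlt (hc.gap_eq_zero hα hδ hN)

end OneStep

end AffectivePolarization

namespace AffectivePolarization

/-! ### Sums of centred functions of the selected nodes -/

/-- A function of finitely many coordinates, as a function on a finite product. -/
theorem DependsOn.eq_comp_restrict {V : Type*} [Nonempty V] {f : (ℕ → V) → ℝ} {m : ℕ}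
    (hf : DependsOn f (Finset.range m : Set ℕ)) :
    ∃ F : ((i : Finset.range m) → V) → ℝ, f = fun ω => F ((Finset.range m).restrict ω) := by
  refine ⟨fun a => f fun i =>
    if h : i ∈ Finset.range m then a ⟨i, h⟩ else Classical.arbitrary V, ?_⟩
  funext ω
  refine hf fun i hi => ?_
  have : i ∈ Finset.range m := hi
  simp only [this, dif_pos, Finset.restrict]

section Noise

variable {V : Type*} [Fintype V] [Nonempty V] [MeasurableSpace V]

instance : IsProbabilityMeasure (selectionLaw V) := by
  unfold selectionLaw; infer_instance

variable [DiscreteMeasurableSpace V]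

theorem integrable_of_dependsOn {f : (ℕ → V) → ℝ} {m : ℕ}
    (hf : DependsOn f (Finset.range m : Set ℕ)) : Integrable f (selectionLaw V) := by
  obtain ⟨F, rfl⟩ := DependsOn.eq_comp_restrict hf
  have hmeas : Measurable fun ω : ℕ → V => (Finset.range m).restrict ω :=
    Finset.measurable_restrict _
  have hF : Integrable F ((selectionLaw V).map fun ω => (Finset.range m).restrict ω) := by
    have := Measure.isProbabilityMeasure_map (μ := selectionLaw V) hmeas.aemeasurable
    exact Integrable.of_finite
  exact hF.comp_measurable hmeas

variable [DecidableEq V]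

/-- If the average of `f` over the last coordinate on which it depends vanishes, so does the
integral of `f`. -/
theorem integral_eq_zero_of_centred {f : (ℕ → V) → ℝ} {k : ℕ}
    (hf : DependsOn f (Finset.range (k + 1) : Set ℕ))
    (hc : ∀ ω, ∑ v, f (Function.update ω k v) = 0) : ∫ ω, f ω ∂(selectionLaw V) = 0 := by
  obtain ⟨F, rfl⟩ := DependsOn.eq_comp_restrict hf
  have hk : k ∈ Finset.range (k + 1) := Finset.self_mem_range_succ k
  rw [selectionLaw,
    integral_restrict_infinitePi (μ := fun _ : ℕ => (PMF.uniformOfFintype V).toMeasure)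
    (StronglyMeasurable.of_discrete).aestronglyMeasurable, integral_fintype Integrable.of_finite]
  have hw : ∀ a : (i : Finset.range (k + 1)) → V,
      (Measure.pi fun _ : Finset.range (k + 1) => (PMF.uniformOfFintype V).toMeasure).real {a} =
        (((Fintype.card V : ℝ≥0∞)⁻¹) ^ (k + 1)).toReal := by
    intro a
    rw [Measure.real, Measure.pi_singleton]
    congr 1
    simp
  simp only [hw, ← Finset.smul_sum]
  -- exchange the coordinate `k` with an independent copy `v`
  have hc' : ∀ a : (i : Finset.range (k + 1)) → V, ∑ v, F (Function.update a ⟨k, hk⟩ v) = 0 := by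
    intro a
    rw [← hc fun i => if h : i ∈ Finset.range (k + 1) then a ⟨i, h⟩ else Classical.arbitrary V]
    refine Finset.sum_congr rfl fun v _ => congrArg F ?_
    funext i
    rcases eq_or_ne i ⟨k, hk⟩ with rfl | hi
    · simp [Finset.restrict]
    · have : (i : ℕ) ≠ k := fun h => hi (Subtype.ext h)
      rw [Function.update_of_ne hi, Finset.restrict, Function.update_of_ne this, dif_pos i.2]
  have hinv : Function.Involutive fun p : ((i : Finset.range (k + 1)) → V) × V =>
      (Function.update p.1 ⟨k, hk⟩ p.2, p.1 ⟨k, hk⟩) := by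
    rintro ⟨a, v⟩
    simp
  have hsum := Equiv.sum_comp hinv.toPerm fun p => F p.1
  simp only [Function.Involutive.coe_toPerm] at hsum
  rw [Fintype.sum_prod_type, Fintype.sum_prod_type] at hsum
  simp only [hc', Finset.sum_const_zero, Finset.sum_const, ← Finset.smul_sum] at hsum
  have hzero : ∑ a, F a = 0 := by
    rw [eq_comm, smul_eq_zero] at hsum
    refine hsum.resolve_left ?_
    simp
  rw [hzero, smul_zero]

variable {h : ℕ → (ℕ → V) → ℝ}

/-- Orthogonality of centred increments: the second moment of a sum of `k - k₀` of them is at most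
`k - k₀` times the squared bound of the increments. -/
theorem integral_sq_sum_le (hdep : ∀ j, DependsOn (h j) (Finset.range (j + 1) : Set ℕ))
    (hc : ∀ j ω, ∑ v, h j (Function.update ω j v) = 0) {b : ℝ} (hb : ∀ j ω, |h j ω| ≤ b)
    {k₀ k : ℕ} (hk : k₀ ≤ k) :
    ∫ ω, (∑ i ∈ Finset.Ico k₀ k, h i ω) ^ 2 ∂(selectionLaw V) ≤ (k - k₀) * b ^ 2 := by
  have hS : ∀ k, DependsOn (fun ω => ∑ i ∈ Finset.Ico k₀ k, h i ω) (Finset.range k : Set ℕ) := by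
    intro k x y hxy
    refine Finset.sum_congr rfl fun i hi => hdep i fun j hj => hxy j ?_
    simp only [Finset.coe_range, Set.mem_Iio, Finset.mem_Ico] at *
    omega
  have hmono : ∀ {f : (ℕ → V) → ℝ} {k : ℕ}, DependsOn f (Finset.range k : Set ℕ) →
      DependsOn f (Finset.range (k + 1) : Set ℕ) := by
    intro f k hf x y hxy
    refine hf fun j hj => hxy j ?_
    simp only [Finset.coe_range, Set.mem_Iio] at *
    omega
  induction k, hk using Nat.le_induction with
  | base => simp
  | succ k hk ih =>
    have i1 : Integrable (fun ω => (∑ i ∈ Finset.Ico k₀ k, h i ω) ^ 2) (selectionLaw V) :=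
      integrable_of_dependsOn (m := k) fun x y hxy => by simp only [hS k hxy]
    have d2 : DependsOn (fun ω => 2 * (∑ i ∈ Finset.Ico k₀ k, h i ω) * h k ω)
        (Finset.range (k + 1) : Set ℕ) := fun x y hxy => by
      simp only [hmono (hS k) hxy, hdep k hxy]
    have i3 : Integrable (fun ω => h k ω ^ 2) (selectionLaw V) :=
      integrable_of_dependsOn (m := k + 1) fun x y hxy => by simp only [hdep k hxy]
    have hexp : ∀ ω, (∑ i ∈ Finset.Ico k₀ (k + 1), h i ω) ^ 2 =
        (∑ i ∈ Finset.Ico k₀ k, h i ω) ^ 2 + 2 * (∑ i ∈ Finset.Ico k₀ k, h i ω) * h k ω +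
          h k ω ^ 2 := by
      intro ω
      rw [Finset.sum_Ico_succ_top hk]; ring
    have hcross : ∫ ω, 2 * (∑ i ∈ Finset.Ico k₀ k, h i ω) * h k ω ∂(selectionLaw V) = 0 := by
      refine integral_eq_zero_of_centred d2 fun ω => ?_
      have : ∀ v, ∑ i ∈ Finset.Ico k₀ k, h i (Function.update ω k v) =
          ∑ i ∈ Finset.Ico k₀ k, h i ω := fun v => hS k fun i hi => by
        simp only [Finset.coe_range, Set.mem_Iio] at hi
        rw [Function.update_of_ne hi.ne]
      simp only [this, ← Finset.mul_sum, hc, mul_zero]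
    have hlast : ∫ ω, h k ω ^ 2 ∂(selectionLaw V) ≤ b ^ 2 := by
      have : ∫ ω, h k ω ^ 2 ∂(selectionLaw V) ≤ ∫ _, b ^ 2 ∂(selectionLaw V) :=
        integral_mono i3 (integrable_const _) fun ω => by
          have := hb k ω
          show h k ω ^ 2 ≤ b ^ 2
          rw [← sq_abs]
          gcongr
      simpa using this
    have i12 : Integrable (fun ω => (∑ i ∈ Finset.Ico k₀ k, h i ω) ^ 2 +
        2 * (∑ i ∈ Finset.Ico k₀ k, h i ω) * h k ω) (selectionLaw V) :=
      i1.add (integrable_of_dependsOn d2)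
    simp only [hexp]
    rw [integral_add i12 i3,
      integral_add i1 (integrable_of_dependsOn d2), hcross]
    push_cast
    linarith

/-- Chebyshev's inequality for a sum of centred increments. -/
theorem measure_sum_gt_le (hdep : ∀ j, DependsOn (h j) (Finset.range (j + 1) : Set ℕ))
    (hc : ∀ j ω, ∑ v, h j (Function.update ω j v) = 0) {b : ℝ} (hb : ∀ j ω, |h j ω| ≤ b)
    {ν : ℝ} (hν : 0 < ν) {k₀ k : ℕ} (hk : k₀ ≤ k) :
    selectionLaw V {ω | ν < |∑ i ∈ Finset.Ico k₀ k, h i ω|} ≤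
      ENNReal.ofReal ((k - k₀) * b ^ 2 / ν ^ 2) := by
  have hint : Integrable (fun ω => (∑ i ∈ Finset.Ico k₀ k, h i ω) ^ 2) (selectionLaw V) := by
    refine integrable_of_dependsOn (m := k) fun x y hxy => ?_
    have : ∀ i ∈ Finset.Ico k₀ k, h i x = h i y := fun i hi => hdep i fun j hj => hxy j (by
      simp only [Finset.coe_range, Set.mem_Iio, Finset.mem_Ico] at *
      omega)
    simp only [Finset.sum_congr rfl this]
  have h1 := mul_meas_ge_le_integral_of_nonneg (μ := selectionLaw V)
    (Eventually.of_forall fun ω => sq_nonneg (∑ i ∈ Finset.Ico k₀ k, h i ω)) hint (ν ^ 2)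
  have h2 := h1.trans (integral_sq_sum_le hdep hc hb hk)
  have hsub : {ω : ℕ → V | ν < |∑ i ∈ Finset.Ico k₀ k, h i ω|} ⊆
      {ω | ν ^ 2 ≤ (∑ i ∈ Finset.Ico k₀ k, h i ω) ^ 2} := by
    intro ω hω
    have hω' : ν < |∑ i ∈ Finset.Ico k₀ k, h i ω| := hω
    show ν ^ 2 ≤ _
    rw [← sq_abs (∑ i ∈ Finset.Ico k₀ k, h i ω)]
    gcongr
  refine (measure_mono hsub).trans ?_
  rw [← ENNReal.ofReal_toReal (measure_ne_top (selectionLaw V) _)]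
  refine ENNReal.ofReal_le_ofReal ?_
  rw [le_div_iff₀ (by positivity), mul_comm]
  exact h2

/-- Maximal inequality: Chebyshev's inequality at `L` times of distance `S`, and the bound of the
increments between these times. -/
theorem measure_exists_sum_gt_le (hdep : ∀ j, DependsOn (h j) (Finset.range (j + 1) : Set ℕ))
    (hc : ∀ j ω, ∑ v, h j (Function.update ω j v) = 0) {b : ℝ} (hb : ∀ j ω, |h j ω| ≤ b)
    {ν : ℝ} (hν : 0 < ν) (k₀ : ℕ) {S : ℕ} (L : ℕ) (hS : 0 < S) (hSb : S * b ≤ ν / 4) :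
    selectionLaw V {ω | ∃ j k, k₀ ≤ j ∧ j ≤ k ∧ k < k₀ + S * L ∧
        ν < |∑ i ∈ Finset.Ico j k, h i ω|} ≤
      ENNReal.ofReal (L * (S * L * b ^ 2 / (ν / 4) ^ 2)) := by
  have hb0 : 0 ≤ b := (abs_nonneg _).trans (hb 0 fun _ => Classical.arbitrary V)
  have hsub : {ω : ℕ → V | ∃ j k, k₀ ≤ j ∧ j ≤ k ∧ k < k₀ + S * L ∧
        ν < |∑ i ∈ Finset.Ico j k, h i ω|} ⊆
      ⋃ m ∈ Finset.range L, {ω | ν / 4 < |∑ i ∈ Finset.Ico k₀ (k₀ + S * m), h i ω|} := by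
    rintro ω ⟨j, k, hj, hjk, hk, hlarge⟩
    by_contra hnot
    simp only [mem_iUnion, Finset.mem_range, exists_prop, not_exists, not_and] at hnot
    have hsmall : ∀ k, k₀ ≤ k → k < k₀ + S * L → |∑ i ∈ Finset.Ico k₀ k, h i ω| ≤ ν / 2 := by
      intro k hk0 hkL
      set m := (k - k₀) / S with hm
      have hdiv := Nat.div_add_mod (k - k₀) S
      have hmod := Nat.mod_lt (k - k₀) hS
      rw [← hm] at hdiv
      have hmL : m < L := Nat.div_lt_of_lt_mul (by omega)
      have h1 : |∑ i ∈ Finset.Ico k₀ (k₀ + S * m), h i ω| ≤ ν / 4 := not_lt.1 (hnot m hmL)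
      have hle : k₀ + S * m ≤ k := by omega
      have h2 : |∑ i ∈ Finset.Ico (k₀ + S * m) k, h i ω| ≤ ν / 4 := by
        calc |∑ i ∈ Finset.Ico (k₀ + S * m) k, h i ω|
            ≤ ∑ i ∈ Finset.Ico (k₀ + S * m) k, |h i ω| := Finset.abs_sum_le_sum_abs _ _
          _ ≤ ∑ i ∈ Finset.Ico (k₀ + S * m) k, b := Finset.sum_le_sum fun i _ => hb i ω
          _ = ((k - (k₀ + S * m) : ℕ) : ℝ) * b := by
              rw [Finset.sum_const, Nat.card_Ico, nsmul_eq_mul]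
          _ ≤ S * b := by
              gcongr
              omega
          _ ≤ ν / 4 := hSb
      rw [← Finset.sum_Ico_consecutive _ (Nat.le_add_right k₀ (S * m)) hle]
      linarith [abs_add_le (∑ i ∈ Finset.Ico k₀ (k₀ + S * m), h i ω)
        (∑ i ∈ Finset.Ico (k₀ + S * m) k, h i ω)]
    have h1 := hsmall j hj (by omega)
    have h2 := hsmall k (hj.trans hjk) hk
    rw [← Finset.sum_Ico_consecutive _ hj hjk] at h2
    rw [abs_le] at h1 h2
    rw [lt_abs] at hlarge
    rcases hlarge with h | h <;> linarith [h1.1, h1.2, h2.1, h2.2]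
  refine (measure_mono hsub).trans ((measure_biUnion_finset_le _ _).trans ?_)
  have hterm : ∀ m ∈ Finset.range L,
      selectionLaw V {ω | ν / 4 < |∑ i ∈ Finset.Ico k₀ (k₀ + S * m), h i ω|} ≤
        ENNReal.ofReal (S * L * b ^ 2 / (ν / 4) ^ 2) := by
    intro m hm
    refine (measure_sum_gt_le hdep hc hb (by positivity) (Nat.le_add_right _ _)).trans ?_
    refine ENNReal.ofReal_le_ofReal ?_
    have : (m : ℝ) ≤ L := by exact_mod_cast (Finset.mem_range.1 hm).le
    push_cast
    rw [add_sub_cancel_left]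
    gcongr
  refine (Finset.sum_le_sum hterm).trans ?_
  rw [Finset.sum_const, Finset.card_range, nsmul_eq_mul, ENNReal.ofReal_mul (Nat.cast_nonneg _),
    ENNReal.ofReal_natCast]

end Noise

end AffectivePolarization

namespace AffectivePolarization

/-! ### Convergence of the process -/

section Convergence

variable {V : Type*} [Fintype V]

theorem choices_dependsOn (α β δ : ℝ) (party c₀ : V → Bool) (k : ℕ) :
    DependsOn (fun ω => choices α β δ ⊤ party c₀ ω k) (Finset.range k : Set ℕ) := by
  classical
  intro x y hxy
  show choices α β δ ⊤ party c₀ x k = choices α β δ ⊤ party c₀ y k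
  induction k with
  | zero => rfl
  | succ k ih =>
    rw [choices_succ, choices_succ, ih fun i hi => hxy i ?_, hxy k ?_]
    · simp
    · simp only [Finset.coe_range, Set.mem_Iio] at *; omega

theorem norm_state_next_sub_le [DecidableEq V] (α β δ : ℝ) (party c : V → Bool) (v : V) {B : ℝ}
    (hB : ∀ a, 1 / (groupSize party a : ℝ) ≤ B) :
    ‖state party (next α β δ party c v) - state party c‖ ≤ B := by
  rw [Prod.norm_def, max_le_iff]
  exact ⟨(abs_groupState_next_sub_le α β δ party c v false).trans (hB _),
    (abs_groupState_next_sub_le α β δ party c v true).trans (hB _)⟩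

/-- The accumulated deviation of the state from the sum of its mean increments is small with high
probability, uniformly over the windows of length `T`.  The increments minus their means are of size
`(C + 1) / N`, so that the maximal inequality applies with a bounded number of grid times. -/
theorem measure_noise_gt_le [DecidableEq V] [Nonempty V] [MeasurableSpace V]
    [DiscreteMeasurableSpace V] {α β δ C ν T t' : ℝ} (hδ : 0 ≤ δ) (party c₀ : V → Bool)
    (hpos : ∀ a, 0 < groupSize party a) (hC0 : 0 ≤ C)
    (hC : ∀ a, 1 / (groupSize party a : ℝ) ≤ C / Fintype.card V) (hν : 0 < ν) (hT : 0 < T)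
    (hN : 8 * (C + 1) / ν ≤ Fintype.card V) :
    selectionLaw V {ω | ∃ j k : ℕ, ⌊Fintype.card V * t'⌋₊ ≤ j ∧ j ≤ k ∧
        (k : ℝ) ≤ Fintype.card V * (t' + T) ∧
        ν < ‖state party (choices α β δ ⊤ party c₀ ω k) -
          state party (choices α β δ ⊤ party c₀ ω j) -
          (Fintype.card V : ℝ)⁻¹ • ∑ i ∈ Finset.Ico j k,
            drift α β δ party (choices α β δ ⊤ party c₀ ω i)‖} ≤
      ENNReal.ofReal (2 * (4 * (⌈8 * (C + 1) * (T + 1) / ν⌉₊ : ℝ) ^ 2 * (C + 1) /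
        (ν * Fintype.card V))) := by
  set N : ℝ := (Fintype.card V : ℝ) with hNdef
  have hN0 : 0 < N := by rw [hNdef]; exact_mod_cast Fintype.card_pos
  have hN1 : 1 ≤ N := by rw [hNdef]; exact_mod_cast Fintype.card_pos
  set L : ℕ := ⌈8 * (C + 1) * (T + 1) / ν⌉₊ with hL
  set S : ℕ := ⌊ν * N / (4 * (C + 1))⌋₊ with hS
  set b : ℝ := (C + 1) / N with hb
  set k₀ : ℕ := ⌊N * t'⌋₊ with hk₀
  have hSle : (S : ℝ) ≤ ν * N / (4 * (C + 1)) := Nat.floor_le (by positivity)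
  have hSge : ν * N / (8 * (C + 1)) ≤ S := by
    have h1 : ν * N / (4 * (C + 1)) < S + 1 := Nat.lt_floor_add_one _
    have h2 : 1 ≤ ν * N / (8 * (C + 1)) := by
      rw [div_le_iff₀ hν] at hN
      rw [le_div_iff₀ (by positivity)]; linarith
    have h3 : ν * N / (4 * (C + 1)) = 2 * (ν * N / (8 * (C + 1))) := by
      field_simp; norm_num
    linarith
  have hSpos : 0 < S := by
    have : (0 : ℝ) < S := lt_of_lt_of_le (by positivity) hSge
    exact_mod_cast this
  have hSb : S * b ≤ ν / 4 := by
    calc S * b ≤ ν * N / (4 * (C + 1)) * b := by gcongr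
      _ = ν / 4 := by rw [hb]; field_simp
  have hSL : N * (T + 1) ≤ S * L := by
    have hLge : 8 * (C + 1) * (T + 1) / ν ≤ L := Nat.le_ceil _
    calc N * (T + 1) = ν * N / (8 * (C + 1)) * (8 * (C + 1) * (T + 1) / ν) := by
          field_simp
      _ ≤ S * L := by gcongr
  -- the increments of one coordinate, minus their conditional means
  let h : Bool → ℕ → (ℕ → V) → ℝ := fun a j ω =>
    groupState party (choices α β δ ⊤ party c₀ ω (j + 1)) a -
      groupState party (choices α β δ ⊤ party c₀ ω j) a -
      N⁻¹ * ∑ v, (groupState party (next α β δ party (choices α β δ ⊤ party c₀ ω j) v) a -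
        groupState party (choices α β δ ⊤ party c₀ ω j) a)
  have hdep : ∀ a j, DependsOn (h a j) (Finset.range (j + 1) : Set ℕ) := by
    intro a j x y hxy
    have e1 := choices_dependsOn α β δ party c₀ (j + 1) hxy
    have e2 := choices_dependsOn α β δ party c₀ j (x := x) (y := y) fun i hi => hxy i (by
      simp only [Finset.coe_range, Set.mem_Iio] at *; omega)
    simp only at e1 e2
    simp only [h, e1, e2]
  have hcent : ∀ a j ω, ∑ v, h a j (Function.update ω j v) = 0 := by
    intro a j ω
    have e2 : ∀ v, choices α β δ ⊤ party c₀ (Function.update ω j v) j =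
        choices α β δ ⊤ party c₀ ω j := fun v =>
      choices_dependsOn α β δ party c₀ j fun i hi => by
        simp only [Finset.coe_range, Set.mem_Iio] at hi
        rw [Function.update_of_ne hi.ne]
    simp only [h, choices_succ, e2, Function.update_self]
    rw [Finset.sum_sub_distrib, Finset.sum_const, Finset.card_univ, nsmul_eq_mul, ← hNdef,
      ← mul_assoc, mul_inv_cancel₀ hN0.ne', one_mul, sub_self]
  have hbound : ∀ a j ω, |h a j ω| ≤ b := by
    intro a j ω
    have h1 := (abs_groupState_next_sub_le α β δ party (choices α β δ ⊤ party c₀ ω j) (ω j) a).trans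
      (hC a)
    have h2 : |∑ v, (groupState party (next α β δ party (choices α β δ ⊤ party c₀ ω j) v) a -
        groupState party (choices α β δ ⊤ party c₀ ω j) a)| ≤ 1 := by
      rw [sum_groupState_next_sub hδ party _ (hpos a)]
      exact abs_groupDrift_le (groupState_mem _ _ _) _ _
    simp only [h, choices_succ]
    refine (abs_sub _ _).trans ?_
    rw [abs_mul, abs_of_pos (inv_pos.2 hN0), hb, add_div, one_div]
    exact add_le_add h1 (mul_le_of_le_one_right (inv_pos.2 hN0).le h2)
  have hsum : ∀ a ω (j k : ℕ), j ≤ k → ∑ i ∈ Finset.Ico j k, h a i ω =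
      groupState party (choices α β δ ⊤ party c₀ ω k) a -
        groupState party (choices α β δ ⊤ party c₀ ω j) a -
        N⁻¹ * ∑ i ∈ Finset.Ico j k, ∑ v,
          (groupState party (next α β δ party (choices α β δ ⊤ party c₀ ω i) v) a -
            groupState party (choices α β δ ⊤ party c₀ ω i) a) := by
    intro a ω j k hjk
    simp only [h]
    rw [Finset.sum_sub_distrib, ← Finset.mul_sum,
      Finset.sum_Ico_sub (fun i => groupState party (choices α β δ ⊤ party c₀ ω i) a) hjk]
  have hsub : {ω | ∃ j k : ℕ, k₀ ≤ j ∧ j ≤ k ∧ (k : ℝ) ≤ N * (t' + T) ∧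
        ν < ‖state party (choices α β δ ⊤ party c₀ ω k) -
          state party (choices α β δ ⊤ party c₀ ω j) -
          N⁻¹ • ∑ i ∈ Finset.Ico j k, drift α β δ party (choices α β δ ⊤ party c₀ ω i)‖} ⊆
      {ω | ∃ j k, k₀ ≤ j ∧ j ≤ k ∧ k < k₀ + S * L ∧ ν < |∑ i ∈ Finset.Ico j k, h false i ω|} ∪
      {ω | ∃ j k, k₀ ≤ j ∧ j ≤ k ∧ k < k₀ + S * L ∧ ν < |∑ i ∈ Finset.Ico j k, h true i ω|} := by
    rintro ω ⟨j, k, hj, hjk, hk, hlt⟩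
    have hkL : k < k₀ + S * L := by
      have h1 := Nat.lt_floor_add_one (N * t')
      have : (k : ℝ) < k₀ + S * L := by
        rw [← hk₀] at h1
        nlinarith
      exact_mod_cast this
    rw [Prod.norm_def, lt_max_iff] at hlt
    rcases hlt with hlt | hlt
    · left
      refine ⟨j, k, hj, hjk, hkL, ?_⟩
      rw [hsum _ _ _ _ hjk]
      simpa [drift, state, Prod.fst_sum] using hlt
    · right
      refine ⟨j, k, hj, hjk, hkL, ?_⟩
      rw [hsum _ _ _ _ hjk]
      simpa [drift, state, Prod.snd_sum] using hlt
  refine (measure_mono hsub).trans ((measure_union_le _ _).trans ?_)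
  have hval : (L : ℝ) * (S * L * b ^ 2 / (ν / 4) ^ 2) ≤ 4 * (L : ℝ) ^ 2 * (C + 1) / (ν * N) := by
    calc (L : ℝ) * (S * L * b ^ 2 / (ν / 4) ^ 2)
        ≤ L * (ν * N / (4 * (C + 1)) * L * b ^ 2 / (ν / 4) ^ 2) := by gcongr
      _ = 4 * (L : ℝ) ^ 2 * (C + 1) / (ν * N) := by rw [hb]; field_simp
  have hone : ∀ a, selectionLaw V {ω | ∃ j k, k₀ ≤ j ∧ j ≤ k ∧ k < k₀ + S * L ∧
      ν < |∑ i ∈ Finset.Ico j k, h a i ω|} ≤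
      ENNReal.ofReal (4 * (L : ℝ) ^ 2 * (C + 1) / (ν * N)) := fun a =>
    (measure_exists_sum_gt_le (hdep a) (hcent a) (hbound a) hν k₀ L hSpos hSb).trans
      (ENNReal.ofReal_le_ofReal hval)
  rw [two_mul, ENNReal.ofReal_add (by positivity) (by positivity)]
  exact add_le_add (hone _) (hone _)

/-- In a large population the drift is close to the convex hull of the nearby values of the mean
field, except at the critical configurations of the case `α = β`. -/
theorem exists_near_drift {α β δ r : ℝ} (hα : α ∈ Icc (0 : ℝ) 1) (hβ : β ∈ Icc (0 : ℝ) 1)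
    (hr : r ∈ Ioo (0 : ℝ) 1) (hδ : 0 ≤ δ) {η : ℝ} (hη : 0 < η) :
    ∃ κ > 0, ∀ (V : Type*) [Fintype V] [DecidableEq V] (party c : V → Bool),
      (∀ a, 0 < groupSize party a) → 1 < Fintype.card V →
      |groupSize party false / ((Fintype.card V : ℝ) - 1) - (1 - r)| ≤ κ →
      |groupSize party true / ((Fintype.card V : ℝ) - 1) - r| ≤ κ →
      1 / ((Fintype.card V : ℝ) - 1) ≤ κ → ¬ (α = β ∧ IsCritical α δ party c) →
      ∃ w ∈ closedConvexHull ℝ (meanField α β δ r '' Metric.ball (state party c) η),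
        ‖drift α β δ party c - w‖ ≤ η := by
  by_cases hne : α = β
  · subst hne
    obtain ⟨κ, hκ, H⟩ := exists_near_drift_of_eq (δ := δ) hα hr hδ hη
    refine ⟨κ / 3, by positivity, fun V _ _ party c hpos hN h0 h1 h2 hcrit => ?_⟩
    rw [drift_eq hδ party c hpos, memberInfluence_true_of_eq, memberInfluence_true_of_eq]
    have hI : ∀ e, |memberInfluence α α party c false e - blueField α α r (state party c)| ≤ κ := by
      intro e
      have := abs_memberInfluence_sub_le (c := c) (e := e) hα hα hpos hN h0 h1 h2
      rwa [mul_div_cancel₀ _ (three_ne_zero' ℝ)] at this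
    have hz : α = 0 → ∀ e, memberInfluence α α party c false e = 0 := by
      rintro rfl e; simp [memberInfluence]
    exact H _ (state_mem party c) _ _ (fun h => ⟨hz h _, hz h _⟩) (hI _) (hI _)
      fun h => hcrit ⟨rfl, h⟩
  · obtain ⟨κ, hκ, H⟩ := exists_near_drift_of_ne (δ := δ) hα hβ hr hδ hne hη
    refine ⟨κ / 3, by positivity, fun V _ _ party c hpos hN h0 h1 h2 _ => ?_⟩
    rw [drift_eq hδ party c hpos]
    have hI : ∀ e, |memberInfluence α β party c false e - blueField α β r (state party c)| ≤ κ := by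
      intro e
      have := abs_memberInfluence_sub_le (c := c) (e := e) hα hβ hpos hN h0 h1 h2
      rwa [mul_div_cancel₀ _ (three_ne_zero' ℝ)] at this
    have hJ : ∀ e, |memberInfluence α β party c true e - redField α β r (state party c)| ≤ κ := by
      intro e
      have := abs_memberInfluence_sub_le (c := c) (e := e) hα hβ hpos hN h1 h0 h2
      rwa [mul_div_cancel₀ _ (three_ne_zero' ℝ)] at this
    exact H _ (state_mem party c) _ _ _ _ (hI _) (hI _) (hJ _) (hJ _)

/-- If the accumulated noise is small on a window, then the process is an approximate solution
there. -/
theorem isApproxSolution_interpolation {α β δ r : ℝ} (hα : α ∈ Icc (0 : ℝ) 1)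
    (hβ : β ∈ Icc (0 : ℝ) 1) (hr : r ∈ Ioo (0 : ℝ) 1) (hδ : 0 ≤ δ) {T η C : ℝ} (hT : 0 < T)
    (hη : 0 < η) (hC0 : 0 ≤ C) :
    ∃ κ > 0, ∀ (V : Type*) [Fintype V] [DecidableEq V] (party c₀ : V → Bool),
      (∀ a, 0 < groupSize party a) → 1 < Fintype.card V →
      |groupSize party false / ((Fintype.card V : ℝ) - 1) - (1 - r)| ≤ κ →
      |groupSize party true / ((Fintype.card V : ℝ) - 1) - r| ≤ κ →
      1 / ((Fintype.card V : ℝ) - 1) ≤ κ →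
      (∀ a, 1 / (groupSize party a : ℝ) ≤ C / Fintype.card V) →
      C / Fintype.card V ≤ η → 9 / (Fintype.card V : ℝ) ≤ η / 4 →
      ∀ t' : ℝ, 0 ≤ t' → ∀ ω : ℕ → V,
      (∀ j k : ℕ, ⌊Fintype.card V * t'⌋₊ ≤ j → j ≤ k → (k : ℝ) ≤ Fintype.card V * (t' + T) →
        ‖state party (choices α β δ ⊤ party c₀ ω k) -
          state party (choices α β δ ⊤ party c₀ ω j) -
          (Fintype.card V : ℝ)⁻¹ • ∑ i ∈ Finset.Ico j k,
            drift α β δ party (choices α β δ ⊤ party c₀ ω i)‖ ≤ η / 4) →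
      IsApproxSolution (meanField α β δ r) T C η
        (fun t => interpolation α β δ ⊤ party c₀ ω (t' + t)) := by
  -- `e ≤ 1` bounds the norm of `w` by `2`, and the accumulated error `(T + 1) e` is at most `η / 4`
  set e : ℝ := min 1 (min η (η / (4 * (T + 1)))) with he
  have hepos : 0 < e := by positivity
  have he1 : e ≤ 1 := min_le_left _ _
  have heη : e ≤ η := (min_le_right _ _).trans (min_le_left _ _)
  have heT : (T + 1) * e ≤ η / 4 := by
    have : e ≤ η / (4 * (T + 1)) := (min_le_right _ _).trans (min_le_right _ _)
    rw [le_div_iff₀ (by positivity)] at this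
    linarith
  obtain ⟨κ, hκ, H⟩ := exists_near_drift hα hβ hr hδ hepos
  refine ⟨κ, hκ, fun V _ _ party c₀ hpos hN h0 h1 h2 hC hCη h9 t' ht' ω hnoise => ?_⟩
  set c : ℕ → V → Bool := fun k => choices α β δ ⊤ party c₀ ω k with hc
  have hex : ∃ j₀, ∀ j, j ≠ j₀ → ¬ (α = β ∧ IsCritical α δ party (c j)) := by
    by_cases hab : α = β
    · subst hab
      obtain ⟨j₀, hj₀⟩ := exists_index_isCritical hα.1 hδ hN party c₀ ω
      exact ⟨j₀, fun j hj h => hj₀ j hj h.2⟩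
    · exact ⟨0, fun j _ h => hab h.1⟩
  obtain ⟨j₀, hj₀⟩ := hex
  have hw : ∀ j, ∃ w ∈ closedConvexHull ℝ (meanField α β δ r '' Metric.ball (state party (c j)) η),
      ‖w‖ ≤ 2 ∧ ‖drift α β δ party (c j) - w‖ ≤ 3 ∧
        (j ≠ j₀ → ‖drift α β δ party (c j) - w‖ ≤ e) := by
    intro j
    have hd := norm_drift_le (α := α) (β := β) hδ party (c j) hpos
    by_cases hj : j = j₀
    · have hg := norm_meanField_le (α := α) (β := β) (r := r) hδ (state_mem party (c j))
      refine ⟨_, subset_closedConvexHull ⟨_, Metric.mem_ball_self hη, rfl⟩, by linarith, ?_,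
        fun h => absurd hj h⟩
      linarith [norm_sub_le (drift α β δ party (c j)) (meanField α β δ r (state party (c j)))]
    · obtain ⟨w, hw, hdw⟩ := H V party (c j) hpos hN h0 h1 h2 (hj₀ j hj)
      refine ⟨w, (closedConvexHull ℝ).monotone (image_mono (Metric.ball_subset_ball heη)) hw, ?_,
        by linarith, fun _ => hdw⟩
      have := norm_sub_norm_le w (drift α β δ party (c j))
      rw [norm_sub_rev] at this
      linarith
  choose w hw1 hw2 hw3 hw4 using hw
  exact isApproxSolution_of_steps (N := Fintype.card V) (by omega) ht' hC0 hepos.le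
    (Θ := fun k => state party (c k)) (d := fun k => drift α β δ party (c k)) (w := w)
    (fun k => by
      simp only [hc, choices_succ]
      exact norm_state_next_sub_le α β δ party _ _ hC)
    hw1 hw2 hw3 hw4 (fun j k hj hjk hk => hnoise j k hj hjk hk) hCη (by linarith)

/-- On every window the process is an approximate solution with high probability, uniformly in the
position of the window. -/
theorem tendsto_iSup_measure_not_isApproxSolution {α β δ r : ℝ} (hα : α ∈ Icc (0 : ℝ) 1)
    (hβ : β ∈ Icc (0 : ℝ) 1) (hr : r ∈ Ioo (0 : ℝ) 1) (hδ : 0 ≤ δ) (V : ℕ → Type*)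
    [∀ n, Fintype (V n)] [∀ n, Nonempty (V n)] [∀ n, MeasurableSpace (V n)]
    [∀ n, DiscreteMeasurableSpace (V n)] (party c₀ : ∀ n, V n → Bool)
    (hcard : Tendsto (fun n => Fintype.card (V n)) atTop atTop)
    (hred : Tendsto (fun n => redFraction (party n)) atTop (𝓝 r)) {T η : ℝ} (hT : 0 < T)
    (hη : 0 < η) :
    Tendsto (fun n => ⨆ t' ∈ Ici (0 : ℝ), selectionLaw (V n)
      {ω | ¬ IsApproxSolution (meanField α β δ r) T (2 / min r (1 - r)) η
        (fun t => interpolation α β δ ⊤ (party n) (c₀ n) ω (t' + t))}) atTop (𝓝 0) := by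
  classical
  obtain ⟨hr0, hr1⟩ := hr
  set m := min r (1 - r) with hm
  have hmpos : 0 < m := lt_min hr0 (by linarith)
  set C : ℝ := 2 / m with hC
  have hCpos : 0 < C := by positivity
  obtain ⟨κ, hκ, H⟩ := isApproxSolution_interpolation hα hβ ⟨hr0, hr1⟩ hδ hT hη hCpos.le
  have hNr : Tendsto (fun n => (Fintype.card (V n) : ℝ)) atTop atTop :=
    tendsto_natCast_atTop_atTop.comp hcard
  have hinv : ∀ A : ℝ, Tendsto (fun n => A / (Fintype.card (V n) : ℝ)) atTop (𝓝 0) := fun A =>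
    hNr.const_div_atTop A
  have hM : Tendsto (fun n => 1 / ((Fintype.card (V n) : ℝ) - 1)) atTop (𝓝 0) := by
    have : Tendsto (fun n => (Fintype.card (V n) : ℝ) - 1) atTop atTop := by
      simpa [sub_eq_add_neg] using tendsto_atTop_add_const_right atTop (-1 : ℝ) hNr
    exact this.const_div_atTop 1
  have hredN : ∀ n, (groupSize (party n) true : ℝ) =
      redFraction (party n) * Fintype.card (V n) := fun n => by
    have : (Fintype.card (V n) : ℝ) ≠ 0 := by exact_mod_cast Fintype.card_ne_zero
    rw [redFraction]; field_simp
  have hblueN : ∀ n, (groupSize (party n) false : ℝ) =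
      (1 - redFraction (party n)) * Fintype.card (V n) := fun n => by
    have h := groupSize_add (party n)
    have : (groupSize (party n) false : ℝ) + groupSize (party n) true = Fintype.card (V n) := by
      exact_mod_cast h
    rw [hredN] at this
    linarith
  have hratio : ∀ (f : ℕ → ℝ) (l : ℝ), Tendsto f atTop (𝓝 l) →
      Tendsto (fun n => f n * Fintype.card (V n) / ((Fintype.card (V n) : ℝ) - 1)) atTop (𝓝 l) := by
    intro f l hf
    have h1 : Tendsto (fun n => f n + f n * (1 / ((Fintype.card (V n) : ℝ) - 1))) atTop
        (𝓝 (l + l * 0)) := hf.add (hf.mul hM)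
    rw [mul_zero, add_zero] at h1
    refine h1.congr' ?_
    filter_upwards [hNr.eventually_gt_atTop 1] with n hn
    have : (Fintype.card (V n) : ℝ) - 1 ≠ 0 := by linarith
    field_simp
    ring
  have hblue : Tendsto (fun n => 1 - redFraction (party n)) atTop (𝓝 (1 - r)) :=
    tendsto_const_nhds.sub hred
  have e1 := (Metric.tendsto_nhds.1 (hratio _ _ hblue)) κ hκ
  have e2 := (Metric.tendsto_nhds.1 (hratio _ _ hred)) κ hκ
  have e3 := hM.eventually_le_const hκ
  have e4 : ∀ᶠ n in atTop, m / 2 < redFraction (party n) :=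
    hred.eventually_const_lt (by linarith [min_le_left r (1 - r)])
  have e5 : ∀ᶠ n in atTop, m / 2 < 1 - redFraction (party n) :=
    hblue.eventually_const_lt (by linarith [min_le_right r (1 - r)])
  have e6 := (hinv C).eventually_le_const hη
  have e7 := (hinv 9).eventually_le_const (show 0 < η / 4 by positivity)
  have e8 := hNr.eventually_ge_atTop (8 * (C + 1) / (η / 4))
  have e9 := hNr.eventually_gt_atTop 1
  set A : ℝ := 2 * (4 * (⌈8 * (C + 1) * (T + 1) / (η / 4)⌉₊ : ℝ) ^ 2 * (C + 1) / (η / 4)) with hA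
  have hlim : Tendsto (fun n => ENNReal.ofReal (A / Fintype.card (V n))) atTop (𝓝 0) := by
    simpa using ENNReal.tendsto_ofReal (hinv A)
  refine tendsto_of_tendsto_of_tendsto_of_le_of_le' tendsto_const_nhds hlim
    (Eventually.of_forall fun _ => zero_le) ?_
  filter_upwards [e1, e2, e3, e4, e5, e6, e7, e8, e9] with n h1 h2 h3 h4 h5 h6 h7 h8 h9
  have hN0 : (0 : ℝ) < Fintype.card (V n) := by linarith
  have hsize : ∀ a, m / 2 * Fintype.card (V n) ≤ groupSize (party n) a := by
    intro a
    cases a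
    · rw [hblueN]; gcongr
    · rw [hredN]; gcongr
  have hpos : ∀ a, 0 < groupSize (party n) a := fun a => by
    have : (0 : ℝ) < groupSize (party n) a := lt_of_lt_of_le (by positivity) (hsize a)
    exact_mod_cast this
  have hCa : ∀ a, 1 / (groupSize (party n) a : ℝ) ≤ C / Fintype.card (V n) := by
    intro a
    calc 1 / (groupSize (party n) a : ℝ) ≤ 1 / (m / 2 * Fintype.card (V n)) := by
          gcongr; exact hsize a
      _ = C / Fintype.card (V n) := by rw [hC]; field_simp
  refine iSup₂_le fun t' ht' => ?_
  have hnoise := measure_noise_gt_le (α := α) (β := β) hδ (party n) (c₀ n) hpos hCpos.le hCa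
    (t' := t') (show 0 < η / 4 by positivity) hT h8
  refine (measure_mono fun ω hω => ?_).trans (hnoise.trans (le_of_eq ?_))
  · by_contra hcon
    refine hω (H (V n) (party n) (c₀ n) hpos (by exact_mod_cast h9) ?_ ?_ h3 hCa h6 h7 t' ht' ω
      fun j k hj hjk hk => ?_)
    · rw [hblueN]; exact (Real.dist_eq _ _ ▸ h1).le
    · rw [hredN]; exact (Real.dist_eq _ _ ▸ h2).le
    · by_contra hlt
      exact hcon ⟨j, k, hj, hjk, hk, not_le.1 hlt⟩
  · congr 1
    rw [hA]; field_simp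

theorem distToSet_le {T ε : ℝ} {z x : ℝ → ℝ × ℝ} {S : Set (ℝ → ℝ × ℝ)}
    (hx : x ∈ S) (h : ∀ t ∈ Icc (0 : ℝ) T, dist (z t) (x t) ≤ ε) :
    distToSet T z S ≤ ENNReal.ofReal ε := by
  refine (iInf₂_le x hx).trans (iSup₂_le fun t ht => ?_)
  rw [edist_dist]
  exact ENNReal.ofReal_le_ofReal (h t ht)

end Convergence

end AffectivePolarization

namespace AffectivePolarization

/-! ### Comparison principles for absolutely continuous functions -/

theorem le_of_ae_deriv_nonneg {X : ℝ → ℝ} {T s t : ℝ} (hX : AbsolutelyContinuousOnInterval X 0 T)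
    (hs : 0 ≤ s) (hst : s ≤ t) (htT : t ≤ T)
    (h : ∀ᵐ τ, τ ∈ Ioo s t → ∃ D, 0 ≤ D ∧ HasDerivAt X D τ) : X s ≤ X t := by
  have hsub : uIcc s t ⊆ uIcc 0 T := by
    rw [uIcc_of_le hst, uIcc_of_le (hs.trans (hst.trans htT))]
    exact Icc_subset_Icc hs htT
  rw [← sub_nonneg, ← (hX.mono hsub).integral_deriv_eq_sub, intervalIntegral.integral_of_le hst,
    ← integral_Ioc_eq_integral_Ioo.symm]
  refine setIntegral_nonneg_of_ae_restrict ?_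
  rw [EventuallyLE, ae_restrict_iff' measurableSet_Ioo]
  filter_upwards [h] with τ hτ hmem
  obtain ⟨D, hD, hd⟩ := hτ hmem
  rw [hd.deriv]; exact hD

/-- A function stays above a barrier `φ`, if it increases at least as much as `φ` on every interval
on which it lies slightly below `φ`. -/
theorem barrier_le {X φ : ℝ → ℝ} {T γ : ℝ} (hX : ContinuousOn X (Icc 0 T))
    (hφ : ContinuousOn φ (Icc 0 T)) (hγ : 0 < γ) (h0 : φ 0 ≤ X 0)
    (h : ∀ s t, 0 ≤ s → s < t → t ≤ T → (∀ τ ∈ Ioc s t, φ τ - γ < X τ ∧ X τ < φ τ) →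
      φ t - φ s ≤ X t - X s) : ∀ t ∈ Icc 0 T, φ t ≤ X t := by
  intro t ht
  by_contra hlt
  rw [not_le] at hlt
  have hXt := hX.mono (Icc_subset_Icc le_rfl ht.2)
  have hφt := hφ.mono (Icc_subset_Icc le_rfl ht.2)
  -- the last time `s` at which `X` is not below the barrier
  set A : Set ℝ := {s ∈ Icc 0 t | φ s ≤ X s} with hA
  have hAc : IsClosed A := isClosed_Icc.isClosed_le hφt hXt
  have hne : A.Nonempty := ⟨0, ⟨le_rfl, ht.1⟩, h0⟩
  have hbdd : BddAbove A := ⟨t, fun s hs => hs.1.2⟩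
  obtain ⟨hsI, hs⟩ := hAc.csSup_mem hne hbdd
  set s := sSup A with hsdef
  have hst : s < t := lt_of_le_of_ne hsI.2 fun h => by rw [h] at hs; linarith
  have hafter : ∀ τ ∈ Ioc s t, X τ < φ τ := fun τ hτ => by
    by_contra hcon
    exact absurd (le_csSup hbdd ⟨⟨hsI.1.trans hτ.1.le, hτ.2⟩, not_lt.1 hcon⟩) (not_le.2 hτ.1)
  have hcont : ContinuousWithinAt (fun τ => X τ - φ τ) (Icc 0 T) s :=
    (hX.sub hφ) s ⟨hsI.1, hsI.2.trans ht.2⟩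
  have hev : ∀ᶠ τ in 𝓝[Icc 0 T] s, -γ < X τ - φ τ :=
    hcont.eventually (lt_mem_nhds (by linarith))
  rw [eventually_nhdsWithin_iff, Metric.eventually_nhds_iff] at hev
  obtain ⟨d, hd, hnear⟩ := hev
  set t₂ := min t (s + d / 2) with ht₂
  have hst₂ : s < t₂ := lt_min hst (by linarith)
  have ht₂t : t₂ ≤ t := min_le_left _ _
  have ht₂d : t₂ ≤ s + d / 2 := min_le_right _ _
  have := h s t₂ hsI.1 hst₂ (ht₂t.trans ht.2) fun τ hτ => by
    refine ⟨?_, hafter τ ⟨hτ.1, hτ.2.trans ht₂t⟩⟩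
    have := hnear (y := τ) (by
      rw [Real.dist_eq, abs_of_pos (by linarith [hτ.1])]; linarith [hτ.2])
      ⟨hsI.1.trans hτ.1.le, hτ.2.trans (ht₂t.trans ht.2)⟩
    linarith
  linarith [hafter t₂ ⟨hst₂, ht₂t⟩]

/-- The first time at which a continuous function that starts below zero is nonnegative. -/
theorem exists_first_nonneg {f : ℝ → ℝ} {t : ℝ} (ht : 0 ≤ t) (hf : ContinuousOn f (Icc 0 t))
    (h0 : f 0 < 0) (hft : 0 ≤ f t) :
    ∃ t₁ ∈ Ioc 0 t, 0 ≤ f t₁ ∧ ∀ s ∈ Ico 0 t₁, f s < 0 := by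
  set A : Set ℝ := {s ∈ Icc 0 t | 0 ≤ f s} with hA
  have hAc : IsClosed A := isClosed_Icc.isClosed_le continuousOn_const hf
  have hbdd : BddBelow A := ⟨0, fun s hs => hs.1.1⟩
  obtain ⟨hsI, hs⟩ := hAc.csInf_mem ⟨t, ⟨ht, le_rfl⟩, hft⟩ hbdd
  refine ⟨sInf A, ⟨lt_of_le_of_ne hsI.1 fun h => ?_, hsI.2⟩, hs, fun s hs' => ?_⟩
  · rw [← h] at hs; linarith
  · by_contra hcon
    exact absurd (csInf_le hbdd ⟨⟨hs'.1, hs'.2.le.trans hsI.2⟩, not_lt.1 hcon⟩) (not_le.2 hs'.2)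

theorem continuousOn_of_ac {X : ℝ → ℝ} {T : ℝ} (hT : 0 ≤ T)
    (hX : AbsolutelyContinuousOnInterval X 0 T) : ContinuousOn X (Icc 0 T) := by
  have := hX.continuousOn
  rwa [uIcc_of_le hT] at this

theorem ae_mem_Ioo_of_subset {p : ℝ → Prop} {T s t : ℝ} (hs : 0 ≤ s) (ht : t ≤ T)
    (h : ∀ᵐ τ, τ ∈ Ioo 0 T → p τ) : ∀ᵐ τ, τ ∈ Ioo s t → p τ := by
  filter_upwards [h] with τ hτ hmem
  exact hτ ⟨hs.trans_lt hmem.1, hmem.2.trans_le ht⟩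

theorem nonneg_of_ae_deriv_nonneg {X : ℝ → ℝ} {T : ℝ} (hT : 0 ≤ T)
    (hX : AbsolutelyContinuousOnInterval X 0 T) (h0 : 0 ≤ X 0)
    (h : ∀ᵐ t, t ∈ Ioo 0 T → X t < 0 → ∃ D, 0 ≤ D ∧ HasDerivAt X D t) :
    ∀ t ∈ Icc 0 T, 0 ≤ X t := by
  refine barrier_le (φ := fun _ => 0) (continuousOn_of_ac hT hX) continuousOn_const one_pos h0 ?_
  intro s t hs hst htT hbelow
  rw [sub_self, sub_nonneg]
  refine le_of_ae_deriv_nonneg hX hs hst.le htT ?_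
  filter_upwards [ae_mem_Ioo_of_subset hs htT h] with τ hτ hmem
  exact hτ hmem (hbelow τ (Ioo_subset_Ioc_self hmem)).2

/-- A positive function that does not decrease while it is positive remains positive. -/
theorem le_of_ae_deriv_nonneg_of_pos {X : ℝ → ℝ} {T : ℝ} (hT : 0 ≤ T)
    (hX : AbsolutelyContinuousOnInterval X 0 T) (h0 : 0 < X 0)
    (h : ∀ᵐ t, t ∈ Ioo 0 T → 0 < X t → ∃ D, 0 ≤ D ∧ HasDerivAt X D t) :
    ∀ t ∈ Icc 0 T, X 0 ≤ X t := by
  refine barrier_le (φ := fun _ => X 0) (continuousOn_of_ac hT hX) continuousOn_const h0 le_rfl ?_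
  intro s t hs hst htT hbelow
  rw [sub_self, sub_nonneg]
  refine le_of_ae_deriv_nonneg hX hs hst.le htT ?_
  filter_upwards [ae_mem_Ioo_of_subset hs htT h] with τ hτ hmem
  have := (hbelow τ (Ioo_subset_Ioc_self hmem)).1
  exact hτ hmem (by linarith)

theorem ac_const_mul_exp (k T : ℝ) :
    AbsolutelyContinuousOnInterval (fun t => k * Real.exp t) 0 T :=
  (Real.contDiff_exp.contDiffOn (n := 1)).absolutelyContinuousOnInterval.const_mul k

/-- Transversal crossing.  If `X' = k eᵗ` where `X < 0`, and `X' ≥ k eᵗ` where `X` is below some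
positive level, then the sign of `X` is that of `X 0 + k (eᵗ - 1)`. -/
theorem sign_of_crossing {X : ℝ → ℝ} {T k l : ℝ} (hT : 0 ≤ T)
    (hX : AbsolutelyContinuousOnInterval X 0 T) (hk : 0 < k) (hl : 0 < l)
    (h1 : ∀ᵐ t, t ∈ Ioo 0 T → X t < l → ∃ D, k * Real.exp t ≤ D ∧ HasDerivAt X D t)
    (h2 : ∀ᵐ t, t ∈ Ioo 0 T → X t < 0 → HasDerivAt X (k * Real.exp t) t) :
    ∀ t ∈ Icc 0 T, (0 < X 0 + k * (Real.exp t - 1) → 0 < X t) ∧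
      (X 0 + k * (Real.exp t - 1) < 0 → X t < 0) := by
  have hXc := continuousOn_of_ac hT hX
  have hexpder : ∀ t, HasDerivAt (fun t => k * Real.exp t) (k * Real.exp t) t := fun t =>
    (Real.hasDerivAt_exp t).const_mul k
  -- the barrier follows `X 0 + k (eᵗ - 1)` up to the level `l`
  have lower : ∀ t ∈ Icc 0 T, min l (X 0 + k * (Real.exp t - 1)) ≤ X t := by
    refine barrier_le (γ := 1) hXc (by fun_prop) one_pos (by simp) ?_
    intro s t hs hst htT hbelow
    have hinc : X s - k * Real.exp s ≤ X t - k * Real.exp t := by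
      refine le_of_ae_deriv_nonneg (hX.sub (ac_const_mul_exp k T)) hs hst.le htT ?_
      filter_upwards [ae_mem_Ioo_of_subset hs htT h1] with τ hτ hmem
      obtain ⟨D, hD, hd⟩ := hτ hmem
        ((hbelow τ (Ioo_subset_Ioc_self hmem)).2.trans_le (min_le_left _ _))
      exact ⟨D - k * Real.exp τ, by linarith, hd.sub (hexpder τ)⟩
    have hmono : k * Real.exp s ≤ k * Real.exp t := by gcongr
    rcases le_total l (X 0 + k * (Real.exp s - 1)) with hc | hc
    · rw [min_eq_left hc, min_eq_left (by linarith)]; linarith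
    · rw [min_eq_right hc]
      linarith [min_le_right l (X 0 + k * (Real.exp t - 1))]
  refine fun t ht => ⟨fun hpos => (lt_min hl hpos).trans_le (lower t ht), fun hneg => ?_⟩
  by_contra hcon
  rw [not_lt] at hcon
  have hX0 : X 0 < 0 := by
    have : 0 ≤ k * (Real.exp t - 1) := mul_nonneg hk.le (by linarith [Real.one_le_exp ht.1])
    linarith
  -- up to the first time at which `X` is nonnegative, it equals `X 0 + k (eᵗ - 1)`
  obtain ⟨t₁, ht₁, hX₁, hbefore⟩ := exists_first_nonneg ht.1
    (hXc.mono (Icc_subset_Icc le_rfl ht.2)) hX0 hcon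
  have hdec : k * Real.exp 0 - X 0 ≤ k * Real.exp t₁ - X t₁ := by
    refine le_of_ae_deriv_nonneg ((ac_const_mul_exp k T).sub hX) le_rfl ht₁.1.le
      (ht₁.2.trans ht.2) ?_
    filter_upwards [ae_mem_Ioo_of_subset le_rfl (ht₁.2.trans ht.2) h2] with τ hτ hmem
    exact ⟨_, (sub_self _).ge, (hexpder τ).sub (hτ hmem (hbefore τ ⟨hmem.1.le, hmem.2⟩))⟩
  have hmono : k * Real.exp t₁ ≤ k * Real.exp t := by
    have := ht₁.2
    gcongr
  rw [Real.exp_zero] at hdec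
  linarith

/-! ### The rescaled sign system

With `p = 2 θᴮ - 1`, `q = 2 θᴿ - 1`, `P = eᵗ p` and `Q = eᵗ q`, a Filippov solution without inertia
satisfies `P' = eᵗ σ` and `Q' = eᵗ τ`, where `σ` and `τ` are the signs of the linear forms
`a P - b Q` and `c Q - d P`. -/

/-- `(P, Q)` solves the sign system on `[0, T]`; on the lines on which a linear form vanishes the
corresponding sign may be any number in `[-1, 1]`. -/
structure IsSignSolution (a b c d T : ℝ) (P Q : ℝ → ℝ) : Prop where
  ac_fst : AbsolutelyContinuousOnInterval P 0 T
  ac_snd : AbsolutelyContinuousOnInterval Q 0 T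
  ae_deriv : ∀ᵐ t, t ∈ Ioo 0 T → ∃ σ τ : ℝ, HasDerivAt P (σ * Real.exp t) t ∧
    HasDerivAt Q (τ * Real.exp t) t ∧ |σ| ≤ 1 ∧ |τ| ≤ 1 ∧
    (0 < a * P t - b * Q t → σ = 1) ∧ (a * P t - b * Q t < 0 → σ = -1) ∧
    (0 < c * Q t - d * P t → τ = 1) ∧ (c * Q t - d * P t < 0 → τ = -1)

namespace IsSignSolution

variable {a b c d T : ℝ} {P Q : ℝ → ℝ}

theorem swap (h : IsSignSolution a b c d T P Q) : IsSignSolution c d a b T Q P := by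
  refine ⟨h.ac_snd, h.ac_fst, ?_⟩
  filter_upwards [h.ae_deriv] with t ht hmem
  obtain ⟨σ, τ, h1, h2, h3, h4, h5, h6, h7, h8⟩ := ht hmem
  exact ⟨τ, σ, h2, h1, h4, h3, h7, h8, h5, h6⟩

theorem neg (h : IsSignSolution a b c d T P Q) : IsSignSolution a b c d T (-P) (-Q) := by
  refine ⟨h.ac_fst.neg, h.ac_snd.neg, ?_⟩
  filter_upwards [h.ae_deriv] with t ht hmem
  obtain ⟨σ, τ, h1, h2, h3, h4, h5, h6, h7, h8⟩ := ht hmem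
  refine ⟨-σ, -τ, ?_, ?_, by rwa [abs_neg], by rwa [abs_neg], ?_, ?_, ?_, ?_⟩
  · rw [neg_mul]; exact h1.neg
  · rw [neg_mul]; exact h2.neg
  all_goals simp only [Pi.neg_apply]; intro hs
  · rw [h6 (by linarith)]; norm_num
  · rw [h5 (by linarith)]
  · rw [h8 (by linarith)]; norm_num
  · rw [h7 (by linarith)]

theorem ac_form (h : IsSignSolution a b c d T P Q) (x y : ℝ) :
    AbsolutelyContinuousOnInterval (fun t => x * P t - y * Q t) 0 T :=
  (h.ac_fst.const_mul x).sub (h.ac_snd.const_mul y)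

theorem hasDerivAt_form {σ τ t : ℝ} (hP : HasDerivAt P (σ * Real.exp t) t)
    (hQ : HasDerivAt Q (τ * Real.exp t) t) (x y : ℝ) :
    HasDerivAt (fun t => x * P t - y * Q t) ((x * σ - y * τ) * Real.exp t) t := by
  have e : (x * σ - y * τ) * Real.exp t = x * (σ * Real.exp t) - y * (τ * Real.exp t) := by ring
  rw [e]
  exact (hP.const_mul x).sub (hQ.const_mul y)

/-- If love dominates in the blue group, solutions do not reach the line `a P = b Q`. -/
theorem pos_of_le (h : IsSignSolution a b c d T P Q) (hT : 0 ≤ T) (hb : 0 ≤ b) (hba : b ≤ a)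
    (h0 : 0 < a * P 0 - b * Q 0) : ∀ t ∈ Icc 0 T, 0 < a * P t - b * Q t := by
  refine fun t ht => h0.trans_le (le_of_ae_deriv_nonneg_of_pos hT (h.ac_form a b) h0 ?_ t ht)
  filter_upwards [h.ae_deriv] with t ht hmem hpos
  obtain ⟨σ, τ, h1, h2, h3, h4, h5, -⟩ := ht hmem
  refine ⟨_, ?_, hasDerivAt_form h1 h2 a b⟩
  rw [h5 hpos]
  have := (abs_le.1 h4).2
  have : 0 ≤ a * 1 - b * τ := by nlinarith
  positivity

/-- If hate dominates in the red group, solutions with `a P > b Q` cross the line `c Q = d P` at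
most once. -/
theorem crossing_of_pos (h : IsSignSolution a b c d T P Q) (hT : 0 ≤ T) (hc : 0 ≤ c) (hcd : c < d)
    (hpos : ∀ t ∈ Icc 0 T, 0 < a * P t - b * Q t) :
    ∀ t ∈ Icc 0 T, (0 < d * P 0 - c * Q 0 + (d - c) * (Real.exp t - 1) → 0 < d * P t - c * Q t) ∧
      (d * P 0 - c * Q 0 + (d - c) * (Real.exp t - 1) < 0 → d * P t - c * Q t < 0) := by
  refine sign_of_crossing hT (h.ac_form d c) (sub_pos.2 hcd) one_pos ?_ ?_
  · filter_upwards [h.ae_deriv] with t ht hmem _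
    obtain ⟨σ, τ, h1, h2, h3, h4, h5, -⟩ := ht hmem
    refine ⟨_, ?_, hasDerivAt_form h1 h2 d c⟩
    rw [h5 (hpos t (Ioo_subset_Icc_self hmem))]
    have := (abs_le.1 h4).2
    exact mul_le_mul_of_nonneg_right (by nlinarith) (Real.exp_pos t).le
  · filter_upwards [h.ae_deriv] with t ht hmem hneg
    obtain ⟨σ, τ, h1, h2, h3, h4, h5, -, h7, -⟩ := ht hmem
    have := hasDerivAt_form h1 h2 d c
    rwa [h5 (hpos t (Ioo_subset_Icc_self hmem)), h7 (by linarith), mul_one, mul_one] at this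

/-- In Case 4 the quantity `P - Q`, once positive, does not decrease. -/
theorem sub_le_sub (h : IsSignSolution a b c d T P Q) (hT : 0 ≤ T) (hab : a < b) (hcd : c < d)
    (ha : 0 ≤ a) (hc : 0 ≤ c) (h0 : Q 0 < P 0) : ∀ t ∈ Icc 0 T, P 0 - Q 0 ≤ P t - Q t := by
  have hac := h.ac_form 1 1
  simp only [one_mul] at hac
  refine le_of_ae_deriv_nonneg_of_pos hT hac (sub_pos.2 h0) ?_
  filter_upwards [h.ae_deriv] with t ht hmem hpos
  obtain ⟨σ, τ, h1, h2, h3, h4, h5, -, -, h8⟩ := ht hmem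
  rw [abs_le] at h3 h4
  refine ⟨σ * Real.exp t - τ * Real.exp t, ?_, h1.sub h2⟩
  rw [← sub_mul]
  refine mul_nonneg ?_ (Real.exp_pos t).le
  by_cases hU : 0 < a * P t - b * Q t
  · rw [h5 hU]; linarith [h4.2]
  · -- where `P > Q`, one of the two forms has the sign that makes `P - Q` grow
    have : c * Q t - d * P t < 0 := by
      have key : (d - c) * (a * P t - b * Q t) - (b - a) * (c * Q t - d * P t) =
          (b * d - a * c) * (P t - Q t) := by ring
      have hΔ : 0 < b * d - a * c := by nlinarith
      by_contra hV
      have e1 := mul_nonneg (sub_pos.2 hcd).le (neg_nonneg.2 (not_lt.1 hU))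
      have e2 := mul_nonneg (sub_pos.2 hab).le (not_lt.1 hV)
      have e3 := mul_pos hΔ hpos
      linarith
    rw [h8 this]; linarith [h3.1]

/-- In Case 4, solutions with `P > Q` cross the line `a P = b Q` at most once. -/
theorem crossing_of_case4 (h : IsSignSolution a b c d T P Q) (hT : 0 ≤ T) (hab : a < b)
    (hcd : c < d) (ha : 0 ≤ a) (hc : 0 ≤ c) (h0 : Q 0 < P 0) :
    ∀ t ∈ Icc 0 T, (0 < a * P 0 - b * Q 0 + (b - a) * (Real.exp t - 1) → 0 < a * P t - b * Q t) ∧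
      (a * P 0 - b * Q 0 + (b - a) * (Real.exp t - 1) < 0 → a * P t - b * Q t < 0) := by
  have hΔ : 0 < b * d - a * c := by nlinarith
  have hW := h.sub_le_sub hT hab hcd ha hc h0
  -- `P - Q` is bounded below, so that the red form is negative as long as the blue one stays below
  -- a certain positive level
  have hneg : ∀ t ∈ Icc 0 T, a * P t - b * Q t < (b * d - a * c) * (P 0 - Q 0) / (d - c) →
      c * Q t - d * P t < 0 := by
    intro t ht hlt
    rw [lt_div_iff₀ (sub_pos.2 hcd)] at hlt
    have key : (d - c) * (a * P t - b * Q t) - (b - a) * (c * Q t - d * P t) =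
        (b * d - a * c) * (P t - Q t) := by ring
    have e1 := mul_le_mul_of_nonneg_left (hW t ht) hΔ.le
    have e2 : (b - a) * (c * Q t - d * P t) < 0 := by linarith
    exact neg_of_mul_neg_right e2 (sub_pos.2 hab).le
  have hl : 0 < (b * d - a * c) * (P 0 - Q 0) / (d - c) :=
    div_pos (mul_pos hΔ (sub_pos.2 h0)) (sub_pos.2 hcd)
  refine sign_of_crossing hT (h.ac_form a b) (sub_pos.2 hab) hl ?_ ?_
  · filter_upwards [h.ae_deriv] with t ht hmem hlt
    obtain ⟨σ, τ, h1, h2, h3, h4, -, -, -, h8⟩ := ht hmem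
    refine ⟨_, ?_, hasDerivAt_form h1 h2 a b⟩
    rw [h8 (hneg t (Ioo_subset_Icc_self hmem) hlt)]
    have := (abs_le.1 h3).1
    exact mul_le_mul_of_nonneg_right (by nlinarith) (Real.exp_pos t).le
  · filter_upwards [h.ae_deriv] with t ht hmem hlt
    obtain ⟨σ, τ, h1, h2, h3, h4, -, h6, -, h8⟩ := ht hmem
    have := hasDerivAt_form h1 h2 a b
    rw [h8 (hneg t (Ioo_subset_Icc_self hmem) (hlt.trans hl)), h6 hlt] at this
    convert this using 1
    ring

end IsSignSolution

end AffectivePolarization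

namespace AffectivePolarization

/-! ### Uniqueness for the sign system -/

/-- Any two solutions of the sign system with the initial values `p` and `q` agree. -/
def UniqueFrom (a b c d p q : ℝ) : Prop :=
  ∀ T, 0 ≤ T → ∀ P Q P' Q' : ℝ → ℝ, IsSignSolution a b c d T P Q →
    IsSignSolution a b c d T P' Q' → P 0 = p → Q 0 = q → P' 0 = p → Q' 0 = q →
    ∀ t ∈ Icc 0 T, P t = P' t ∧ Q t = Q' t

section Uniqueness

variable {a b c d p q : ℝ}

theorem UniqueFrom.swap (h : UniqueFrom c d a b q p) : UniqueFrom a b c d p q :=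
  fun T hT P Q P' Q' hs hs' h1 h2 h3 h4 t ht =>
    (h T hT Q P Q' P' hs.swap hs'.swap h2 h1 h4 h3 t ht).symm

theorem UniqueFrom.neg (h : UniqueFrom a b c d (-p) (-q)) : UniqueFrom a b c d p q := by
  intro T hT P Q P' Q' hs hs' h1 h2 h3 h4 t ht
  have := h T hT (-P) (-Q) (-P') (-Q') hs.neg hs'.neg (by simp [h1]) (by simp [h2]) (by simp [h3])
    (by simp [h4]) t ht
  simpa using this

/-- Solutions are unique if the signs of the two linear forms are known at almost every time. -/
theorem uniqueFrom_of_signs (s₁ s₂ : ℝ → ℝ)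
    (h : ∀ T, 0 ≤ T → ∀ P Q : ℝ → ℝ, IsSignSolution a b c d T P Q → P 0 = p → Q 0 = q →
      ∀ᵐ t, t ∈ Icc 0 T →
        ((0 < a * P t - b * Q t ∧ s₁ t = 1) ∨ (a * P t - b * Q t < 0 ∧ s₁ t = -1)) ∧
        ((0 < c * Q t - d * P t ∧ s₂ t = 1) ∨ (c * Q t - d * P t < 0 ∧ s₂ t = -1))) :
    UniqueFrom a b c d p q := by
  have known : ∀ T, 0 ≤ T → ∀ P Q : ℝ → ℝ, IsSignSolution a b c d T P Q → P 0 = p → Q 0 = q →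
      ∀ᵐ t, t ∈ uIcc 0 T → HasDerivAt P (s₁ t * Real.exp t) t ∧
        HasDerivAt Q (s₂ t * Real.exp t) t := by
    intro T hT P Q hs hP hQ
    have e0 : ∀ᵐ t : ℝ, t ≠ 0 := by simp [ae_iff, measure_singleton]
    have e1 : ∀ᵐ t : ℝ, t ≠ T := by simp [ae_iff, measure_singleton]
    rw [uIcc_of_le hT]
    filter_upwards [hs.ae_deriv, h T hT P Q hs hP hQ, e0, e1] with t ht hsg n0 n1 hmem
    obtain ⟨σ, τ, h1, h2, -, -, h5, h6, h7, h8⟩ :=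
      ht ⟨lt_of_le_of_ne hmem.1 n0.symm, lt_of_le_of_ne hmem.2 n1⟩
    obtain ⟨hu, hv⟩ := hsg hmem
    constructor
    · rcases hu with ⟨hu, hs⟩ | ⟨hu, hs⟩
      · rw [hs, ← h5 hu]; exact h1
      · rw [hs, ← h6 hu]; exact h1
    · rcases hv with ⟨hv, hs⟩ | ⟨hv, hs⟩
      · rw [hs, ← h7 hv]; exact h2
      · rw [hs, ← h8 hv]; exact h2
  have const : ∀ (T : ℝ) (X : ℝ → ℝ), AbsolutelyContinuousOnInterval X 0 T → X 0 = 0 →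
      (∀ᵐ t, t ∈ uIcc 0 T → HasDerivAt X 0 t) → ∀ t ∈ uIcc 0 T, X t = 0 := by
    intro T X hX h0 hd t ht
    obtain ⟨C, hC⟩ := hX.const_of_ae_hasDerivAt_zero hd
    rw [hC t ht, ← hC 0 left_mem_uIcc, h0]
  intro T hT P Q P' Q' hs hs' h1 h2 h3 h4 t ht
  have k := known T hT P Q hs h1 h2
  have k' := known T hT P' Q' hs' h3 h4
  rw [← uIcc_of_le hT] at ht
  refine ⟨sub_eq_zero.1 (const T (P - P') (hs.ac_fst.sub hs'.ac_fst) (by simp [h1, h3]) ?_ t ht),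
    sub_eq_zero.1 (const T (Q - Q') (hs.ac_snd.sub hs'.ac_snd) (by simp [h2, h4]) ?_ t ht)⟩
  · filter_upwards [k, k'] with t ht ht' hmem
    simpa using (ht hmem).1.sub (ht' hmem).1
  · filter_upwards [k, k'] with t ht ht' hmem
    simpa using (ht hmem).2.sub (ht' hmem).2

/-- The sign of `x + k (eᵗ - 1)`. -/
noncomputable def crossingSign (x k t : ℝ) : ℝ := if 0 < x + k * (Real.exp t - 1) then 1 else -1

theorem ae_crossing_ne_zero (x : ℝ) {k : ℝ} (hk : 0 < k) :
    ∀ᵐ t : ℝ, x + k * (Real.exp t - 1) ≠ 0 := by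
  have : {t : ℝ | ¬ x + k * (Real.exp t - 1) ≠ 0}.Subsingleton := by
    intro s hs t ht
    simp only [ne_eq, not_not, mem_ofPred_eq] at hs ht
    have : k * Real.exp s = k * Real.exp t := by linarith
    exact Real.exp_injective (mul_left_cancel₀ hk.ne' this)
  exact this.measure_zero _

theorem crossingSign_cases {X : ℝ} {x k t : ℝ} (hne : x + k * (Real.exp t - 1) ≠ 0)
    (h : (0 < x + k * (Real.exp t - 1) → 0 < X) ∧ (x + k * (Real.exp t - 1) < 0 → X < 0)) :
    (0 < X ∧ crossingSign x k t = 1) ∨ (X < 0 ∧ crossingSign x k t = -1) := by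
  rcases lt_or_gt_of_ne hne with h' | h'
  · exact Or.inr ⟨h.2 h', if_neg h'.le.not_gt⟩
  · exact Or.inl ⟨h.1 h', if_pos h'⟩

/-- Love dominates in both groups: both signs persist. -/
theorem uniqueFrom_of_le_of_le (hb : 0 ≤ b) (hd : 0 ≤ d) (hba : b ≤ a) (hdc : d ≤ c)
    (hU : a * p - b * q ≠ 0) (hV : c * q - d * p ≠ 0) : UniqueFrom a b c d p q := by
  have persist : ∀ {a b c d p q : ℝ}, 0 ≤ b → b ≤ a → a * p - b * q ≠ 0 → ∀ T, 0 ≤ T →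
      ∀ P Q : ℝ → ℝ, IsSignSolution a b c d T P Q → P 0 = p → Q 0 = q → ∀ t ∈ Icc 0 T,
      (0 < a * P t - b * Q t ∧ (if 0 < a * p - b * q then (1 : ℝ) else -1) = 1) ∨
        (a * P t - b * Q t < 0 ∧ (if 0 < a * p - b * q then (1 : ℝ) else -1) = -1) := by
    intro a b c d p q hb hba hU T hT P Q hs hP hQ t ht
    rcases lt_or_gt_of_ne hU with h | h
    · right
      have := hs.neg.pos_of_le hT hb hba (by simp only [Pi.neg_apply, hP, hQ]; linarith) t ht
      simp only [Pi.neg_apply] at this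
      exact ⟨by linarith, if_neg h.le.not_gt⟩
    · left
      exact ⟨hs.pos_of_le hT hb hba (by rwa [hP, hQ]) t ht, if_pos h⟩
  refine uniqueFrom_of_signs (fun _ => if 0 < a * p - b * q then (1 : ℝ) else -1)
    (fun _ => if 0 < c * q - d * p then (1 : ℝ) else -1) ?_
  intro T hT P Q hs hP hQ
  refine Eventually.of_forall fun t ht => ⟨persist hb hba hU T hT P Q hs hP hQ t ht,
    persist hd hdc hV T hT Q P hs.swap hQ hP t ht⟩

/-- Love dominates in the blue group, hate in the red group: the sign of the blue form persists and
that of the red form changes at most once. -/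
theorem uniqueFrom_of_le_of_lt (hb : 0 ≤ b) (hc : 0 ≤ c) (hba : b ≤ a) (hcd : c < d)
    (hU : a * p - b * q ≠ 0) : UniqueFrom a b c d p q := by
  have main : ∀ p q : ℝ, 0 < a * p - b * q → UniqueFrom a b c d p q := by
    intro p q hU
    refine uniqueFrom_of_signs (fun _ => 1)
      (fun t => -crossingSign (d * p - c * q) (d - c) t) ?_
    intro T hT P Q hs hP hQ
    have hpos := hs.pos_of_le hT hb hba (by rwa [hP, hQ])
    have hcross := hs.crossing_of_pos hT hc hcd hpos
    rw [hP, hQ] at hcross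
    filter_upwards [ae_crossing_ne_zero (d * p - c * q) (sub_pos.2 hcd)] with t hne ht
    refine ⟨Or.inl ⟨hpos t ht, rfl⟩, ?_⟩
    rcases crossingSign_cases hne (hcross t ht) with ⟨h, hsg⟩ | ⟨h, hsg⟩
    · exact Or.inr ⟨by linarith, by rw [hsg]⟩
    · exact Or.inl ⟨by linarith, by rw [hsg, neg_neg]⟩
  rcases lt_or_gt_of_ne hU with h | h
  · exact (main (-p) (-q) (by linarith)).neg
  · exact main p q h

/-- Hate dominates in both groups: off the diagonal, each sign changes at most once. -/
theorem uniqueFrom_of_lt_of_lt (ha : 0 ≤ a) (hc : 0 ≤ c) (hab : a < b) (hcd : c < d)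
    (hne : p ≠ q) : UniqueFrom a b c d p q := by
  have main : ∀ {a b c d : ℝ} (p q : ℝ), 0 ≤ a → 0 ≤ c → a < b → c < d → q < p →
      UniqueFrom a b c d p q := by
    intro a b c d p q ha hc hab hcd hlt
    refine uniqueFrom_of_signs (crossingSign (a * p - b * q) (b - a))
      (fun t => -crossingSign (d * p - c * q) (d - c) t) ?_
    intro T hT P Q hs hP hQ
    have h0 : Q 0 < P 0 := by rwa [hP, hQ]
    have hcross := hs.crossing_of_case4 hT hab hcd ha hc h0
    -- the red form of `(P, Q)` is the blue form of `(-Q, -P)` in the system with exchanged groups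
    have hcross' := hs.neg.swap.crossing_of_case4 hT hcd hab hc ha
      (by simpa using h0)
    simp only [Pi.neg_apply] at hcross'
    rw [hP, hQ] at hcross hcross'
    filter_upwards [ae_crossing_ne_zero (a * p - b * q) (sub_pos.2 hab),
      ae_crossing_ne_zero (d * p - c * q) (sub_pos.2 hcd)] with t hne hne' ht
    refine ⟨crossingSign_cases hne (hcross t ht), ?_⟩
    have e1 : ∀ x y : ℝ, c * -x - d * -y = d * y - c * x := fun x y => by ring
    simp only [e1] at hcross'
    rcases crossingSign_cases hne' (hcross' t ht) with ⟨h, hsg⟩ | ⟨h, hsg⟩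
    · exact Or.inr ⟨by linarith, by rw [hsg]⟩
    · exact Or.inl ⟨by linarith, by rw [hsg, neg_neg]⟩
  rcases lt_or_gt_of_ne hne with h | h
  · exact (main q p hc ha hcd hab h).swap
  · exact main p q ha hc hab hcd h

/-- The three regimes of `uniqueFrom_of_le_of_le`, `uniqueFrom_of_le_of_lt` and
`uniqueFrom_of_lt_of_lt`, the second one also with the groups exchanged. -/
theorem uniqueFrom (ha : 0 ≤ a) (hb : 0 ≤ b) (hc : 0 ≤ c) (hd : 0 ≤ d)
    (hU : a * p - b * q = 0 → a < b) (hV : c * q - d * p = 0 → c < d)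
    (hne : ¬ ((c < d ∧ a < b) ∧ p = q)) : UniqueFrom a b c d p q := by
  rcases le_or_gt b a with hba | hab
  · have hU' : a * p - b * q ≠ 0 := fun h => (hU h).not_ge hba
    rcases le_or_gt d c with hdc | hcd
    · exact uniqueFrom_of_le_of_le hb hd hba hdc hU' fun h => (hV h).not_ge hdc
    · exact uniqueFrom_of_le_of_lt hb hc hba hcd hU'
  · rcases le_or_gt d c with hdc | hcd
    · exact (uniqueFrom_of_le_of_lt hd ha hdc hab fun h => (hV h).not_ge hdc).swap
    · exact uniqueFrom_of_lt_of_lt ha hc hab hcd fun h => hne ⟨⟨hcd, hab⟩, h⟩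

/-- On the diagonal, if hate dominates in both groups, both forms have the sign opposite to that of
`p` until the solution reaches the origin. -/
theorem IsSignSolution.eq_of_diagonal {T : ℝ} {P Q : ℝ → ℝ} (h : IsSignSolution a b c d T P Q)
    (hT : 0 ≤ T) (hab : a < b) (hcd : c < d) (hP : P 0 = p) (hQ : Q 0 = p)
    (hTp : Real.exp T ≤ 1 + p) : ∀ t ∈ Icc 0 T, P t = 1 + p - Real.exp t ∧
      Q t = 1 + p - Real.exp t := by
  have hPc := continuousOn_of_ac hT h.ac_fst
  have hQc := continuousOn_of_ac hT h.ac_snd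
  have formula : ∀ t ∈ Icc 0 T, (∀ s ∈ Ioo 0 t, a * P s - b * Q s < 0 ∧ c * Q s - d * P s < 0) →
      P t = 1 + p - Real.exp t ∧ Q t = 1 + p - Real.exp t := by
    intro t ht hneg
    have hsub : uIcc 0 t ⊆ uIcc 0 T := by
      rw [uIcc_of_le hT, uIcc_of_le ht.1]; exact Icc_subset_Icc le_rfl ht.2
    have hexp := (ac_const_mul_exp 1 T).mono hsub
    simp only [one_mul] at hexp
    have e0 : ∀ᵐ t : ℝ, t ≠ 0 := by simp [ae_iff, measure_singleton]
    have e1 : ∀ᵐ s : ℝ, s ≠ t := by simp [ae_iff, measure_singleton]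
    have hd : ∀ᵐ s, s ∈ uIcc 0 t → HasDerivAt (fun s => P s + Real.exp s) 0 s ∧
        HasDerivAt (fun s => Q s + Real.exp s) 0 s := by
      rw [uIcc_of_le ht.1]
      filter_upwards [h.ae_deriv, e0, e1] with s hs n0 n1 hmem
      have hmem' : s ∈ Ioo 0 t := ⟨lt_of_le_of_ne hmem.1 n0.symm, lt_of_le_of_ne hmem.2 n1⟩
      obtain ⟨σ, τ, h1, h2, -, -, -, h6, -, h8⟩ := hs ⟨hmem'.1, hmem'.2.trans_le ht.2⟩
      rw [h6 (hneg s hmem').1] at h1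
      rw [h8 (hneg s hmem').2] at h2
      have d1 := h1.add (Real.hasDerivAt_exp s)
      have d2 := h2.add (Real.hasDerivAt_exp s)
      rw [neg_one_mul, neg_add_cancel] at d1 d2
      exact ⟨d1, d2⟩
    obtain ⟨C, hC⟩ := ((h.ac_fst.mono hsub).add hexp).const_of_ae_hasDerivAt_zero
      (by filter_upwards [hd] with s hs hm; exact (hs hm).1)
    obtain ⟨C', hC'⟩ := ((h.ac_snd.mono hsub).add hexp).const_of_ae_hasDerivAt_zero
      (by filter_upwards [hd] with s hs hm; exact (hs hm).2)
    have c1 := hC 0 left_mem_uIcc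
    have c2 := hC t right_mem_uIcc
    have c3 := hC' 0 left_mem_uIcc
    have c4 := hC' t right_mem_uIcc
    simp only [Pi.add_apply, hP, hQ, Real.exp_zero] at c1 c2 c3 c4
    constructor <;> linarith
  have hlt : ∀ t, 0 ≤ t → t < T → Real.exp t < 1 + p := fun t _ htT =>
    (Real.exp_lt_exp.2 htT).trans_le hTp
  have neg : ∀ t, 0 ≤ t → t < T → max (a * P t - b * Q t) (c * Q t - d * P t) < 0 := by
    intro t ht0 htT
    have hp0 : 0 < p := by linarith [hlt t ht0 htT, Real.one_le_exp ht0]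
    by_contra hcon
    rw [not_lt] at hcon
    have hcont : ContinuousOn (fun t => max (a * P t - b * Q t) (c * Q t - d * P t)) (Icc 0 t) := by
      have i1 := hPc.mono (Icc_subset_Icc le_rfl htT.le)
      have i2 := hQc.mono (Icc_subset_Icc le_rfl htT.le)
      exact ((i1.const_mul a).sub (i2.const_mul b)).sup ((i2.const_mul c).sub (i1.const_mul d))
    obtain ⟨t₁, ht₁, hge, hbefore⟩ := exists_first_nonneg ht0 hcont (by
      rw [hP, hQ, max_lt_iff]; constructor <;> nlinarith) hcon
    obtain ⟨f1, f2⟩ := formula t₁ ⟨ht₁.1.le, ht₁.2.trans htT.le⟩ fun s hs =>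
      max_lt_iff.1 (hbefore s ⟨hs.1.le, hs.2⟩)
    have hx : 0 < 1 + p - Real.exp t₁ := by linarith [hlt t₁ ht₁.1.le (ht₁.2.trans_lt htT)]
    simp only [f1, f2] at hge
    rcases le_max_iff.1 hge with h' | h' <;> nlinarith
  exact fun t ht => formula t ht fun s hs => max_lt_iff.1 (neg s hs.1.le (hs.2.trans_le ht.2))

end Uniqueness

/-! ### From Filippov solutions to the sign system -/

/-- A bound for a linear functional on the values of `g` near `x` passes to the Filippov set. -/
theorem le_of_mem_filippovMap {g : ℝ × ℝ → ℝ × ℝ} {x w : ℝ × ℝ} (hw : w ∈ filippovMap g x)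
    (l : ℝ × ℝ →L[ℝ] ℝ) {φ : ℝ × ℝ → ℝ} (hφ : ContinuousAt φ x)
    (h : ∀ᶠ y in 𝓝 x, l (g y) ≤ φ y) : l w ≤ φ x := by
  refine le_of_forall_pos_le_add fun η hη => ?_
  have hev : ∀ᶠ y in 𝓝 x, l (g y) ≤ φ x + η := by
    filter_upwards [h, hφ.eventually (gt_mem_nhds (show φ x < φ x + η by linarith))] with y h1 h2
    linarith
  obtain ⟨ε, hε, hball⟩ := Metric.eventually_nhds_iff_ball.1 hev
  rw [filippovMap, mem_iInter₂] at hw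
  have hsub : closedConvexHull ℝ (g '' Metric.ball x ε) ⊆ {v | l v ≤ φ x + η} := by
    refine closedConvexHull_min ?_ ?_ ?_
    · rintro _ ⟨y, hy, rfl⟩
      exact hball y hy
    · exact convex_halfSpace_le l.toLinearMap.isLinear _
    · exact isClosed_le l.continuous continuous_const
  exact hsub (hw ε hε)

theorem self_mem_filippovMap (g : ℝ × ℝ → ℝ × ℝ) (x : ℝ × ℝ) : g x ∈ filippovMap g x := by
  rw [filippovMap, mem_iInter₂]
  exact fun ε hε => subset_closedConvexHull ⟨x, Metric.mem_ball_self hε, rfl⟩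

/-- One coordinate of the Filippov set without inertia: it is determined off the line `f = 0`, and
bounded on it.  The first two bounds hold outside the unit square as well, where they show that
solutions cannot leave it. -/
theorem coord_of_mem_filippovMap {g : ℝ × ℝ → ℝ × ℝ} (l : ℝ × ℝ →L[ℝ] ℝ) {f : ℝ × ℝ → ℝ}
    (hf : Continuous f) (hg : ∀ y, l (g y) = groupDrift 0 (l y) (f y) (f y)) {x w : ℝ × ℝ}
    (hw : w ∈ filippovMap g x) :
    l w ≤ max 0 (1 - l x) ∧ min 0 (-l x) ≤ l w ∧ (0 < f x → l w = 1 - l x) ∧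
      (f x < 0 → l w = -l x) := by
  have hpos : ∀ y, 0 < f y → l (g y) = 1 - l y := fun y hy => by
    rw [hg, groupDrift, if_pos hy, if_neg (by rw [neg_zero]; exact hy.le.not_gt)]; ring
  have hneg : ∀ y, f y < 0 → l (g y) = -l y := fun y hy => by
    rw [hg, groupDrift, if_neg hy.le.not_gt, if_pos (by rwa [neg_zero])]; ring
  have hzero : ∀ y, f y = 0 → l (g y) = 0 := fun y hy => by
    rw [hg, groupDrift, hy, if_neg (lt_irrefl _), if_neg (by simp)]; ring
  have upper := fun (φ : ℝ × ℝ → ℝ) (hφ : Continuous φ) (h : ∀ᶠ y in 𝓝 x, l (g y) ≤ φ y) =>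
    le_of_mem_filippovMap hw l hφ.continuousAt h
  have lower := fun (φ : ℝ × ℝ → ℝ) (hφ : Continuous φ) (h : ∀ᶠ y in 𝓝 x, φ y ≤ l (g y)) => by
    have := le_of_mem_filippovMap hw (-l) (φ := fun y => -φ y) hφ.neg.continuousAt (by
      filter_upwards [h] with y hy
      simpa using hy)
    simpa using this
  have hl := l.continuous
  refine ⟨upper (fun y => max 0 (1 - l y)) (by fun_prop) (Eventually.of_forall fun y => ?_),
    lower (fun y => min 0 (-l y)) (by fun_prop) (Eventually.of_forall fun y => ?_), fun h => ?_,
    fun h => ?_⟩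
  · rcases lt_trichotomy (f y) 0 with h | h | h
    · rw [hneg y h]; exact le_trans (by linarith) (le_max_right _ _)
    · rw [hzero y h]; exact le_max_left _ _
    · rw [hpos y h]; exact le_max_right _ _
  · rcases lt_trichotomy (f y) 0 with h | h | h
    · rw [hneg y h]; exact min_le_right _ _
    · rw [hzero y h]; exact min_le_left _ _
    · rw [hpos y h]; exact (min_le_right _ _).trans (by linarith)
  · have hev : ∀ᶠ y in 𝓝 x, l (g y) = 1 - l y :=
      (hf.continuousAt.eventually (lt_mem_nhds h)).mono hpos
    exact le_antisymm (upper (fun y => 1 - l y) (by fun_prop) (hev.mono fun y hy => hy.le))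
      (lower (fun y => 1 - l y) (by fun_prop) (hev.mono fun y hy => hy.ge))
  · have hev : ∀ᶠ y in 𝓝 x, l (g y) = -l y :=
      (hf.continuousAt.eventually (gt_mem_nhds h)).mono hneg
    exact le_antisymm (upper (fun y => -l y) (by fun_prop) (hev.mono fun y hy => hy.le))
      (lower (fun y => -l y) (by fun_prop) (hev.mono fun y hy => hy.ge))

theorem mem_unitInterval_of_ae {X : ℝ → ℝ} {T : ℝ} (hT : 0 ≤ T)
    (hX : AbsolutelyContinuousOnInterval X 0 T) (h0 : 0 ≤ X 0 ∧ X 0 ≤ 1)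
    (h : ∀ᵐ t, t ∈ Ioo 0 T → ∃ D, D ≤ max 0 (1 - X t) ∧ min 0 (-X t) ≤ D ∧ HasDerivAt X D t) :
    ∀ t ∈ Icc 0 T, 0 ≤ X t ∧ X t ≤ 1 := by
  have h1 := nonneg_of_ae_deriv_nonneg hT hX h0.1 (by
    filter_upwards [h] with t ht hmem hneg
    obtain ⟨D, -, hD, hd⟩ := ht hmem
    rw [min_eq_left (by linarith)] at hD
    exact ⟨D, hD, hd⟩)
  have hconst : AbsolutelyContinuousOnInterval (fun _ : ℝ => (1 : ℝ)) 0 T :=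
    ((LipschitzWith.const (1 : ℝ)).lipschitzOnWith (s := uIcc 0 T)).absolutelyContinuousOnInterval
  have h2 := nonneg_of_ae_deriv_nonneg hT (hconst.sub hX) (by simpa using h0.2) (by
    filter_upwards [h] with t ht hmem hneg
    obtain ⟨D, hD, -, hd⟩ := ht hmem
    simp only [Pi.sub_apply] at hneg
    rw [max_eq_left (by linarith)] at hD
    exact ⟨0 - D, by linarith, (hasDerivAt_const t (1 : ℝ)).sub hd⟩)
  intro t ht
  have := h2 t ht
  simp only [Pi.sub_apply] at this
  exact ⟨h1 t ht, by linarith⟩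

/-- The coordinate `eᵗ (2 θ - 1)` of the sign system. -/
noncomputable def rescale (X : ℝ → ℝ) (t : ℝ) : ℝ := (2 * X t - 1) * Real.exp t

theorem hasDerivAt_rescale {X : ℝ → ℝ} {D t : ℝ} (h : HasDerivAt X D t) :
    HasDerivAt (rescale X) ((2 * D + (2 * X t - 1)) * Real.exp t) t := by
  have e : (2 * D + (2 * X t - 1)) * Real.exp t =
      2 * D * Real.exp t + (2 * X t - 1) * Real.exp t := by ring
  rw [e]
  exact ((h.const_mul 2).sub_const 1).mul (Real.hasDerivAt_exp t)

theorem ac_rescale {X : ℝ → ℝ} {T : ℝ} (hX : AbsolutelyContinuousOnInterval X 0 T) :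
    AbsolutelyContinuousOnInterval (rescale X) 0 T := by
  have hconst : AbsolutelyContinuousOnInterval (fun _ : ℝ => (1 : ℝ)) 0 T :=
    ((LipschitzWith.const (1 : ℝ)).lipschitzOnWith (s := uIcc 0 T)).absolutelyContinuousOnInterval
  have hexp := ac_const_mul_exp 1 T
  simp only [one_mul] at hexp
  exact ((hX.const_mul 2).sub hconst).mul hexp

/-- Rescaling by `eᵗ` removes the linear part of the mean field and leaves the signs of the fields
as the right-hand side. -/
theorem isSignSolution_of_isFilippovSolutionOn {α β r T : ℝ} (hT : 0 ≤ T) {x : ℝ → ℝ × ℝ}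
    (hx : IsFilippovSolutionOn (meanField α β 0 r) T x) (h0 : x 0 ∈ Icc (0 : ℝ × ℝ) 1) :
    IsSignSolution (α * (1 - r)) (β * r) (α * r) (β * (1 - r)) T
      (rescale fun t => (x t).1) (rescale fun t => (x t).2) := by
  obtain ⟨a1, a2, hae⟩ := hx.absolutelyContinuous_and_ae hT
  have hblue : Continuous (blueField α β r) := by unfold blueField; fun_prop
  have hredc : Continuous (redField α β r) := by unfold redField; fun_prop
  have c1 : ∀ {p w : ℝ × ℝ}, w ∈ filippovMap (meanField α β 0 r) p → _ := fun {p w} hw =>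
    coord_of_mem_filippovMap (ContinuousLinearMap.fst ℝ ℝ ℝ) hblue (fun y => rfl) hw
  have c2 : ∀ {p w : ℝ × ℝ}, w ∈ filippovMap (meanField α β 0 r) p → _ := fun {p w} hw =>
    coord_of_mem_filippovMap (ContinuousLinearMap.snd ℝ ℝ ℝ) hredc (fun y => rfl) hw
  simp only [ContinuousLinearMap.coe_fst', ContinuousLinearMap.coe_snd'] at c1 c2
  obtain ⟨h01, h02⟩ := mem_unitSquare.1 h0
  have b1 := mem_unitInterval_of_ae hT a1 h01 (by
    filter_upwards [hae] with t ht hmem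
    obtain ⟨w, hw, d1, -⟩ := ht hmem
    exact ⟨w.1, (c1 hw).1, (c1 hw).2.1, d1⟩)
  have b2 := mem_unitInterval_of_ae hT a2 h02 (by
    filter_upwards [hae] with t ht hmem
    obtain ⟨w, hw, -, d2⟩ := ht hmem
    exact ⟨w.2, (c2 hw).1, (c2 hw).2.1, d2⟩)
  refine ⟨ac_rescale a1, ac_rescale a2, ?_⟩
  filter_upwards [hae] with t ht hmem
  obtain ⟨w, hw, d1, d2⟩ := ht hmem
  obtain ⟨u1, l1, p1, n1⟩ := c1 hw
  obtain ⟨u2, l2, p2, n2⟩ := c2 hw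
  have B1 := b1 t (Ioo_subset_Icc_self hmem)
  have B2 := b2 t (Ioo_subset_Icc_self hmem)
  rw [max_eq_right (by linarith)] at u1 u2
  rw [min_eq_right (by linarith)] at l1 l2
  have hU : α * (1 - r) * rescale (fun t => (x t).1) t - β * r * rescale (fun t => (x t).2) t =
      blueField α β r (x t) * Real.exp t := by
    simp only [rescale, blueField]; ring
  have hV : α * r * rescale (fun t => (x t).2) t - β * (1 - r) * rescale (fun t => (x t).1) t =
      redField α β r (x t) * Real.exp t := by
    simp only [rescale, redField]; ring
  have hexp := Real.exp_pos t
  refine ⟨_, _, hasDerivAt_rescale d1, hasDerivAt_rescale d2, ?_, ?_, ?_, ?_, ?_, ?_⟩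
  · rw [abs_le]; constructor <;> linarith
  · rw [abs_le]; constructor <;> linarith
  · rw [hU]; intro h
    rw [p1 (pos_of_mul_pos_left h hexp.le)]; ring
  · rw [hU]; intro h
    rw [n1 (neg_of_mul_neg_left h hexp.le)]; ring
  · rw [hV]; intro h
    rw [p2 (pos_of_mul_pos_left h hexp.le)]; ring
  · rw [hV]; intro h
    rw [n2 (neg_of_mul_neg_left h hexp.le)]; ring

theorem IsFilippovSolutionOn.mono {g : ℝ × ℝ → ℝ × ℝ} {S T : ℝ} {x : ℝ → ℝ × ℝ} (hST : S ≤ T)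
    (hx : IsFilippovSolutionOn g T x) : IsFilippovSolutionOn g S x := by
  obtain ⟨y, hy, hmem, hint⟩ := hx
  have hsub : Icc 0 S ⊆ Icc 0 T := Icc_subset_Icc le_rfl hST
  exact ⟨y, hy.mono_set hsub, ae_restrict_of_ae_restrict_of_subset hsub hmem,
    fun t ht => hint t (hsub ht)⟩

theorem eqOn_of_uniqueFrom {α β r : ℝ} {θ₀ : ℝ × ℝ} (hθ₀ : θ₀ ∈ Icc (0 : ℝ × ℝ) 1)
    (hu : UniqueFrom (α * (1 - r)) (β * r) (α * r) (β * (1 - r)) (2 * θ₀.1 - 1) (2 * θ₀.2 - 1))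
    {T : ℝ} (hT : 0 ≤ T) {x y : ℝ → ℝ × ℝ} (hx0 : x 0 = θ₀) (hy0 : y 0 = θ₀)
    (hx : IsFilippovSolutionOn (meanField α β 0 r) T x)
    (hy : IsFilippovSolutionOn (meanField α β 0 r) T y) : EqOn x y (Icc 0 T) := by
  intro t ht
  have := hu T hT _ _ _ _ (isSignSolution_of_isFilippovSolutionOn hT hx (hx0 ▸ hθ₀))
    (isSignSolution_of_isFilippovSolutionOn hT hy (hy0 ▸ hθ₀)) (by simp [rescale, hx0])
    (by simp [rescale, hx0]) (by simp [rescale, hy0]) (by simp [rescale, hy0]) t ht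
  simp only [rescale] at this
  have hexp := (Real.exp_pos t).ne'
  have e1 := mul_right_cancel₀ hexp this.1
  have e2 := mul_right_cancel₀ hexp this.2
  exact Prod.ext (by linarith) (by linarith)

/-- Local solutions that are unique fit together to a global one. -/
theorem exists_global_of_unique {g : ℝ × ℝ → ℝ × ℝ} {θ₀ : ℝ × ℝ}
    (hex : ∀ T, 0 ≤ T → ∃ x, x 0 = θ₀ ∧ IsFilippovSolutionOn g T x)
    (huniq : ∀ T, 0 ≤ T → ∀ x y : ℝ → ℝ × ℝ, x 0 = θ₀ → y 0 = θ₀ → IsFilippovSolutionOn g T x →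
      IsFilippovSolutionOn g T y → EqOn x y (Icc 0 T)) :
    ∃ x : ℝ → ℝ × ℝ, x 0 = θ₀ ∧ IsFilippovSolution g x ∧
      ∀ T ≥ (0 : ℝ), ∀ y : ℝ → ℝ × ℝ, y 0 = θ₀ → IsFilippovSolutionOn g T y →
        EqOn y x (Icc 0 T) := by
  choose! X hX0 hX using hex
  have key : ∀ T ≥ (0 : ℝ), ∀ y : ℝ → ℝ × ℝ, y 0 = θ₀ → IsFilippovSolutionOn g T y →
      EqOn y (fun t => X t t) (Icc 0 T) := fun T _ y hy0 hy t ht =>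
    huniq t ht.1 y (X t) hy0 (hX0 t ht.1) (hy.mono ht.2) (hX t ht.1) ⟨ht.1, le_rfl⟩
  exact ⟨fun t => X t t, hX0 0 le_rfl, fun T hT =>
    (hX T hT).congr (key T hT (X T) (hX0 T hT) (hX T hT)), key⟩

/-! ### Two solutions that branch at the centre -/

/-- A solution that follows the diagonal to the centre of the square and then turns off it: with
`s = 1` the blue share grows and the red share decreases after the centre, with `s = -1` it is the
other way round.  It starts at the point `1 / 2 + s (κ - 1) / 2` of the diagonal. -/
noncomputable def branch (s κ t : ℝ) : ℝ × ℝ :=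
  ((1 + s * |1 - κ * Real.exp (-t)|) / 2, (1 + s * (κ * Real.exp (-t) - 1)) / 2)

theorem hasDerivAt_branch {α β r s κ t : ℝ} (h4 : IsCase4 α β r) (hα : 0 ≤ α)
    (hr : r ∈ Ioo (0 : ℝ) 1) (hs : s = 1 ∨ s = -1) (ht : κ * Real.exp (-t) ≠ 1) :
    HasDerivAt (branch s κ) (meanField α β 0 r (branch s κ t)) t := by
  obtain ⟨h41, h42⟩ := h4
  have hq : 0 < 1 - r := by linarith [hr.2]
  have ha : 0 ≤ α * (1 - r) := by positivity
  have hc : 0 ≤ α * r := mul_nonneg hα hr.1.le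
  have he : HasDerivAt (fun t => κ * Real.exp (-t)) (-(κ * Real.exp (-t))) t := by
    have := ((hasDerivAt_neg t).exp).const_mul κ
    simpa using this
  set z := κ * Real.exp (-t) with hz
  have hred : HasDerivAt (fun t => (1 + s * (κ * Real.exp (-t) - 1)) / 2) (s * -z / 2) t :=
    (((he.sub_const 1).const_mul s).const_add 1).div_const 2
  rcases lt_or_gt_of_ne ht with h | h
  · -- after the centre
    have habs : HasDerivAt (fun t => |1 - κ * Real.exp (-t)|) z t := by
      have h1 : HasDerivAt (fun t => 1 - κ * Real.exp (-t)) z t := by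
        simpa using he.const_sub 1
      refine h1.congr_of_eventuallyEq ?_
      filter_upwards [h1.continuousAt.eventually (lt_mem_nhds (show 0 < 1 - κ * Real.exp (-t) by
        rw [← hz]; linarith))] with u hu
      exact abs_of_pos hu
    have hblue : HasDerivAt (fun t => (1 + s * |1 - κ * Real.exp (-t)|) / 2) (s * z / 2) t :=
      ((habs.const_mul s).const_add 1).div_const 2
    have hbr : branch s κ t = ((1 + s * (1 - z)) / 2, (1 + s * (z - 1)) / 2) := by
      rw [branch, ← hz, abs_of_pos (by linarith)]
    have hu : blueField α β r (branch s κ t) = s * ((α * (1 - r) + β * r) * (1 - z)) := by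
      rw [hbr, blueField]; ring
    have hv : redField α β r (branch s κ t) = s * (-((α * r + β * (1 - r)) * (1 - z))) := by
      rw [hbr, redField]; ring
    have k1 : 0 < (α * (1 - r) + β * r) * (1 - z) := mul_pos (by linarith) (by linarith)
    have k2 : 0 < (α * r + β * (1 - r)) * (1 - z) := mul_pos (by linarith) (by linarith)
    have hval : meanField α β 0 r (branch s κ t) = (s * z / 2, s * -z / 2) := by
      rw [meanField_eq_groupDrift, hu, hv, hbr]
      rcases hs with rfl | rfl <;> ext <;>
        simp only [groupDrift, gt_iff_lt, neg_zero, one_mul, neg_mul, neg_neg, Left.neg_pos_iff,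
          Left.neg_neg_iff, k1, k2, k1.le.not_gt, k2.le.not_gt, if_true, if_false] <;> ring
    rw [hval]
    exact hblue.prodMk hred
  · -- before the centre
    have habs : HasDerivAt (fun t => |1 - κ * Real.exp (-t)|) (-z) t := by
      have h1 : HasDerivAt (fun t => -(1 - κ * Real.exp (-t))) (-z) t := by
        have h0 := (he.const_sub 1).neg
        rw [neg_neg] at h0
        exact h0
      refine h1.congr_of_eventuallyEq ?_
      filter_upwards [h1.continuousAt.eventually (lt_mem_nhds (show 0 < -(1 - κ * Real.exp (-t)) by
        rw [← hz]; linarith))] with u hu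
      exact abs_of_neg (by linarith)
    have hblue : HasDerivAt (fun t => (1 + s * |1 - κ * Real.exp (-t)|) / 2) (s * -z / 2) t :=
      ((habs.const_mul s).const_add 1).div_const 2
    have hbr : branch s κ t = ((1 + s * (z - 1)) / 2, (1 + s * (z - 1)) / 2) := by
      rw [branch, ← hz, abs_of_neg (by linarith)]; ring_nf
    have hu : blueField α β r (branch s κ t) = s * (-((β * r - α * (1 - r)) * (z - 1))) := by
      rw [hbr, blueField]; ring
    have hv : redField α β r (branch s κ t) = s * (-((β * (1 - r) - α * r) * (z - 1))) := by
      rw [hbr, redField]; ring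
    have k1 : 0 < (β * r - α * (1 - r)) * (z - 1) := mul_pos (by linarith) (by linarith)
    have k2 : 0 < (β * (1 - r) - α * r) * (z - 1) := mul_pos (by linarith) (by linarith)
    have hval : meanField α β 0 r (branch s κ t) = (s * -z / 2, s * -z / 2) := by
      rw [meanField_eq_groupDrift, hu, hv, hbr]
      rcases hs with rfl | rfl <;> ext <;>
        simp only [groupDrift, gt_iff_lt, neg_zero, one_mul, neg_mul, neg_neg, Left.neg_pos_iff,
          Left.neg_neg_iff, k1, k2, k1.le.not_gt, k2.le.not_gt, if_true, if_false] <;> ring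
    rw [hval]
    exact hblue.prodMk hred

theorem ac_branch (s κ T : ℝ) :
    AbsolutelyContinuousOnInterval (fun t => (branch s κ t).1) 0 T ∧
      AbsolutelyContinuousOnInterval (fun t => (branch s κ t).2) 0 T := by
  have hz : ContDiff ℝ 1 fun t : ℝ => 1 - κ * Real.exp (-t) := by fun_prop
  obtain ⟨K, hK⟩ := (hz.contDiffOn (s := uIcc 0 T)).exists_lipschitzOnWith (by decide)
    (convex_Icc _ _) isCompact_Icc
  have habs : LipschitzOnWith (1 * K) (fun t : ℝ => |1 - κ * Real.exp (-t)|) (uIcc 0 T) :=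
    lipschitzWith_one_norm.comp_lipschitzOnWith hK
  have hconst : AbsolutelyContinuousOnInterval (fun _ : ℝ => (1 / 2 : ℝ)) 0 T :=
    ((LipschitzWith.const _).lipschitzOnWith (s := uIcc 0 T)).absolutelyContinuousOnInterval
  constructor
  · refine (hconst.add (habs.absolutelyContinuousOnInterval.const_mul (s / 2))).congr_uIcc ?_
    intro t _
    simp only [branch, Pi.add_apply]; ring
  · have : ContDiff ℝ 1 fun t : ℝ => (1 + s * (κ * Real.exp (-t) - 1)) / 2 := by fun_prop
    exact this.contDiffOn.absolutelyContinuousOnInterval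

theorem ae_branch_ne (κ : ℝ) : ∀ᵐ t : ℝ, κ * Real.exp (-t) ≠ 1 := by
  have : {t : ℝ | ¬ κ * Real.exp (-t) ≠ 1}.Subsingleton := by
    intro s hs t ht
    simp only [ne_eq, not_not, mem_ofPred_eq] at hs ht
    have hκ : κ ≠ 0 := by rintro rfl; simp at hs
    have := Real.exp_injective (mul_left_cancel₀ hκ (hs.trans ht.symm))
    linarith
  exact this.measure_zero _

theorem isFilippovSolution_branch {α β r s : ℝ} (κ : ℝ) (h4 : IsCase4 α β r) (hα : 0 ≤ α)
    (hr : r ∈ Ioo (0 : ℝ) 1) (hs : s = 1 ∨ s = -1) :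
    IsFilippovSolution (meanField α β 0 r) (branch s κ) := by
  intro T hT
  refine isFilippovSolutionOn_of_ae hT (ac_branch s κ T).1 (ac_branch s κ T).2 ?_
  filter_upwards [ae_branch_ne κ] with t ht _ w hw
  rw [hw.unique (hasDerivAt_branch h4 hα hr hs ht)]
  exact self_mem_filippovMap _ _

/-- Exchanging the two groups turns the mean field for `r` into that for `1 - r`. -/
theorem isFilippovSolution_swap_branch {α β r s : ℝ} (κ : ℝ) (h4 : IsCase4 α β r) (hα : 0 ≤ α)
    (hr : r ∈ Ioo (0 : ℝ) 1) (hs : s = 1 ∨ s = -1) :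
    IsFilippovSolution (meanField α β 0 r) fun t => (branch s κ t).swap := by
  intro T hT
  refine isFilippovSolutionOn_of_ae hT (ac_branch s κ T).2 (ac_branch s κ T).1 ?_
  filter_upwards [ae_branch_ne κ] with t ht _ w hw
  have h4' : IsCase4 α β (1 - r) := by
    rw [IsCase4, sub_sub_cancel]; exact ⟨h4.2, h4.1⟩
  have hd := hasDerivAt_branch h4' hα ⟨by linarith [hr.2], by linarith [hr.1]⟩ hs ht
  have hswap : meanField α β 0 r (branch s κ t).swap =
      (meanField α β 0 (1 - r) (branch s κ t)).swap := by
    simp only [meanField_eq_groupDrift, blueField, redField, Prod.fst_swap, Prod.snd_swap,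
      sub_sub_cancel, Prod.swap_prod_mk]
  have hd' : HasDerivAt (fun t => (branch s κ t).swap)
      (meanField α β 0 (1 - r) (branch s κ t)).swap t :=
    ((ContinuousLinearMap.snd ℝ ℝ ℝ).hasFDerivAt.comp_hasDerivAt t hd).prodMk
      ((ContinuousLinearMap.fst ℝ ℝ ℝ).hasFDerivAt.comp_hasDerivAt t hd)
  rw [hw.unique hd', ← hswap]
  exact self_mem_filippovMap _ _

/-- In Case 4 all solutions that start on the diagonal agree until they reach the centre. -/
theorem diagonal_solution_eq {α β r T : ℝ} (h4 : IsCase4 α β r) {θ₀ : ℝ × ℝ}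
    (hθ₀ : θ₀ ∈ Icc (0 : ℝ × ℝ) 1) (hdiag : θ₀.1 = θ₀.2) (hT : 0 ≤ T)
    (hTθ : Real.exp T ≤ 1 + |2 * θ₀.1 - 1|) {x : ℝ → ℝ × ℝ} (hx0 : x 0 = θ₀)
    (hx : IsFilippovSolutionOn (meanField α β 0 r) T x) {s : ℝ} (hs : s = 1 ∨ s = -1)
    (hs' : |2 * θ₀.1 - 1| = s * (2 * θ₀.1 - 1)) {t : ℝ} (ht : t ∈ Icc 0 T) :
    (2 * (x t).1 - 1) * Real.exp t = s * (1 + |2 * θ₀.1 - 1| - Real.exp t) ∧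
      (2 * (x t).2 - 1) * Real.exp t = s * (1 + |2 * θ₀.1 - 1| - Real.exp t) := by
  have hsol := isSignSolution_of_isFilippovSolutionOn hT hx (hx0 ▸ hθ₀)
  rcases hs with rfl | rfl
  · have := hsol.eq_of_diagonal hT h4.2 h4.1
      (by simp only [rescale, hx0, Real.exp_zero]; rw [hs']; ring)
      (by simp only [rescale, hx0, Real.exp_zero]; rw [← hdiag, hs']; ring) hTθ t ht
    simpa only [rescale, one_mul] using this
  · have := hsol.neg.eq_of_diagonal hT h4.2 h4.1
      (by simp only [Pi.neg_apply, rescale, hx0, Real.exp_zero]; rw [hs']; ring)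
      (by simp only [Pi.neg_apply, rescale, hx0, Real.exp_zero]; rw [← hdiag, hs']; ring) hTθ t ht
    simp only [rescale, Pi.neg_apply] at this
    constructor <;> linarith

end AffectivePolarization

namespace AffectivePolarization

/-! ### Convergence, uniqueness and non-uniqueness -/

/-- The process is an approximate solution with high probability, and approximate solutions are
close to Filippov solutions. -/
theorem convergence {α β δ r : ℝ} (hα : α ∈ Icc (0 : ℝ) 1) (hβ : β ∈ Icc (0 : ℝ) 1)
    (hr : r ∈ Ioo (0 : ℝ) 1) (hδ : 0 ≤ δ) (V : ℕ → Type*)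
    [∀ n, Fintype (V n)] [∀ n, Nonempty (V n)] [∀ n, MeasurableSpace (V n)]
    [∀ n, DiscreteMeasurableSpace (V n)] (party c₀ : ∀ n, V n → Bool)
    (hcard : Tendsto (fun n => Fintype.card (V n)) atTop atTop)
    (hred : Tendsto (fun n => redFraction (party n)) atTop (𝓝 r)) :
    (∀ T > (0 : ℝ), ∀ ε > (0 : ℝ),
      Tendsto (fun n => ⨆ t' ∈ Ici (0 : ℝ), selectionLaw (V n)
        {ω | ENNReal.ofReal ε < distToSet T
          (fun t => interpolation α β δ ⊤ (party n) (c₀ n) ω (t' + t))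
          (solutionSet (meanField α β δ r) T (Icc 0 1))}) atTop (𝓝 0)) ∧
    (∀ θ₀ : ℝ × ℝ, Tendsto (fun n => state (party n) (c₀ n)) atTop (𝓝 θ₀) →
      ∀ T > (0 : ℝ), ∀ ε > (0 : ℝ),
      Tendsto (fun n => selectionLaw (V n)
        {ω | ENNReal.ofReal ε < distToSet T
          (interpolation α β δ ⊤ (party n) (c₀ n) ω)
          (solutionSet (meanField α β δ r) T {θ₀})}) atTop (𝓝 0)) := by
  have hC : 0 ≤ 2 / min r (1 - r) := by
    have : 0 < min r (1 - r) := lt_min hr.1 (by linarith [hr.2])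
    positivity
  constructor
  · intro T hT ε hε
    have hK : IsCompact (Icc (0 : ℝ × ℝ) 1) := isCompact_Icc
    obtain ⟨η, hη, H⟩ := exists_approx_precision (g := meanField α β δ r) hT.le hC hε hK
    refine tendsto_of_tendsto_of_tendsto_of_le_of_le tendsto_const_nhds
      (tendsto_iSup_measure_not_isApproxSolution hα hβ hr hδ V party c₀ hcard hred hT hη)
      (fun _ => zero_le) fun n => ?_
    refine iSup₂_mono fun t' _ => measure_mono fun ω hω happ => ?_
    obtain ⟨x, hx, hclose⟩ := H _ happ ⟨_, state_mem _ _, (dist_self _).trans_le hη.le⟩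
    exact (distToSet_le hx hclose).not_gt hω
  · intro θ₀ hθ₀ T hT ε hε
    obtain ⟨η, hη, H⟩ := exists_approx_precision (g := meanField α β δ r) hT.le hC hε
      (isCompact_singleton (x := θ₀))
    refine tendsto_of_tendsto_of_tendsto_of_le_of_le' tendsto_const_nhds
      (tendsto_iSup_measure_not_isApproxSolution hα hβ hr hδ V party c₀ hcard hred hT hη)
      (Eventually.of_forall fun _ => zero_le) ?_
    filter_upwards [Metric.tendsto_nhds.1 hθ₀ η hη] with n hn
    have hle := le_iSup₂ (f := fun t' (_ : t' ∈ Ici (0 : ℝ)) => selectionLaw (V n)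
      {ω | ¬ IsApproxSolution (meanField α β δ r) T (2 / min r (1 - r)) η
        (fun t => interpolation α β δ ⊤ (party n) (c₀ n) ω (t' + t))}) 0 (mem_Ici.2 le_rfl)
    have hsub : {ω | ENNReal.ofReal ε < distToSet T (interpolation α β δ ⊤ (party n) (c₀ n) ω)
        (solutionSet (meanField α β δ r) T {θ₀})} ⊆
        {ω | ¬ IsApproxSolution (meanField α β δ r) T (2 / min r (1 - r)) η
          (fun t => interpolation α β δ ⊤ (party n) (c₀ n) ω (0 + t))} := by
      intro ω hω happ
      simp only [zero_add] at happ
      obtain ⟨x, hx, hclose⟩ := H _ happ ⟨θ₀, rfl, by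
        simpa [interpolation, choices] using hn.le⟩
      exact (distToSet_le hx hclose).not_gt hω
    exact (measure_mono hsub).trans hle

/-- Euler polygons give a solution on every `[0, T]`; by uniqueness for the sign system these
solutions fit together. -/
theorem uniqueness {α β r : ℝ} (hα : α ∈ Icc (0 : ℝ) 1) (hβ : β ∈ Icc (0 : ℝ) 1)
    (hr : r ∈ Ioo (0 : ℝ) 1) {θ₀ : ℝ × ℝ} (hθ₀ : θ₀ ∈ Icc (0 : ℝ × ℝ) 1)
    (hu : blueField α β r θ₀ = 0 → α * (1 - r) < β * r)
    (hv : redField α β r θ₀ = 0 → α * r < β * (1 - r))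
    (hne : ¬ (IsCase4 α β r ∧ θ₀.1 = θ₀.2)) :
    ∃ x : ℝ → ℝ × ℝ, x 0 = θ₀ ∧ IsFilippovSolution (meanField α β 0 r) x ∧
      ∀ T ≥ (0 : ℝ), ∀ y : ℝ → ℝ × ℝ, y 0 = θ₀ → IsFilippovSolutionOn (meanField α β 0 r) T y →
        EqOn y x (Icc 0 T) := by
  have hq : 0 ≤ 1 - r := by linarith [hr.2]
  have huniq := uniqueFrom (p := 2 * θ₀.1 - 1) (q := 2 * θ₀.2 - 1) (mul_nonneg hα.1 hq)
    (mul_nonneg hβ.1 hr.1.le) (mul_nonneg hα.1 hr.1.le) (mul_nonneg hβ.1 hq) hu hv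
    fun h => hne ⟨h.1, by linarith [h.2]⟩
  exact exists_global_of_unique
    (fun T hT => exists_isFilippovSolutionOn (fun x hx => add_meanField_mem le_rfl hx) hT hθ₀)
    fun T hT x y hx0 hy0 hx hy => eqOn_of_uniqueFrom hθ₀ huniq hT hx0 hy0 hx hy

/-- All solutions follow the diagonal to the centre, which they reach at time
`log (1 + |2 θ₀ - 1|)`; there `branch` and its mirror image turn off to different sides. -/
theorem nonuniqueness {α β r : ℝ} (hα : α ∈ Icc (0 : ℝ) 1)
    (hr : r ∈ Ioo (0 : ℝ) 1) (h4 : IsCase4 α β r) {θ₀ : ℝ × ℝ} (hθ₀ : θ₀ ∈ Icc (0 : ℝ × ℝ) 1)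
    (hdiag : θ₀.1 = θ₀.2) :
    ∃ τ ≥ (0 : ℝ),
      (∀ x y : ℝ → ℝ × ℝ, x 0 = θ₀ → y 0 = θ₀ →
        IsFilippovSolution (meanField α β 0 r) x → IsFilippovSolution (meanField α β 0 r) y →
        x τ = (1 / 2, 1 / 2) ∧ EqOn x y (Icc 0 τ)) ∧
      ∃ x y : ℝ → ℝ × ℝ, x 0 = θ₀ ∧ y 0 = θ₀ ∧
        IsFilippovSolution (meanField α β 0 r) x ∧ IsFilippovSolution (meanField α β 0 r) y ∧
        ∃ t > τ, x t ≠ y t := by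
  obtain ⟨s, hs, hs'⟩ : ∃ s : ℝ, (s = 1 ∨ s = -1) ∧ |2 * θ₀.1 - 1| = s * (2 * θ₀.1 - 1) := by
    rcases le_total 0 (2 * θ₀.1 - 1) with h | h
    · exact ⟨1, Or.inl rfl, by rw [abs_of_nonneg h, one_mul]⟩
    · exact ⟨-1, Or.inr rfl, by rw [abs_of_nonpos h, neg_one_mul]⟩
  have hss : s * s = 1 := by rcases hs with rfl | rfl <;> norm_num
  -- with this `κ`, `branch s κ` starts at `θ₀` and reaches the centre when `eᵗ = κ`
  set κ : ℝ := 1 + |2 * θ₀.1 - 1| with hκ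
  have hκ1 : 1 ≤ κ := by linarith [abs_nonneg (2 * θ₀.1 - 1)]
  have hκ0 : 0 < κ := by linarith
  have hexp : Real.exp (Real.log κ) = κ := Real.exp_log hκ0
  have hτ : 0 ≤ Real.log κ := Real.log_nonneg hκ1
  refine ⟨Real.log κ, hτ, ?_, ?_⟩
  · intro x y hx0 hy0 hx hy
    have ex := fun t ht => diagonal_solution_eq h4 hθ₀ hdiag hτ hexp.le hx0 (hx _ hτ) hs hs'
      (t := t) ht
    have ey := fun t ht => diagonal_solution_eq h4 hθ₀ hdiag hτ hexp.le hy0 (hy _ hτ) hs hs'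
      (t := t) ht
    constructor
    · have := ex _ ⟨hτ, le_rfl⟩
      rw [hexp, ← hκ, sub_self, mul_zero, mul_eq_zero, mul_eq_zero] at this
      have e1 := this.1.resolve_right hκ0.ne'
      have e2 := this.2.resolve_right hκ0.ne'
      exact Prod.ext (by simp only; linarith) (by simp only; linarith)
    · intro t ht
      have hpos := (Real.exp_pos t).ne'
      have e1 := mul_right_cancel₀ hpos ((ex t ht).1.trans (ey t ht).1.symm)
      have e2 := mul_right_cancel₀ hpos ((ex t ht).2.trans (ey t ht).2.symm)
      exact Prod.ext (by linarith) (by linarith)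
  · have hsp : s * (κ - 1) = 2 * θ₀.1 - 1 := by
      rw [hκ, add_sub_cancel_left, hs', ← mul_assoc, hss, one_mul]
    have h0 : branch s κ 0 = (θ₀.1, θ₀.1) := by
      rw [branch, neg_zero, Real.exp_zero, mul_one, abs_of_nonpos (by linarith), neg_sub, hsp]
      ext <;> simp only <;> ring
    refine ⟨branch s κ, fun t => (branch s κ t).swap, ?_, ?_,
      isFilippovSolution_branch κ h4 hα.1 hr hs,
      isFilippovSolution_swap_branch κ h4 hα.1 hr hs, Real.log κ + 1, by linarith, ?_⟩
    · rw [h0]; exact Prod.ext rfl hdiag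
    · simp only [h0]; exact Prod.ext rfl hdiag
    · intro heq
      have h1 := congrArg Prod.fst heq
      have hz : κ * Real.exp (-(Real.log κ + 1)) < 1 := by
        rw [neg_add, Real.exp_add, Real.exp_neg, hexp, ← mul_assoc,
          mul_inv_cancel₀ hκ0.ne', one_mul]
        exact (Real.exp_lt_exp.2 neg_one_lt_zero).trans_eq Real.exp_zero
      simp only [branch, Prod.fst_swap] at h1
      rw [abs_of_pos (by linarith)] at h1
      rcases hs with rfl | rfl <;> linarith

end AffectivePolarization

open AffectivePolarization in
theorem mainTheorem3 (α β r : ℝ) (hα : α ∈ Icc (0 : ℝ) 1) (hβ : β ∈ Icc (0 : ℝ) 1)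
    (hr : r ∈ Ioo (0 : ℝ) 1) :
    -- Convergence on complete graphs whose number of nodes tends to infinity.
    (∀ δ ∈ Icc (0 : ℝ) 1, ∀ (V : ℕ → Type*) [∀ n, Fintype (V n)] [∀ n, Nonempty (V n)]
      [∀ n, MeasurableSpace (V n)] [∀ n, DiscreteMeasurableSpace (V n)]
      (party c₀ : ∀ n, V n → Bool),
      Tendsto (fun n => Fintype.card (V n)) atTop atTop →
      Tendsto (fun n => redFraction (party n)) atTop (𝓝 r) →
      -- Every window `[t', t' + T]`: convergence in probability, uniformly in `t'`.
      (∀ T > (0 : ℝ), ∀ ε > (0 : ℝ),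
        Tendsto (fun n => ⨆ t' ∈ Ici (0 : ℝ), selectionLaw (V n)
          {ω | ENNReal.ofReal ε < distToSet T
            (fun t => interpolation α β δ ⊤ (party n) (c₀ n) ω (t' + t))
            (solutionSet (meanField α β δ r) T (Icc 0 1))}) atTop (𝓝 0)) ∧
      -- Initial states that converge to `θ₀`: the limit solutions start at `θ₀`.
      (∀ θ₀ : ℝ × ℝ, Tendsto (fun n => state (party n) (c₀ n)) atTop (𝓝 θ₀) →
        ∀ T > (0 : ℝ), ∀ ε > (0 : ℝ),
        Tendsto (fun n => selectionLaw (V n)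
          {ω | ENNReal.ofReal ε < distToSet T
            (interpolation α β δ ⊤ (party n) (c₀ n) ω)
            (solutionSet (meanField α β δ r) T {θ₀})}) atTop (𝓝 0))) ∧
    -- Uniqueness, without inertia.
    (∀ θ₀ ∈ Icc (0 : ℝ × ℝ) 1,
      (blueField α β r θ₀ = 0 → α * (1 - r) < β * r) →
      (redField α β r θ₀ = 0 → α * r < β * (1 - r)) →
      ¬ (IsCase4 α β r ∧ θ₀.1 = θ₀.2) →
      ∃ x : ℝ → ℝ × ℝ, x 0 = θ₀ ∧ IsFilippovSolution (meanField α β 0 r) x ∧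
        ∀ T ≥ (0 : ℝ), ∀ y : ℝ → ℝ × ℝ, y 0 = θ₀ → IsFilippovSolutionOn (meanField α β 0 r) T y →
          EqOn y x (Icc 0 T)) ∧
    -- The symmetric trajectory in Case 4 is unique until it reaches `(1/2, 1/2)`, and not after.
    (IsCase4 α β r → ∀ θ₀ ∈ Icc (0 : ℝ × ℝ) 1, θ₀.1 = θ₀.2 →
      ∃ τ ≥ (0 : ℝ),
        (∀ x y : ℝ → ℝ × ℝ, x 0 = θ₀ → y 0 = θ₀ →
          IsFilippovSolution (meanField α β 0 r) x → IsFilippovSolution (meanField α β 0 r) y →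
          x τ = (1 / 2, 1 / 2) ∧ EqOn x y (Icc 0 τ)) ∧
        ∃ x y : ℝ → ℝ × ℝ, x 0 = θ₀ ∧ y 0 = θ₀ ∧
          IsFilippovSolution (meanField α β 0 r) x ∧ IsFilippovSolution (meanField α β 0 r) y ∧
          ∃ t > τ, x t ≠ y t) := by
  refine ⟨fun δ hδ V _ _ _ _ party c₀ hcard hred =>
      convergence hα hβ hr hδ.1 V party c₀ hcard hred,
    fun θ₀ hθ₀ hu hv hne => uniqueness hα hβ hr hθ₀ hu hv hne,
    fun h4 θ₀ hθ₀ hdiag => nonuniqueness hα hr h4 hθ₀ hdiag⟩
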